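/- Let $T>0$, let $f_0\ge 0$ be a bounded measurable function on $\mathbb R^3\times\mathbb R^3$ and $(\xi_0,\eta_0)\in\mathbb R^3\times\mathbb R^3$. For a density $f\ge0$ put $\rho(s,x)=\int f(s,x,v)\,dv$, $E(s,x)=\int\frac{x-y}{|x-y|^3}\rho(s,y)\,dy$, and, for a trajectory $\xi$, $F(s,x)=\frac{x-\xi(s)}{|x-\xi(s)|^3}$ and $b(s,x,v)=(v,E(s,x)+F(s,x))$. Assume that $$M(0)=\iint f_0\,dx\,dv<1,\qquad H(0)=\iint\tfrac{|v|^2}{2}f_0\,dx\,dv+\tfrac{|\eta_0|^2}{2}+\tfrac12\iint\tfrac{\rho_0(x)\rho_0(y)}{|x-y|}\,dx\,dy+\int\tfrac{\rho_0(x)}{|x-\xi_0|}\,dx<\infty ,$$ where $\rho_0=\int f_0\,dv$, and put $\mu=f_0\,\mathcal L^6$. *Flows.* For $t\in[0,T)$, a measurable map $Z:[t,T]\times\mathbb R^6\to\mathbb R^6$ is a $\mu$-regular Lagrangian flow relative to $b$ starting at time $t$, with compression constant $L<\infty$, if: $Z\in C([t,T];L^0_{\rm loc}(\mu))$ (local convergence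 in measure); $\int_{B_R}\log(1+\log(1+|Z(s,z)|^2))\,d\mu(z)$ is bounded in $s\in[t,T]$ for every $R$; for every $\beta\in C^1(\mathbb R^6;\mathbb R)$ satisfying, for some $C$, $|\beta(z)|\le C(1+\log(1+\log(1+|z|^2)))$ and $|\beta'(z)|\le \frac{C|z|}{(1+|z|^2)(1+\log(1+|z|^2))}$, one has for $\mu$-a.e. $z$ that $\partial_s(\beta(Z(s,z)))=\beta'(Z(s,z))\,b(s,Z(s,z))$ in $\mathcal D'((t,T))$ (both $\beta(Z)$ and the right-hand side being locally integrable in $s$); $Z(t,z)=z$ for $\mu$-a.e. $z$; and $Z(s,\cdot)_\#\mu\le L\,\mathcal L^6$ for all $s\in[t,T]$. Its sublevels are $G_\lambda=\{z:|Z(s,z)|\le\lambda\text{ for a.e. }s\in[t,T]\}$. *Solutions.* Let $(f,\xi,\eta)$ be a Lagrangian solution on $[0,T]$ of the Vlasov–Poisson system with a point charge and initial data $f_0,(\xi_0,\eta_0)$: $f\ge 0$ is measurable; $f(s)\mathcal L^6=Y(s,\cdot)_\#\mu$ for all $s\in[0,T]$, for some $\mu$-regular Lagrangian flow $Y$ relative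 to $b$ starting at time $0$; $\dot\xi=\eta$ and $\dot\eta=E(s,\xi)$ on $[0,T]$ with $(\xi,\eta)(0)=(\xi_0,\eta_0)$; and $E\in L^\infty((0,T);C^{0,\alpha}(\mathbb R^3))$ for some $\alpha\in(0,1)$. Then there is a function $g=g(T,N_E,N_f,M,H;r,\lambda)$, chosen once and for all and independent of the data, the solution and the flow, such that for all fixed values of the other arguments with $r>0$ it is nonincreasing in $\lambda>0$ and tends to $0$ as $\lambda\to\infty$, and such that the following holds for all data and solutions as above, all $t\in[0,T)$, every $\mu$-regular Lagrangian flow $Z$ relative to $b$ starting at time $t$, with sublevels $G_\lambda$ and compression constant $L$, and all $r,\lambda>0$. 1. If $f$ is transported by $Z$, that is $Z(s,\cdot)_\#\mu=f(s)\mathcal L^6$ for $s\in[t,T]$, then $$f_0(B_r\setminus G_\lambda):=\mu(B_r\setminus G_\lambda)\le g\big(T,\|E\|_{L^\infty_t L^{5/2}_x},\|f\|_{L^\infty_tL^\infty_{x,v}},M(0),H(0);r,\lambda\big).$$ 2. Without that condition, $$f_0(B_r\setminus G_\lambda)\le g\big(T,\|E\|_{L^\infty_t L^{5/2}_x},\max\{\|f\|_{L^\infty_tL^\infty_{x,v}},L\},M(0),H(0);r,\lambda\big).$$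 In particular, the bound of part 1 holds whenever $L\le\|f\|_{L^\infty_tL^\infty_{x,v}}$. Here the norms are taken over $s\in[0,T]$. -/

import Mathlib

open MeasureTheory Set Filter Topology
open scoped ENNReal

noncomputable section

namespace VPCharge

/-- Physical space `ℝ³` with its Euclidean norm. -/
abbrev Space : Type := EuclideanSpace ℝ (Fin 3)

/-- Phase space `ℝ³ × ℝ³` of pairs `z = (x, v)`, with the product Lebesgue measure `ℒ⁶`. -/
abbrev Phase : Type := Space × Space

/-- The Euclidean norm on `ℝ⁶ = ℝ³ × ℝ³` (the norm Mathlib puts on a product is the maximum). -/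
def phaseNorm (z : Phase) : ℝ := Real.sqrt (‖z.1‖ ^ 2 + ‖z.2‖ ^ 2)

/-- The Euclidean ball `B_r` of `ℝ⁶` about the origin. -/
def phaseBall (r : ℝ) : Set Phase := {z | phaseNorm z < r}

/-! ### The Vlasov-Poisson system with a point charge -/

/-- The Coulomb kernel `x / |x|³`. -/
def coulomb (x : Space) : Space := (‖x‖ ^ 3)⁻¹ • x

/-- The spatial density `ρ(x) = ∫ f(x, v) dv`. -/
def spatialDensity (f : Phase → ℝ) (x : Space) : ℝ := ∫ v, f (x, v)

/-- The self-induced field `E(x) = ∫ (x - y) / |x - y|³ ρ(y) dy` of a density on phase space. -/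
def selfField (f : Phase → ℝ) (x : Space) : Space :=
  ∫ y, spatialDensity f y • coulomb (x - y)

/-- The vector field `b(s, x, v) = (v, E(s, x) + F(s, x))`, where
`F(s, x) = (x - ξ(s)) / |x - ξ(s)|³` is the field of the point charge. -/
def vectorField (f : ℝ → Phase → ℝ) (ξ : ℝ → Space) (s : ℝ) (z : Phase) : Phase :=
  (z.2, selfField (f s) z.1 + coulomb (z.1 - ξ s))

/-- The measure `f ℒ⁶` with density `f ≥ 0`. -/
def densityMeasure (f : Phase → ℝ) : Measure Phase :=
  volume.withDensity fun z => ENNReal.ofReal (f z)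

/-- The total charge `∬ f dx dv`. -/
def totalCharge (f : Phase → ℝ) : ℝ≥0∞ := ∫⁻ z, ENNReal.ofReal (f z)

/-- The total energy
`∬ |v|²/2 f + |η|²/2 + 1/2 ∬ ρ(x) ρ(y) / |x - y| + ∫ ρ(x) / |x - ξ|`. -/
def totalEnergy (f : Phase → ℝ) (ξ η : Space) : ℝ≥0∞ :=
  (∫⁻ z : Phase, ENNReal.ofReal (‖z.2‖ ^ 2 / 2 * f z))
    + ENNReal.ofReal (‖η‖ ^ 2 / 2)
    + (1 / 2) * (∫⁻ x : Space, ∫⁻ y : Space,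
        ENNReal.ofReal (spatialDensity f x * spatialDensity f y / ‖x - y‖))
    + ∫⁻ x : Space, ENNReal.ofReal (spatialDensity f x / ‖x - ξ‖)

/-- The norm `‖f‖` of `L^∞((0,T); L^∞(ℝ³ × ℝ³))`. -/
def densityNorm (T : ℝ) (f : ℝ → Phase → ℝ) : ℝ≥0∞ :=
  essSup (fun s => eLpNorm (f s) ∞ volume) (volume.restrict (Icc 0 T))

/-- The norm `‖E‖` of `L^∞((0,T); L^{5/2}(ℝ³))`, for the self-induced field of `f`. -/
def fieldNorm (T : ℝ) (f : ℝ → Phase → ℝ) : ℝ≥0∞ :=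
  essSup (fun s => eLpNorm (selfField (f s)) (5 / 2) volume) (volume.restrict (Icc 0 T))

/-! ### Regular Lagrangian flows in the renormalized sense -/

/-- The renormalizations `β ∈ C¹(ℝ⁶; ℝ)` with
`|β(z)| ≤ C (1 + log (1 + log (1 + |z|²)))` and
`|β'(z)| ≤ C |z| / ((1 + |z|²) (1 + log (1 + |z|²)))`. -/
def IsRenormalization (β : Phase → ℝ) : Prop :=
  ContDiff ℝ 1 β ∧ ∃ C : ℝ, ∀ z : Phase,
    |β z| ≤ C * (1 + Real.log (1 + Real.log (1 + phaseNorm z ^ 2))) ∧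
    ‖fderiv ℝ β z‖ ≤
      C * phaseNorm z / ((1 + phaseNorm z ^ 2) * (1 + Real.log (1 + phaseNorm z ^ 2)))

/-- `u' = w` in the sense of distributions on the open interval `(t, T)`. -/
def HasDistribDerivOn (u w : ℝ → ℝ) (t T : ℝ) : Prop :=
  LocallyIntegrableOn u (Ioo t T) ∧ LocallyIntegrableOn w (Ioo t T) ∧
    ∀ φ : ℝ → ℝ, ContDiff ℝ (⊤ : ℕ∞) φ → HasCompactSupport φ → tsupport φ ⊆ Ioo t T →
      ∫ s, deriv φ s * u s = -∫ s, φ s * w s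

/-- `Z` is a `μ`-regular Lagrangian flow in the renormalized sense, relative to `b` and starting
at time `t`, on the time interval `[t, T]`.

Compression is measured against Lebesgue measure, `Z(s,·)_# μ ≤ L ℒ⁶`. If `μ = h ℒ⁶` with `h`
bounded, this is weaker than `Z(s,·)_# μ ≤ L' μ` (take `L = L' ‖h‖_∞`, as the next lemma shows);
unlike the latter it does not confine the flow to the set where `h` is positive. -/
structure IsRegularLagrangianFlow (μ : Measure Phase) (L : ℝ≥0∞) (b : ℝ → Phase → Phase)
    (t T : ℝ) (Z : ℝ → Phase → Phase) : Prop where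
  measurable : Measurable (Function.uncurry Z)
  /-- `Z` is continuous from `[t, T]` to `L⁰_loc(μ)` (local convergence in measure). -/
  continuous_in_measure : ∀ s₀ ∈ Icc t T, ∀ R : ℝ,
    TendstoInMeasure (μ.restrict (phaseBall R)) Z (𝓝[Icc t T] s₀) (Z s₀)
  /-- `Z` is bounded from `[t, T]` to `log log L_loc(μ)`. -/
  bounded_loglog : ∀ R : ℝ, ∃ C : ℝ, ∀ s ∈ Icc t T,
    ∫⁻ z in phaseBall R,
      ENNReal.ofReal (Real.log (1 + Real.log (1 + phaseNorm (Z s z) ^ 2))) ∂μ ≤ ENNReal.ofReal C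
  /-- `∂ₛ (β(Z(s, z))) = β'(Z(s, z)) b(s, Z(s, z))` in `𝒟'((t, T))`. -/
  renormalized : ∀ β : Phase → ℝ, IsRenormalization β → ∀ᵐ z ∂μ,
    HasDistribDerivOn (fun s => β (Z s z)) (fun s => fderiv ℝ β (Z s z) (b s (Z s z))) t T
  initial : ∀ᵐ z ∂μ, Z t z = z
  compression : ∀ s ∈ Icc t T, μ.map (Z s) ≤ L • (volume : Measure Phase)

/-- Compression relative to `μ = h ℒ⁶` implies compression relative to `ℒ⁶`. -/
theorem compression_of_relative {h : Phase → ℝ} {L' C : ℝ≥0∞} {Y : Phase → Phase}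
    (hC : ∀ z, ENNReal.ofReal (h z) ≤ C)
    (hY : (densityMeasure h).map Y ≤ L' • densityMeasure h) :
    (densityMeasure h).map Y ≤ (L' * C) • (volume : Measure Phase) := by
  have h1 : densityMeasure h ≤ C • (volume : Measure Phase) := by
    rw [← withDensity_const]
    exact withDensity_mono (Eventually.of_forall hC)
  refine hY.trans ?_
  rw [mul_smul]
  intro B
  simp only [Measure.smul_apply, smul_eq_mul]
  gcongr
  simpa using h1 B

/-- The sublevel `G_λ` of `Z` on `[t, T]`. -/
def sublevel (Z : ℝ → Phase → Phase) (t T lam : ℝ) : Set Phase :=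
  {z | ∀ᵐ s ∂(volume.restrict (Icc t T)), phaseNorm (Z s z) ≤ lam}

/-- `(f, ξ, η)` is a Lagrangian solution on `[0, T]` of the Vlasov-Poisson system with a point
charge, with initial data `f₀` and `(ξ₀, η₀)`: the density is transported by a Lagrangian flow of
`b = (v, E + F)`, the charge obeys `ξ' = η`, `η' = E(s, ξ)`, and `E ∈ L^∞((0,T); C^{0,α})`. -/
structure IsLagrangianSolution (T : ℝ) (f₀ : Phase → ℝ) (ξ₀ η₀ : Space)
    (f : ℝ → Phase → ℝ) (ξ η : ℝ → Space) : Prop where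
  measurable : Measurable (Function.uncurry f)
  nonneg : ∀ s z, 0 ≤ f s z
  field_holder : ∃ α : ℝ, 0 < α ∧ α < 1 ∧ ∃ C : ℝ,
    ∀ᵐ s ∂(volume.restrict (Icc 0 T)),
      (∀ x, ‖selfField (f s) x‖ ≤ C) ∧
      ∀ x y, ‖selfField (f s) x - selfField (f s) y‖ ≤ C * ‖x - y‖ ^ α
  initial_position : ξ 0 = ξ₀
  initial_velocity : η 0 = η₀
  position : ∀ s ∈ Icc 0 T, HasDerivWithinAt ξ (η s) (Icc 0 T) s
  velocity : ∀ s ∈ Icc 0 T, HasDerivWithinAt η (selfField (f s) (ξ s)) (Icc 0 T) s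
  /-- `f(s) ℒ⁶ = Y(s,·)_# (f₀ ℒ⁶)` for a regular Lagrangian flow `Y` starting at time `0`. -/
  transported : ∃ (L : ℝ≥0∞) (Y : ℝ → Phase → Phase), L ≠ ∞ ∧
    IsRegularLagrangianFlow (densityMeasure f₀) L (vectorField f ξ) 0 T Y ∧
    ∀ s ∈ Icc 0 T, (densityMeasure f₀).map (Y s) = densityMeasure (f s)

end VPCharge

end

namespace VPCharge

/-! ### Calculus along absolutely continuous curves -/

/-! The modulus is the worst case: the supremum `escapeMass` of the escaping mass over all data,
solutions and flows with horizon `T`, a bound `N` on density and compression, and energy `H`. It is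
at most one, and it decreases in the radius because sublevels grow. Everything rests on
`exists_sublevel_radius`: up to mass `ε`, the particles of a ball stay in a larger ball whose radius
depends only on `T`, `N`, `H`, `r` and `ε`.

Let `y` be the position relative to the charge and let `K - 1` bound the speed of the charge. The
motion of the charge changes the energy `|v|²/2 + 1/|y|` at a rate of size up to `(K - 1)/|y|²`,
which is not integrable uniformly. Subtracting `K` times the radial velocity compensates this,
because the repulsion makes the radial velocity grow at rate `1/|y|²`. The logarithm of the
resulting `lyapunov` function grows at a rate of at most a constant times `|E|/(1 + |v|)`, plus a
constant (`fderiv_log_lyapunov_le`). So the speed is controlled by the initial distance to the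
charge and by the action `∫ |E|/(1 + |v|) ds`. The action has a finite mean: `|E|` is dominated by
the potential with kernel `|x|⁻²`, and a splitting by the sizes of the two velocities and the
distance bounds its weighted average through `N` and the kinetic energy
(`exists_lintegral_speedKernel_bound`). By Markov's inequality few particles feel a large action,
and few start near the charge because the density is bounded.

The kinetic energy and the speed of the charge are bounded by the initial energy
(`IsSelfConsistent.energy_le`). This follows by integrating energy identities of single particles
and of pairs. The exchanges of integrals use a uniform bound on `∫ ρ(y)/|x - y|² dy`, which Hölder
continuity of `E` yields through Gauss' law (`exists_lintegral_inv_sq_bound`). That bound and the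
sup norm of `E` are only qualitative: they do not enter the modulus.

All this needs genuine trajectories, whereas a renormalized flow only provides distributional
equations for `β(Z)`. `IsRegularLagrangianFlow.ae_isTrajectory` shows that almost every curve agrees
a.e. in time with an integral curve on `[t, T]` that avoids the charge. Suitable `β` keep the curve
away from infinity and from the origin, cut-off linear forms give the vector equation, and the
compression makes `|x - ξ|⁻²` integrable in time, which forbids a collision. -/

/-- The fundamental theorem of calculus for `Φ ∘ p`, where `p` has an a.e. bounded derivative. -/
theorem integral_fderiv_comp_eq_sub {F : Type*} [NormedAddCommGroup F] [NormedSpace ℝ F]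
    [CompleteSpace F] {p q : ℝ → F} {a b K : ℝ} {U : Set F} {Φ : F → ℝ} (hab : a ≤ b)
    (hU : IsOpen U) (hΦ : ContDiffOn ℝ 1 Φ U) (hp : ∀ s ∈ Icc a b, p s ∈ U)
    (hq : IntervalIntegrable q volume a b)
    (hpq : ∀ s ∈ Icc a b, p s = p a + ∫ τ in a..s, q τ)
    (hK : ∀ᵐ s ∂(volume.restrict (Ioc a b)), ‖q s‖ ≤ K) :
    IntervalIntegrable (fun s => fderiv ℝ Φ (p s) (q s)) volume a b ∧
      ∫ s in a..b, fderiv ℝ Φ (p s) (q s) = Φ (p b) - Φ (p a) := by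
  have hK' : ∀ᵐ s, s ∈ Ioc a b → ‖q s‖ ≤ K := (ae_restrict_iff' measurableSet_Ioc).1 hK
  have hlip : LipschitzOnWith (Real.toNNReal K) p (Icc a b) := by
    refine LipschitzOnWith.of_dist_le_mul fun s hs s' hs' => ?_
    have hI : ∀ u ∈ Icc a b, IntervalIntegrable q volume a u := fun u hu =>
      hq.mono_set (by rw [uIcc_of_le hab, uIcc_of_le hu.1]; exact Icc_subset_Icc_right hu.2)
    rw [dist_eq_norm, hpq s hs, hpq s' hs', add_sub_add_left_eq_sub,
      intervalIntegral.integral_interval_sub_left (hI s hs) (hI s' hs')]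
    have h1 : ‖∫ τ in s'..s, q τ‖ ≤ (Real.toNNReal K : ℝ) * |s - s'| := by
      refine intervalIntegral.norm_integral_le_of_norm_le_const_ae ?_
      filter_upwards [hK'] with u hu hu'
      refine (hu ?_).trans (Real.le_coe_toNNReal K)
      rcases le_total s' s with h | h
      · rw [uIoc_of_le h] at hu'; exact ⟨hs'.1.trans_lt hu'.1, hu'.2.trans hs.2⟩
      · rw [uIoc_of_ge h] at hu'; exact ⟨hs.1.trans_lt hu'.1, hu'.2.trans hs'.2⟩
    rwa [Real.dist_eq]
  -- `Φ` is only locally Lipschitz, and only on `U`. Compactness of `[a, b]` makes the composite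
  -- Lipschitz, hence absolutely continuous, although `p` is differentiable only almost everywhere.
  have hloc : LocallyLipschitzOn (Icc a b) (fun s => Φ (p s)) := by
    intro s hs
    obtain ⟨K₁, V, hV, hVl⟩ := (hΦ.contDiffAt (hU.mem_nhds (hp s hs))).exists_lipschitzOnWith
    refine ⟨K₁ * Real.toNNReal K, Icc a b ∩ p ⁻¹' V, ?_, ?_⟩
    · exact inter_mem self_mem_nhdsWithin ((hlip.continuousOn s hs) hV)
    · exact hVl.comp (hlip.mono inter_subset_left) (fun u hu => hu.2)
  obtain ⟨K₂, hK₂⟩ := hloc.exists_lipschitzOnWith_of_compact isCompact_Icc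
  have hac : AbsolutelyContinuousOnInterval (fun s => Φ (p s)) a b := by
    apply LipschitzOnWith.absolutelyContinuousOnInterval (K := K₂)
    rwa [uIcc_of_le hab]
  have hderiv : ∀ᵐ s, s ∈ uIoc a b →
      deriv (fun s => Φ (p s)) s = fderiv ℝ Φ (p s) (q s) := by
    have hne : ∀ᵐ s : ℝ, s ≠ b := by simp [ae_iff, measure_singleton]
    filter_upwards [hq.ae_hasDerivAt_integral, hne] with s hs hsb hsI
    rw [uIoc_of_le hab] at hsI
    have hsI' : s ∈ Ioo a b := ⟨hsI.1, lt_of_le_of_ne hsI.2 hsb⟩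
    have h1 := hs (by rw [uIcc_of_le hab]; exact Ioc_subset_Icc_self hsI) a left_mem_uIcc
    have h2 : HasDerivAt p (q s) s := by
      refine (h1.const_add (p a)).congr_of_eventuallyEq ?_
      filter_upwards [Ioo_mem_nhds hsI'.1 hsI'.2] with u hu
      exact hpq u (Ioo_subset_Icc_self hu)
    have h3 : HasFDerivAt Φ (fderiv ℝ Φ (p s)) (p s) :=
      ((hΦ.contDiffAt (hU.mem_nhds (hp s (Ioc_subset_Icc_self hsI)))).differentiableAt
        one_ne_zero).hasFDerivAt
    exact (h3.comp_hasDerivAt s h2).deriv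
  constructor
  · exact hac.intervalIntegrable_deriv.congr_ae ((ae_restrict_iff' measurableSet_uIoc).2 hderiv)
  · rw [← hac.integral_deriv_eq_sub]
    apply intervalIntegral.integral_congr_ae
    filter_upwards [hderiv] with s hs hs'
    exact (hs hs').symm

/-- A Lipschitz curve along which `‖y‖⁻²` is integrable does not reach the origin. -/
theorem ne_zero_of_lintegral_inv_sq_ne_top {F : Type*} [NormedAddCommGroup F] {y : ℝ → F}
    {a b K : ℝ} (hab : a < b) (hy : ∀ s ∈ Icc a b, ∀ s' ∈ Icc a b, ‖y s - y s'‖ ≤ K * |s - s'|)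
    (hint : ∫⁻ s in Icc a b, (‖y s‖ₑ ^ 2)⁻¹ ≠ ∞) : ∀ s ∈ Icc a b, y s ≠ 0 := by
  intro s₀ hs₀ h0
  have hK0 : 0 ≤ K := by
    have := (norm_nonneg _).trans (hy a ⟨le_rfl, hab.le⟩ b ⟨hab.le, le_rfl⟩)
    have h2 : 0 < |a - b| := abs_pos.2 (by linarith)
    exact nonneg_of_mul_nonneg_left this h2
  set I := ∫⁻ s in Icc a b, (‖y s‖ₑ ^ 2)⁻¹ with hI
  -- If the curve vanishes at `s₀`, then `‖y‖ ≤ (K + 1) h` on an interval of length `h` beside `s₀`,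
  -- so the integral is at least `1 / ((K + 1)² h)`. This blows up as `h` tends to zero. `K + 1`
  -- avoids a division by zero.
  have key : ∀ h : ℝ, 0 < h → h ≤ (b - a) / 2 → ((K + 1) ^ 2 * h)⁻¹ ≤ I.toReal := by
    intro h hh hh2
    obtain ⟨J, hJm, hJs, hJv, hJd⟩ : ∃ J : Set ℝ, MeasurableSet J ∧ J ⊆ Icc a b ∧
        volume J = ENNReal.ofReal h ∧ ∀ s ∈ J, |s - s₀| ≤ h := by
      -- The interval is laid on the side of `s₀` where at least half of `[a, b]` remains.
      rcases le_total s₀ ((a + b) / 2) with hc | hc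
      · refine ⟨Icc s₀ (s₀ + h), measurableSet_Icc, Icc_subset_Icc hs₀.1 (by linarith),
          by simp, fun s hs => ?_⟩
        rw [abs_of_nonneg (by linarith [hs.1])]; linarith [hs.2]
      · refine ⟨Icc (s₀ - h) s₀, measurableSet_Icc, Icc_subset_Icc (by linarith) hs₀.2,
          by simp, fun s hs => ?_⟩
        rw [abs_of_nonpos (by linarith [hs.2])]; linarith [hs.1]
    have h1 : ENNReal.ofReal (((K + 1) ^ 2 * h)⁻¹) ≤ I := by
      calc ENNReal.ofReal (((K + 1) ^ 2 * h)⁻¹)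
          = ENNReal.ofReal ((((K + 1) * h) ^ 2)⁻¹) * volume J := by
            rw [hJv, ← ENNReal.ofReal_mul (by positivity)]
            congr 1; field_simp
        _ = ∫⁻ s in J, ENNReal.ofReal ((((K + 1) * h) ^ 2)⁻¹) := by
            rw [setLIntegral_const]
        _ ≤ ∫⁻ s in J, (‖y s‖ₑ ^ 2)⁻¹ := by
            refine setLIntegral_mono' hJm fun s hs => ?_
            rw [ENNReal.ofReal_inv_of_pos (by positivity)]
            refine ENNReal.inv_le_inv.2 ?_
            rw [← ofReal_norm, ← ENNReal.ofReal_pow (norm_nonneg _)]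
            refine ENNReal.ofReal_le_ofReal (pow_le_pow_left₀ (norm_nonneg _) ?_ 2)
            have := hy s (hJs hs) s₀ hs₀
            rw [h0, sub_zero] at this
            have h2 := hJd s hs
            nlinarith [abs_nonneg (s - s₀)]
        _ ≤ I := lintegral_mono_set hJs
    rwa [ENNReal.ofReal_le_iff_le_toReal hint] at h1
  have hA : 0 ≤ I.toReal := ENNReal.toReal_nonneg
  set A := I.toReal
  set h := min ((b - a) / 2) (((K + 1) ^ 2 * (A + 1))⁻¹) with hh
  have hpos : 0 < h := lt_min (by linarith) (by positivity)
  have := key h hpos (min_le_left _ _)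
  have h2 : (K + 1) ^ 2 * h ≤ (A + 1)⁻¹ := by
    calc (K + 1) ^ 2 * h ≤ (K + 1) ^ 2 * ((K + 1) ^ 2 * (A + 1))⁻¹ := by
          gcongr; exact min_le_right _ _
      _ = (A + 1)⁻¹ := by field_simp
  have h3 : A + 1 ≤ ((K + 1) ^ 2 * h)⁻¹ := by
    rw [le_inv_comm₀ (by positivity) (by positivity)]; exact h2
  linarith

/-! ### Distributional derivatives on an interval -/

theorem LocallyIntegrableOn.intervalIntegrable_of_Ioo {F : Type*} [NormedAddCommGroup F]
    {w : ℝ → F} {t T a b : ℝ} (hw : LocallyIntegrableOn w (Ioo t T)) (ha : a ∈ Ioo t T)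
    (hb : b ∈ Ioo t T) : IntervalIntegrable w volume a b := by
  have h : uIcc a b ⊆ Ioo t T := (ordConnected_Ioo.uIcc_subset ha hb)
  exact (hw.integrableOn_compact_subset h isCompact_uIcc).intervalIntegrable

/-- A compactly supported function in `(t, T)` lives in a compact subinterval. -/
theorem exists_tsupport_subset_Ioo {φ : ℝ → ℝ} {t T c : ℝ} (hc : c ∈ Ioo t T)
    (hφ : HasCompactSupport φ) (hs : tsupport φ ⊆ Ioo t T) :
    ∃ a b, a < c ∧ c < b ∧ a ∈ Ioo t T ∧ b ∈ Ioo t T ∧ tsupport φ ⊆ Ioo a b := by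
  have hK : IsCompact (insert c (tsupport φ)) := hφ.isCompact.insert c
  have hKs : insert c (tsupport φ) ⊆ Ioo t T := insert_subset hc hs
  obtain ⟨m, hm, hm'⟩ := hK.exists_isLeast ⟨c, mem_insert _ _⟩
  obtain ⟨M, hM, hM'⟩ := hK.exists_isGreatest ⟨c, mem_insert _ _⟩
  obtain ⟨a, ha, ham⟩ := exists_between (hKs hm).1
  obtain ⟨b, hb, hbM⟩ := exists_between (hKs hM).2
  have h1 := hm' (mem_insert c _)
  have h2 := hM' (mem_insert c _)
  refine ⟨a, b, ham.trans_le h1, h2.trans_lt hb, ⟨ha, ham.trans (hKs hm).2⟩,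
    ⟨(hKs hM).1.trans hb, hbM⟩, fun x hx => ?_⟩
  exact ⟨ham.trans_le (hm' (mem_insert_of_mem _ hx)), (hM' (mem_insert_of_mem _ hx)).trans_lt hb⟩

theorem integral_eq_intervalIntegral_of_support {F : Type*} [NormedAddCommGroup F]
    [NormedSpace ℝ F] {g : ℝ → F} {a b : ℝ} (hab : a ≤ b)
    (hg : ∀ s, s ∉ Ioo a b → g s = 0) : ∫ s, g s = ∫ s in a..b, g s := by
  rw [intervalIntegral.integral_of_le hab, setIntegral_eq_integral_of_forall_compl_eq_zero]
  exact fun s hs => hg s fun h => hs (Ioo_subset_Ioc_self h)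

/-- Integration by parts for absolutely continuous functions, on a compact interval that contains
`c` and the support of `φ`. The boundary terms vanish. -/
theorem integral_deriv_mul_primitive {w φ : ℝ → ℝ} {t T c : ℝ} (hc : c ∈ Ioo t T)
    (hw : LocallyIntegrableOn w (Ioo t T)) (hφ : ContDiff ℝ (⊤ : ℕ∞) φ)
    (hφc : HasCompactSupport φ) (hφs : tsupport φ ⊆ Ioo t T) :
    ∫ s, deriv φ s * ∫ τ in c..s, w τ = -∫ s, φ s * w s := by
  obtain ⟨a, b, hac, hcb, ha, hb, hab⟩ := exists_tsupport_subset_Ioo hc hφc hφs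
  have hle : a ≤ b := (hac.trans hcb).le
  have hwi := LocallyIntegrableOn.intervalIntegrable_of_Ioo hw ha hb
  have hW : AbsolutelyContinuousOnInterval (fun s => ∫ τ in c..s, w τ) a b :=
    hwi.absolutelyContinuousOnInterval_intervalIntegral
      (by rw [uIcc_of_le hle]; exact ⟨hac.le, hcb.le⟩)
  have hφac : AbsolutelyContinuousOnInterval φ a b :=
    (hφ.of_le (by exact_mod_cast le_top)).contDiffOn.absolutelyContinuousOnInterval
  have h0 : ∀ s, s ∉ Ioo a b → φ s = 0 := fun s hs => image_eq_zero_of_notMem_tsupport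
    fun h => hs (hab h)
  have h0' : ∀ s, s ∉ Ioo a b → deriv φ s = 0 := fun s hs =>
    image_eq_zero_of_notMem_tsupport fun h => hs (hab (tsupport_deriv_subset h))
  have key := hφac.integral_mul_deriv_eq_deriv_mul hW
  rw [h0 a (by simp), h0 b (by simp), zero_mul, zero_mul, sub_zero, zero_sub] at key
  rw [integral_eq_intervalIntegral_of_support hle (fun s hs => by rw [h0' s hs, zero_mul]),
    integral_eq_intervalIntegral_of_support hle (fun s hs => by rw [h0 s hs, zero_mul]),
    ← neg_eq_iff_eq_neg, ← key]
  apply intervalIntegral.integral_congr_ae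
  filter_upwards [hwi.ae_hasDerivAt_integral] with s hs hsI
  rw [(hs (uIoc_subset_uIcc hsI) c (by rw [uIcc_of_le hle]; exact ⟨hac.le, hcb.le⟩)).deriv]

theorem continuousOn_primitive_Ioo {F : Type*} [NormedAddCommGroup F] [NormedSpace ℝ F]
    {w : ℝ → F} {t T c : ℝ} (hc : c ∈ Ioo t T) (hw : LocallyIntegrableOn w (Ioo t T)) :
    ContinuousOn (fun s => ∫ τ in c..s, w τ) (Ioo t T) := by
  intro s hs
  obtain ⟨a, ha, has⟩ := exists_between (lt_min hs.1 hc.1)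
  obtain ⟨b, hbs, hb⟩ := exists_between (max_lt hs.2 hc.2)
  have ha' : a ∈ Ioo t T := ⟨ha, has.trans ((min_le_left _ _).trans_lt hs.2)⟩
  have hb' : b ∈ Ioo t T := ⟨hs.1.trans ((le_max_left _ _).trans_lt hbs), hb⟩
  have hle : a ≤ b := (has.trans ((min_le_left _ _).trans_lt ((le_max_left _ _).trans_lt hbs))).le
  have := intervalIntegral.continuousOn_primitive_interval' (μ := volume) (a := c)
    (LocallyIntegrableOn.intervalIntegrable_of_Ioo hw ha' hb')
    (by rw [uIcc_of_le hle]
        exact ⟨(has.trans_le (min_le_right _ _)).le, ((le_max_right _ _).trans_lt hbs).le⟩)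
  rw [uIcc_of_le hle] at this
  exact (this.continuousAt (Icc_mem_nhds (has.trans_le (min_le_left _ _))
    ((le_max_left _ _).trans_lt hbs))).continuousWithinAt

theorem integrable_smul_of_tsupport_subset {F : Type*} [NormedAddCommGroup F] [NormedSpace ℝ F]
    {v : ℝ → F} {φ : ℝ → ℝ} {U : Set ℝ} (hv : LocallyIntegrableOn v U)
    (hφ : Continuous φ) (hφc : HasCompactSupport φ) (hφs : tsupport φ ⊆ U) :
    Integrable fun s => φ s • v s := by
  have h1 : IntegrableOn (fun s => φ s • v s) (tsupport φ) :=
    (hv.integrableOn_compact_subset hφs hφc.isCompact).continuousOn_smul hφ.continuousOn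
      hφc.isCompact
  refine (integrableOn_iff_integrable_of_support_subset ?_).1 h1
  intro s hs
  apply subset_tsupport
  intro h0
  exact hs (by simp [h0])

/-- Continuous linear functionals separate points and commute with the integrals, so the scalar case
suffices. -/
theorem integral_deriv_smul_primitive {F : Type*} [NormedAddCommGroup F] [NormedSpace ℝ F]
    [CompleteSpace F] {w : ℝ → F} {φ : ℝ → ℝ} {t T c : ℝ} (hc : c ∈ Ioo t T)
    (hw : LocallyIntegrableOn w (Ioo t T)) (hφ : ContDiff ℝ (⊤ : ℕ∞) φ)
    (hφc : HasCompactSupport φ) (hφs : tsupport φ ⊆ Ioo t T) :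
    ∫ s, deriv φ s • ∫ τ in c..s, w τ = -∫ s, φ s • w s := by
  refine (SeparatingDual.eq_iff_forall_dual_eq (R := ℝ)).2 fun g => ?_
  have hd : Continuous (deriv φ) :=
    hφ.continuous_deriv (by simp)
  have hW : LocallyIntegrableOn (fun s => ∫ τ in c..s, w τ) (Ioo t T) :=
    (continuousOn_primitive_Ioo hc hw).locallyIntegrableOn measurableSet_Ioo
  have hd' : tsupport (deriv φ) ⊆ Ioo t T := (tsupport_deriv_subset).trans hφs
  have hgw : LocallyIntegrableOn (fun s => g (w s)) (Ioo t T) := by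
    intro x hx
    obtain ⟨s, hs, hs'⟩ := hw x hx
    exact ⟨s, hs, g.integrable_comp hs'⟩
  rw [map_neg, ← g.integral_comp_comm (integrable_smul_of_tsupport_subset hW hd hφc.deriv hd'),
    ← g.integral_comp_comm (integrable_smul_of_tsupport_subset hw hφ.continuous hφc hφs)]
  simp only [map_smul, smul_eq_mul]
  rw [← integral_deriv_mul_primitive hc hgw hφ hφc hφs]
  congr 1
  ext s
  by_cases hs : s ∈ Ioo t T
  · rw [g.intervalIntegral_comp_comm (LocallyIntegrableOn.intervalIntegrable_of_Ioo hw hc hs)]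
  · rw [image_eq_zero_of_notMem_tsupport fun h => hs (hd' h), zero_mul, zero_mul]

/-- A smooth function compactly supported in `(t, T)` with zero integral is the derivative of
another one. -/
theorem exists_primitive_of_integral_eq_zero {θ : ℝ → ℝ} {t T c : ℝ} (hc : c ∈ Ioo t T)
    (hθ : ContDiff ℝ (⊤ : ℕ∞) θ) (hθc : HasCompactSupport θ) (hθs : tsupport θ ⊆ Ioo t T)
    (h0 : ∫ s, θ s = 0) :
    ∃ φ : ℝ → ℝ, ContDiff ℝ (⊤ : ℕ∞) φ ∧ HasCompactSupport φ ∧ tsupport φ ⊆ Ioo t T ∧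
      deriv φ = θ := by
  obtain ⟨a, b, hac, hcb, ha, hb, hab⟩ := exists_tsupport_subset_Ioo hc hθc hθs
  have hz : ∀ s, s ∉ Ioo a b → θ s = 0 := fun s hs => image_eq_zero_of_notMem_tsupport
    fun h => hs (hab h)
  have hle : a ≤ b := (hac.trans hcb).le
  have hdφ : ∀ s, HasDerivAt (fun s => ∫ τ in a..s, θ τ) (θ s) s := fun s =>
    hθ.continuous.integral_hasStrictDerivAt a s |>.hasDerivAt
  have hd : deriv (fun s => ∫ τ in a..s, θ τ) = θ := funext fun s => (hdφ s).deriv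
  have hsupp : Function.support (fun s => ∫ τ in a..s, θ τ) ⊆ Icc a b := by
    intro s hs
    by_contra hsI
    apply hs
    rcases lt_or_ge s a with h | h
    · refine (intervalIntegral.integral_congr (g := fun _ => (0 : ℝ)) fun τ hτ => ?_).trans (by simp)
      rw [uIcc_of_ge h.le] at hτ
      exact hz τ fun h' => absurd h'.1 (not_lt.2 hτ.2)
    · have hbs : b ≤ s := by
        by_contra h2
        exact hsI ⟨h, (not_le.1 h2).le⟩
      change ∫ τ in a..s, θ τ = 0
      rw [← h0, integral_eq_intervalIntegral_of_support h]
      exact fun τ hτ => hz τ fun h' => hτ ⟨h'.1, h'.2.trans_le hbs⟩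
  have hts : tsupport (fun s => ∫ τ in a..s, θ τ) ⊆ Icc a b := closure_minimal hsupp isClosed_Icc
  refine ⟨fun s => ∫ τ in a..s, θ τ, ?_, ?_, hts.trans (Icc_subset_Ioo ha.1 hb.2), hd⟩
  · rw [contDiff_infty_iff_deriv, hd]
    exact ⟨fun s => (hdφ s).differentiableAt, hθ⟩
  · exact HasCompactSupport.of_support_subset_isCompact isCompact_Icc hsupp

/-- The lemma of du Bois-Reymond: a distributional derivative integrates back. -/
theorem ae_eq_primitive_of_distribDeriv {F : Type*} [NormedAddCommGroup F] [NormedSpace ℝ F]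
    [CompleteSpace F] {u w : ℝ → F} {t T c : ℝ} (hc : c ∈ Ioo t T)
    (hu : LocallyIntegrableOn u (Ioo t T)) (hw : LocallyIntegrableOn w (Ioo t T))
    (h : ∀ φ : ℝ → ℝ, ContDiff ℝ (⊤ : ℕ∞) φ → HasCompactSupport φ → tsupport φ ⊆ Ioo t T →
      ∫ s, deriv φ s • u s = -∫ s, φ s • w s) :
    ∃ p : F, ∀ᵐ s, s ∈ Ioo t T → u s = p + ∫ τ in c..s, w τ := by
  have hW : LocallyIntegrableOn (fun s => ∫ τ in c..s, w τ) (Ioo t T) :=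
    (continuousOn_primitive_Ioo hc hw).locallyIntegrableOn measurableSet_Ioo
  -- `v` has zero distributional derivative. It remains to see that it is constant.
  set v : ℝ → F := fun s => u s - ∫ τ in c..s, w τ with hv_def
  have hv : LocallyIntegrableOn v (Ioo t T) := hu.sub hW
  have hv0 : ∀ φ : ℝ → ℝ, ContDiff ℝ (⊤ : ℕ∞) φ → HasCompactSupport φ → tsupport φ ⊆ Ioo t T →
      ∫ s, deriv φ s • v s = 0 := by
    intro φ hφ hφc hφs
    have hd : Continuous (deriv φ) := hφ.continuous_deriv (by simp)
    have hd' : tsupport (deriv φ) ⊆ Ioo t T := (tsupport_deriv_subset).trans hφs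
    simp only [hv_def, smul_sub]
    rw [integral_sub (integrable_smul_of_tsupport_subset hu hd hφc.deriv hd')
      (integrable_smul_of_tsupport_subset hW hd hφc.deriv hd'),
      integral_deriv_smul_primitive hc hw hφ hφc hφs, h φ hφ hφc hφs, sub_self]
  obtain ⟨ε, hε, hεs⟩ := Metric.nhds_basis_closedBall.mem_iff.1 (Ioo_mem_nhds hc.1 hc.2)
  let B : ContDiffBump c := ⟨ε / 2, ε, by positivity, by linarith⟩
  set φ₀ : ℝ → ℝ := B.normed volume
  have hφ₀ : ContDiff ℝ (⊤ : ℕ∞) φ₀ := B.contDiff_normed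
  have hφ₀c : HasCompactSupport φ₀ := B.hasCompactSupport_normed
  have hφ₀s : tsupport φ₀ ⊆ Ioo t T := by
    rw [B.tsupport_normed_eq]; exact hεs
  have hφ₀1 : ∫ s, φ₀ s = 1 := B.integral_normed
  -- The constant is read off by averaging against a bump of mass one.
  refine ⟨∫ s, φ₀ s • v s, ?_⟩
  have hconst : LocallyIntegrableOn (fun _ : ℝ => ∫ s, φ₀ s • v s) (Ioo t T) :=
    continuousOn_const.locallyIntegrableOn measurableSet_Ioo
  have := isOpen_Ioo.ae_eq_zero_of_integral_contDiff_smul_eq_zero (μ := volume)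
    (hv.sub hconst) ?_
  · filter_upwards [this] with s hs hsI
    have h1 := hs hsI
    simp only [hv_def, Pi.sub_apply, sub_eq_zero] at h1
    rw [← h1]; abel
  · intro ψ hψ hψc hψs
    -- Subtracting a multiple of `φ₀` gives mean zero, so that `θ` is the derivative of a test
    -- function and is annihilated by `v`.
    set θ : ℝ → ℝ := fun s => ψ s - (∫ τ, ψ τ) * φ₀ s with hθ_def
    have hψi : Integrable ψ := hψ.continuous.integrable_of_hasCompactSupport hψc
    have hφ₀i : Integrable φ₀ := hφ₀.continuous.integrable_of_hasCompactSupport hφ₀c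
    have hθs : tsupport θ ⊆ tsupport ψ ∪ tsupport φ₀ := by
      refine closure_minimal (fun s hs => ?_) ((isClosed_tsupport ψ).union (isClosed_tsupport φ₀))
      by_contra hcon
      rw [mem_union, not_or] at hcon
      apply hs
      simp [hθ_def, image_eq_zero_of_notMem_tsupport hcon.1,
        image_eq_zero_of_notMem_tsupport hcon.2]
    obtain ⟨φ, hφ, hφc, hφs, hφd⟩ := exists_primitive_of_integral_eq_zero (θ := θ) hc
      (hψ.sub (contDiff_const.mul hφ₀))
      (HasCompactSupport.of_support_subset_isCompact (hψc.isCompact.union hφ₀c.isCompact)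
        ((subset_tsupport θ).trans hθs)) (hθs.trans (union_subset hψs hφ₀s))
      (by simp only [hθ_def]
          rw [integral_sub hψi (hφ₀i.const_mul _), integral_const_mul, hφ₀1, mul_one, sub_self])
    have h1 := hv0 φ hφ hφc hφs
    rw [hφd] at h1
    simp only [hθ_def, sub_smul, mul_smul] at h1
    rw [integral_sub (integrable_smul_of_tsupport_subset hv hψ.continuous hψc hψs)
      ((integrable_smul_of_tsupport_subset hv hφ₀.continuous hφ₀c hφ₀s).fun_smul _),
      integral_smul] at h1
    simp only [Pi.sub_apply, smul_sub]
    rw [integral_sub (integrable_smul_of_tsupport_subset hv hψ.continuous hψc hψs)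
      (hψi.smul_const _), integral_smul_const]
    exact h1

end VPCharge

namespace VPCharge

/-! ### Renormalizations -/

theorem phaseNorm_sq (z : Phase) : phaseNorm z ^ 2 = ‖z.1‖ ^ 2 + ‖z.2‖ ^ 2 :=
  Real.sq_sqrt (by positivity)

theorem phaseNorm_nonneg (z : Phase) : 0 ≤ phaseNorm z := Real.sqrt_nonneg _

theorem norm_fst_le_phaseNorm (z : Phase) : ‖z.1‖ ≤ phaseNorm z :=
  Real.le_sqrt_of_sq_le (by nlinarith [sq_nonneg ‖z.2‖])

theorem norm_snd_le_phaseNorm (z : Phase) : ‖z.2‖ ≤ phaseNorm z :=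
  Real.le_sqrt_of_sq_le (by nlinarith [sq_nonneg ‖z.1‖])

theorem norm_le_phaseNorm (z : Phase) : ‖z‖ ≤ phaseNorm z :=
  max_le (norm_fst_le_phaseNorm z) (norm_snd_le_phaseNorm z)

theorem phaseNorm_le (z : Phase) : phaseNorm z ≤ ‖z.1‖ + ‖z.2‖ :=
  Real.sqrt_le_iff.2 ⟨by positivity, by nlinarith [norm_nonneg z.1, norm_nonneg z.2]⟩

theorem continuous_phaseNorm : Continuous phaseNorm := by
  unfold phaseNorm; fun_prop

theorem phaseNorm_pos {z : Phase} (hz : z ≠ 0) : 0 < phaseNorm z :=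
  (norm_pos_iff.2 hz).trans_le (norm_le_phaseNorm z)

theorem log_one_add_sq_nonneg (z : Phase) : 0 ≤ Real.log (1 + phaseNorm z ^ 2) :=
  Real.log_nonneg (by nlinarith [sq_nonneg (phaseNorm z)])

theorem loglog_nonneg (z : Phase) : 0 ≤ Real.log (1 + Real.log (1 + phaseNorm z ^ 2)) :=
  Real.log_nonneg (by linarith [log_one_add_sq_nonneg z])

/-- The weight allowed for the derivative vanishes only at the origin. Away from it, the ratio of
the derivative to the weight is continuous on a compact set, hence bounded; this is why the
derivative has to vanish near the origin. -/
theorem isRenormalization_of_hasCompactSupport {β : Phase → ℝ} (hβ : ContDiff ℝ 1 β)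
    (hc : HasCompactSupport β) {δ : ℝ} (hδ : 0 < δ) (h0 : ∀ z, ‖z‖ < δ → fderiv ℝ β z = 0) :
    IsRenormalization β := by
  set m : Phase → ℝ := fun z =>
    phaseNorm z / ((1 + phaseNorm z ^ 2) * (1 + Real.log (1 + phaseNorm z ^ 2))) with hm
  have hmpos : ∀ z, z ≠ 0 → 0 < m z := fun z hz =>
    div_pos (phaseNorm_pos hz) (mul_pos (by positivity) (by linarith [log_one_add_sq_nonneg z]))
  have hmnonneg : ∀ z, 0 ≤ m z := fun z =>
    div_nonneg (phaseNorm_nonneg z)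
      (mul_nonneg (by positivity) (by linarith [log_one_add_sq_nonneg z]))
  have hmc : Continuous m := by
    refine continuous_phaseNorm.div (((continuous_const.add (continuous_phaseNorm.pow 2))).mul
      (continuous_const.add ((continuous_const.add (continuous_phaseNorm.pow 2)).log fun z => ?_)))
      fun z => ?_
    · exact (by positivity : (0 : ℝ) < 1 + phaseNorm z ^ 2).ne'
    · exact (mul_pos (by positivity) (by linarith [log_one_add_sq_nonneg z])).ne'
  obtain ⟨C₁, hC₁⟩ := hβ.continuous.bounded_above_of_compact_support hc
  have hK : IsCompact (tsupport β \ Metric.ball 0 δ) := hc.isCompact.diff Metric.isOpen_ball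
  obtain ⟨C₂, hC₂⟩ := hK.exists_bound_of_continuousOn (f := fun z => ‖fderiv ℝ β z‖ / m z)
    (by
      refine ContinuousOn.div (hβ.continuous_fderiv one_ne_zero).norm.continuousOn
        hmc.continuousOn fun z hz => (hmpos z ?_).ne'
      rintro rfl
      exact hz.2 (Metric.mem_ball_self hδ))
  refine ⟨hβ, max C₁ (max C₂ 0), fun z => ⟨?_, ?_⟩⟩
  · have h1 : |β z| ≤ C₁ := hC₁ z
    have h2 := loglog_nonneg z
    have h3 : C₁ ≤ max C₁ (max C₂ 0) := le_max_left _ _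
    have h4 : 0 ≤ max C₁ (max C₂ 0) := (le_max_right _ _).trans (le_max_right _ _)
    nlinarith
  · rw [mul_div_assoc]
    change _ ≤ _ * m z
    have h4 : 0 ≤ max C₁ (max C₂ 0) := (le_max_right _ _).trans (le_max_right _ _)
    by_cases hz : z ∈ tsupport β \ Metric.ball 0 δ
    · have hz0 : z ≠ 0 := by
        rintro rfl
        exact hz.2 (Metric.mem_ball_self hδ)
      have h1 := hC₂ z hz
      rw [Real.norm_eq_abs, abs_of_nonneg (div_nonneg (norm_nonneg _) (hmnonneg z)),
        div_le_iff₀ (hmpos z hz0)] at h1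
      exact h1.trans (mul_le_mul_of_nonneg_right
        ((le_max_left _ _).trans (le_max_right _ _)) (hmnonneg z))
    · have : fderiv ℝ β z = 0 := by
        by_cases h : z ∈ tsupport β
        · exact h0 z (by
            by_contra h'
            exact hz ⟨h, by simpa using h'⟩)
        · exact image_eq_zero_of_notMem_tsupport (f := fderiv ℝ β)
            fun h' => h (tsupport_fderiv_subset ℝ h')
      rw [this, norm_zero]
      exact mul_nonneg h4 (hmnonneg z)

/-- The renormalization `log (1 + log (1 + |z|²))`. -/
noncomputable def logLog (z : Phase) : ℝ := Real.log (1 + Real.log (1 + phaseNorm z ^ 2))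

/-- The growth and derivative conditions are modelled on this function. Because it tends to infinity
at infinity, its equation keeps curves bounded on compact time intervals. -/
theorem isRenormalization_logLog : IsRenormalization logLog := by
  have hq : ∀ z : Phase, 0 < 1 + (‖z.1‖ ^ 2 + ‖z.2‖ ^ 2) := fun z => by positivity
  have hl : ∀ z : Phase, 0 < 1 + Real.log (1 + (‖z.1‖ ^ 2 + ‖z.2‖ ^ 2)) := fun z => by
    have := log_one_add_sq_nonneg z
    rw [phaseNorm_sq] at this
    linarith
  have heq : logLog = fun z : Phase => Real.log (1 + Real.log (1 + (‖z.1‖ ^ 2 + ‖z.2‖ ^ 2))) := by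
    funext z; rw [logLog, phaseNorm_sq]
  -- The factor is `4` because `|x|² + |v|²` has a derivative of norm at most `2|x| + 2|v| ≤ 4|z|`.
  refine ⟨?_, 4, fun z => ⟨?_, ?_⟩⟩
  · rw [heq]
    refine ContDiff.log (contDiff_const.add (ContDiff.log (contDiff_const.add
      ((contDiff_fst.norm_sq ℝ).add (contDiff_snd.norm_sq ℝ))) fun z => (hq z).ne'))
      fun z => (hl z).ne'
  · rw [logLog, abs_of_nonneg (loglog_nonneg z)]
    linarith [loglog_nonneg z]
  · have h1 : HasFDerivAt (fun z : Phase => ‖z.1‖ ^ 2 + ‖z.2‖ ^ 2)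
        (2 • (innerSL ℝ z.1).comp (ContinuousLinearMap.fst ℝ Space Space) +
          2 • (innerSL ℝ z.2).comp (ContinuousLinearMap.snd ℝ Space Space)) z := by
      exact (hasFDerivAt_fst.norm_sq).add (hasFDerivAt_snd.norm_sq)
    have h2 := ((h1.const_add 1).log (hq z).ne')
    have h3 := (h2.const_add 1).log (hl z).ne'
    rw [heq, h3.fderiv, norm_smul, norm_smul, phaseNorm_sq]
    rw [Real.norm_of_nonneg (inv_nonneg.2 (hq z).le), Real.norm_of_nonneg (inv_nonneg.2 (hl z).le)]
    have hn : ‖(2 • (innerSL ℝ z.1).comp (ContinuousLinearMap.fst ℝ Space Space) +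
          2 • (innerSL ℝ z.2).comp (ContinuousLinearMap.snd ℝ Space Space) : Phase →L[ℝ] ℝ)‖
          ≤ 4 * phaseNorm z := by
      have hfst : ‖(innerSL ℝ z.1).comp (ContinuousLinearMap.fst ℝ Space Space)‖ ≤ ‖z.1‖ := by
        refine (ContinuousLinearMap.opNorm_comp_le _ _).trans ?_
        rw [innerSL_apply_norm]
        exact mul_le_of_le_one_right (norm_nonneg _) (ContinuousLinearMap.norm_fst_le ..)
      have hsnd : ‖(innerSL ℝ z.2).comp (ContinuousLinearMap.snd ℝ Space Space)‖ ≤ ‖z.2‖ := by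
        refine (ContinuousLinearMap.opNorm_comp_le _ _).trans ?_
        rw [innerSL_apply_norm]
        exact mul_le_of_le_one_right (norm_nonneg _) (ContinuousLinearMap.norm_snd_le ..)
      refine (norm_add_le _ _).trans ?_
      rw [two_nsmul, two_nsmul]
      have e1 := norm_add_le ((innerSL ℝ z.1).comp (ContinuousLinearMap.fst ℝ Space Space))
        ((innerSL ℝ z.1).comp (ContinuousLinearMap.fst ℝ Space Space))
      have e2 := norm_add_le ((innerSL ℝ z.2).comp (ContinuousLinearMap.snd ℝ Space Space))
        ((innerSL ℝ z.2).comp (ContinuousLinearMap.snd ℝ Space Space))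
      linarith [norm_fst_le_phaseNorm z, norm_snd_le_phaseNorm z]
    rw [le_div_iff₀ (mul_pos (hq z) (hl z))]
    have := (hq z).ne'
    have := (hl z).ne'
    field_simp
    exact hn

/-- A smooth cutoff: `1` on the unit ball, `0` off the ball of radius `2`. -/
noncomputable def unitBump : ContDiffBump (0 : Phase) := ⟨1, 2, one_pos, one_lt_two⟩

/-- The cutoff to the ball of radius `c⁻¹`. -/
noncomputable def cutoff (c : ℝ) (z : Phase) : ℝ := unitBump (c • z)

theorem contDiff_cutoff (c : ℝ) : ContDiff ℝ 1 (cutoff c) :=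
  unitBump.contDiff.comp (contDiff_const_smul c)

theorem cutoff_eq_one {c : ℝ} (hc : 0 < c) {z : Phase} (hz : ‖z‖ ≤ c⁻¹) : cutoff c z = 1 := by
  refine unitBump.one_of_mem_closedBall ?_
  rw [mem_closedBall_zero_iff, norm_smul, Real.norm_of_nonneg hc.le]
  calc c * ‖z‖ ≤ c * c⁻¹ := by gcongr
    _ = 1 := mul_inv_cancel₀ hc.ne'

theorem cutoff_eq_zero {c : ℝ} (hc : 0 < c) {z : Phase} (hz : 2 * c⁻¹ ≤ ‖z‖) :
    cutoff c z = 0 := by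
  refine unitBump.zero_of_le_dist ?_
  rw [dist_zero_right, norm_smul, Real.norm_of_nonneg hc.le]
  calc (2 : ℝ) = c * (2 * c⁻¹) := by field_simp
    _ ≤ c * ‖z‖ := by gcongr

theorem hasCompactSupport_cutoff {c : ℝ} (hc : 0 < c) : HasCompactSupport (cutoff c) := by
  refine HasCompactSupport.of_support_subset_isCompact
    (isCompact_closedBall (0 : Phase) (2 * c⁻¹)) fun z hz => ?_
  rw [mem_closedBall_zero_iff]
  by_contra h
  exact hz (cutoff_eq_zero hc (not_le.1 h).le)

theorem fderiv_cutoff_eq_zero_of_lt {c : ℝ} (hc : 0 < c) {z : Phase} (hz : ‖z‖ < c⁻¹) :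
    fderiv ℝ (cutoff c) z = 0 := by
  have : cutoff c =ᶠ[𝓝 z] fun _ => 1 := by
    filter_upwards [(continuous_norm.isOpen_preimage _ isOpen_Iio).mem_nhds
      (show z ∈ norm ⁻¹' Iio c⁻¹ from hz)] with y hy
    exact cutoff_eq_one hc (le_of_lt hy)
  rw [this.fderiv_eq, fderiv_const_apply]

theorem fderiv_cutoff_eq_zero_of_gt {c : ℝ} (hc : 0 < c) {z : Phase} (hz : 2 * c⁻¹ < ‖z‖) :
    fderiv ℝ (cutoff c) z = 0 := by
  have : cutoff c =ᶠ[𝓝 z] fun _ => 0 := by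
    filter_upwards [(continuous_norm.isOpen_preimage _ isOpen_Ioi).mem_nhds
      (show z ∈ norm ⁻¹' Ioi (2 * c⁻¹) from hz)] with y hy
    exact cutoff_eq_zero hc (le_of_lt hy)
  rw [this.fderiv_eq, fderiv_const_apply]

theorem exists_fderiv_cutoff_bound : ∃ A : ℝ, 0 ≤ A ∧ ∀ c : ℝ, 0 < c → ∀ z,
    ‖fderiv ℝ (cutoff c) z‖ ≤ A * c := by
  obtain ⟨A, hA⟩ := (unitBump.contDiff (n := 1)).continuous_fderiv one_ne_zero
    |>.bounded_above_of_compact_support (unitBump.hasCompactSupport.fderiv (𝕜 := ℝ))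
  refine ⟨A, (norm_nonneg _).trans (hA 0), fun c hc z => ?_⟩
  have h : fderiv ℝ (cutoff c) z = c • fderiv ℝ unitBump (c • z) := by
    change fderiv ℝ (fun z => unitBump (c • z)) z = _
    rw [fderiv_comp_smul]
  rw [h, norm_smul, Real.norm_of_nonneg hc.le, mul_comm]
  gcongr
  exact hA _

theorem isRenormalization_cutoff {c : ℝ} (hc : 0 < c) : IsRenormalization (cutoff c) :=
  isRenormalization_of_hasCompactSupport (contDiff_cutoff c) (hasCompactSupport_cutoff hc)
    (inv_pos.2 hc) fun _ hz => fderiv_cutoff_eq_zero_of_lt hc hz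

/-- A linear form, cut off away from the origin and from infinity. -/
noncomputable def cutForm (n : ℕ) (ℓ : Phase →L[ℝ] ℝ) (z : Phase) : ℝ :=
  (1 - cutoff (n + 1) z) * cutoff ((n + 1 : ℝ)⁻¹) z * ℓ z

theorem cutForm_eq {n : ℕ} {ℓ : Phase →L[ℝ] ℝ} {z : Phase} (h1 : 2 * (n + 1 : ℝ)⁻¹ ≤ ‖z‖)
    (h2 : ‖z‖ ≤ n + 1) : cutForm n ℓ z = ℓ z := by
  have hn : (0 : ℝ) < n + 1 := by positivity
  rw [cutForm, cutoff_eq_zero hn h1, cutoff_eq_one (inv_pos.2 hn) (by rwa [inv_inv])]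
  ring

theorem fderiv_cutForm {n : ℕ} {ℓ : Phase →L[ℝ] ℝ} {z : Phase} (h1 : 2 * (n + 1 : ℝ)⁻¹ < ‖z‖)
    (h2 : ‖z‖ < n + 1) : fderiv ℝ (cutForm n ℓ) z = ℓ := by
  have : cutForm n ℓ =ᶠ[𝓝 z] ℓ := by
    filter_upwards [(continuous_norm.isOpen_preimage _ isOpen_Ioo).mem_nhds
      (show z ∈ norm ⁻¹' Ioo (2 * (n + 1 : ℝ)⁻¹) (n + 1) from ⟨h1, h2⟩)] with y hy
    exact cutForm_eq hy.1.le hy.2.le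
  rw [this.fderiv_eq, ContinuousLinearMap.fderiv]

/-- A nonzero linear form grows too fast and its derivative does not vanish at the origin. The two
cutoffs repair both defects, at the price of knowing the form only on an annulus. -/
theorem isRenormalization_cutForm (n : ℕ) (ℓ : Phase →L[ℝ] ℝ) :
    IsRenormalization (cutForm n ℓ) := by
  have hn : (0 : ℝ) < n + 1 := by positivity
  refine isRenormalization_of_hasCompactSupport (δ := (n + 1 : ℝ)⁻¹) ?_ ?_ (by positivity) ?_
  · exact ((contDiff_const.sub (contDiff_cutoff _)).mul (contDiff_cutoff _)).mul ℓ.contDiff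
  · exact ((hasCompactSupport_cutoff (inv_pos.2 hn)).mul_left).mul_right
  · intro z hz
    have : cutForm n ℓ =ᶠ[𝓝 z] fun _ => 0 := by
      filter_upwards [(continuous_norm.isOpen_preimage _ isOpen_Iio).mem_nhds
        (show z ∈ norm ⁻¹' Iio (n + 1 : ℝ)⁻¹ from hz)] with y hy
      rw [cutForm, cutoff_eq_one hn (le_of_lt hy)]
      ring
    rw [this.fderiv_eq, fderiv_const_apply]

end VPCharge

namespace VPCharge

/-! ### Trajectories in the field of a point charge -/

/-- The vector field `(v, E(s, x) + F(s, x))` of a given field `E` and a charge at `ξ`. -/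
noncomputable def drift (E : ℝ → Space → Space) (ξ : ℝ → Space) (s : ℝ) (z : Phase) : Phase :=
  (z.2, E s z.1 + coulomb (z.1 - ξ s))

/-- A point charge `(ξ, η)` driven by a field `E` bounded by `C`. -/
structure IsChargePath (E : ℝ → Space → Space) (ξ η : ℝ → Space) (C T : ℝ) : Prop where
  measurable : Measurable (Function.uncurry E)
  bound : ∀ s x, ‖E s x‖ ≤ C
  continuous_position : Continuous ξ
  continuous_velocity : Continuous η
  position : ∀ s ∈ Icc 0 T, ξ s = ξ 0 + ∫ τ in (0 : ℝ)..s, η τ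
  velocity : ∀ s ∈ Icc 0 T, η s = η 0 + ∫ τ in (0 : ℝ)..s, E τ (ξ τ)

/-- An integral curve of `drift E ξ` that does not meet the charge. -/
structure IsTrajectory (E : ℝ → Space → Space) (ξ : ℝ → Space) (a b : ℝ) (γ : ℝ → Phase) :
    Prop where
  continuousOn : ContinuousOn γ (Icc a b)
  ne : ∀ s ∈ Icc a b, (γ s).1 ≠ ξ s
  integrable : IntervalIntegrable (fun s => drift E ξ s (γ s)) volume a b
  eq : ∀ s ∈ Icc a b, γ s = γ a + ∫ τ in a..s, drift E ξ τ (γ τ)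

theorem measurable_coulomb : Measurable coulomb := by
  unfold coulomb; fun_prop

theorem norm_coulomb (x : Space) : ‖coulomb x‖ = (‖x‖ ^ 2)⁻¹ := by
  rcases eq_or_ne x 0 with rfl | hx
  · simp [coulomb]
  · have : ‖x‖ ≠ 0 := norm_ne_zero_iff.2 hx
    rw [coulomb, norm_smul, Real.norm_of_nonneg (by positivity)]
    field_simp

theorem coulomb_neg (x : Space) : coulomb (-x) = -coulomb x := by simp [coulomb]

theorem enorm_coulomb_le (x : Space) : ‖coulomb x‖ₑ ≤ (‖x‖ₑ ^ 2)⁻¹ := by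
  rcases eq_or_ne x 0 with rfl | hx
  · simp
  · have : 0 < ‖x‖ := norm_pos_iff.2 hx
    rw [← ofReal_norm, norm_coulomb, ENNReal.ofReal_inv_of_pos (by positivity),
      ENNReal.ofReal_pow (norm_nonneg _), ofReal_norm]

section

variable {E : ℝ → Space → Space} {ξ η : ℝ → Space} {C T : ℝ}

theorem IsChargePath.bound_nonneg (h : IsChargePath E ξ η C T) : 0 ≤ C :=
  (norm_nonneg _).trans (h.bound 0 0)

theorem IsChargePath.measurable_comp (h : IsChargePath E ξ η C T) {x : ℝ → Space}
    (hx : Measurable x) : Measurable fun s => E s (x s) :=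
  h.measurable.comp (measurable_id.prodMk hx)

theorem IsChargePath.aestronglyMeasurable_comp (h : IsChargePath E ξ η C T) {x : ℝ → Space}
    {μ : Measure ℝ} (hx : AEMeasurable x μ) : AEStronglyMeasurable (fun s => E s (x s)) μ :=
  (h.measurable.comp_aemeasurable (aemeasurable_id.prodMk hx)).aestronglyMeasurable

theorem IsChargePath.intervalIntegrable (h : IsChargePath E ξ η C T) {x : ℝ → Space} {a b : ℝ}
    (hx : AEMeasurable x (volume.restrict (uIoc a b))) :
    IntervalIntegrable (fun s => E s (x s)) volume a b := by
  rw [intervalIntegrable_iff]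
  exact IntegrableOn.of_bound (by rw [uIoc]; exact measure_Ioc_lt_top)
    (h.aestronglyMeasurable_comp hx) C (Eventually.of_forall fun s => h.bound s _)

theorem IsChargePath.position_eq (h : IsChargePath E ξ η C T) {a s : ℝ} (ha : a ∈ Icc 0 T)
    (hs : s ∈ Icc 0 T) : ξ s = ξ a + ∫ τ in a..s, η τ := by
  have hi : ∀ u v : ℝ, IntervalIntegrable η volume u v := fun u v =>
    h.continuous_velocity.intervalIntegrable u v
  rw [h.position s hs, h.position a ha, add_assoc,
    intervalIntegral.integral_add_adjacent_intervals (hi _ _) (hi _ _)]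

theorem IsChargePath.velocity_eq (h : IsChargePath E ξ η C T) {a s : ℝ} (ha : a ∈ Icc 0 T)
    (hs : s ∈ Icc 0 T) : η s = η a + ∫ τ in a..s, E τ (ξ τ) := by
  have hi : ∀ u v : ℝ, IntervalIntegrable (fun s => E s (ξ s)) volume u v := fun u v =>
    h.intervalIntegrable h.continuous_position.measurable.aemeasurable
  rw [h.velocity s hs, h.velocity a ha, add_assoc,
    intervalIntegral.integral_add_adjacent_intervals (hi _ _) (hi _ _)]

variable {a b : ℝ} {γ : ℝ → Phase}

theorem IsTrajectory.aemeasurable (hγ : IsTrajectory E ξ a b γ) (hab : a ≤ b) :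
    AEMeasurable γ (volume.restrict (uIoc a b)) := by
  rw [uIoc_of_le hab]
  exact (hγ.continuousOn.mono Ioc_subset_Icc_self).aemeasurable measurableSet_Ioc

theorem IsTrajectory.mono (hγ : IsTrajectory E ξ a b γ) {a' b' : ℝ} (ha : a ≤ a')
    (hab : a' ≤ b') (hb : b' ≤ b) : IsTrajectory E ξ a' b' γ where
  continuousOn := hγ.continuousOn.mono (Icc_subset_Icc ha hb)
  ne s hs := hγ.ne s (Icc_subset_Icc ha hb hs)
  integrable := hγ.integrable.mono_set
    (by rw [uIcc_of_le hab, uIcc_of_le (ha.trans (hab.trans hb))]; exact Icc_subset_Icc ha hb)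
  eq s hs := by
    have hi : ∀ u ∈ Icc a b, IntervalIntegrable (fun s => drift E ξ s (γ s)) volume a u :=
      fun u hu => hγ.integrable.mono_set (by
        rw [uIcc_of_le hu.1, uIcc_of_le (hu.1.trans hu.2)]; exact Icc_subset_Icc le_rfl hu.2)
    have h1 : a' ∈ Icc a b := ⟨ha, hab.trans hb⟩
    have h2 : s ∈ Icc a b := ⟨ha.trans hs.1, hs.2.trans hb⟩
    rw [hγ.eq s h2, hγ.eq a' h1, add_assoc,
      intervalIntegral.integral_add_adjacent_intervals (hi _ h1) ((hi _ h1).symm.trans (hi _ h2))]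

theorem IsTrajectory.exists_bound (hγ : IsTrajectory E ξ a b γ) (hξ : IsChargePath E ξ η C T)
    : ∃ K : ℝ, ∀ s ∈ Icc a b, ‖drift E ξ s (γ s)‖ ≤ K := by
  have hcont : ContinuousOn (fun s => (γ s).1 - ξ s) (Icc a b) :=
    (continuous_fst.comp_continuousOn hγ.continuousOn).sub hξ.continuous_position.continuousOn
  obtain ⟨K₁, hK₁⟩ := isCompact_Icc.exists_bound_of_continuousOn
    (f := fun s => (‖(γ s).1 - ξ s‖ ^ 2)⁻¹)
    ((hcont.norm.pow 2).inv₀ fun s hs => pow_ne_zero 2 (norm_ne_zero_iff.2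
      (sub_ne_zero.2 (hγ.ne s hs))))
  obtain ⟨K₂, hK₂⟩ := isCompact_Icc.exists_bound_of_continuousOn
    (f := fun s => (γ s).2) (continuous_snd.comp_continuousOn hγ.continuousOn)
  refine ⟨max K₂ (C + K₁), fun s hs => max_le_max (hK₂ s hs) ?_⟩
  refine (norm_add_le _ _).trans (add_le_add (hξ.bound _ _) ?_)
  rw [norm_coulomb]
  exact (Real.le_norm_self _).trans (hK₁ s hs)

theorem IsTrajectory.snd_eq (hγ : IsTrajectory E ξ a b γ) {s : ℝ} (hs : s ∈ Icc a b) :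
    (γ s).2 = (γ a).2 + ∫ τ in a..s, (E τ (γ τ).1 + coulomb ((γ τ).1 - ξ τ)) := by
  have hi : IntervalIntegrable (fun s => drift E ξ s (γ s)) volume a s :=
    hγ.integrable.mono_set (by
      rw [uIcc_of_le hs.1, uIcc_of_le (hs.1.trans hs.2)]; exact Icc_subset_Icc le_rfl hs.2)
  have h := congrArg (ContinuousLinearMap.snd ℝ Space Space) (hγ.eq s hs)
  rw [map_add, ← ContinuousLinearMap.intervalIntegral_comp_comm _ hi] at h
  exact h

theorem IsTrajectory.fst_eq (hγ : IsTrajectory E ξ a b γ) {s : ℝ} (hs : s ∈ Icc a b) :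
    (γ s).1 = (γ a).1 + ∫ τ in a..s, (γ τ).2 := by
  have hi : IntervalIntegrable (fun s => drift E ξ s (γ s)) volume a s :=
    hγ.integrable.mono_set (by
      rw [uIcc_of_le hs.1, uIcc_of_le (hs.1.trans hs.2)]; exact Icc_subset_Icc le_rfl hs.2)
  have h := congrArg (ContinuousLinearMap.fst ℝ Space Space) (hγ.eq s hs)
  rw [map_add, ← ContinuousLinearMap.intervalIntegral_comp_comm _ hi] at h
  exact h

theorem IsTrajectory.intervalIntegrable_snd (hγ : IsTrajectory E ξ a b γ) :
    IntervalIntegrable (fun τ => (E τ (γ τ).1 + coulomb ((γ τ).1 - ξ τ))) volume a b :=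
  ⟨(ContinuousLinearMap.snd ℝ Space Space).integrable_comp hγ.integrable.1,
    (ContinuousLinearMap.snd ℝ Space Space).integrable_comp hγ.integrable.2⟩

theorem IsTrajectory.intervalIntegrable_fst (hγ : IsTrajectory E ξ a b γ) :
    IntervalIntegrable (fun τ => (γ τ).2) volume a b :=
  ⟨(ContinuousLinearMap.fst ℝ Space Space).integrable_comp hγ.integrable.1,
    (ContinuousLinearMap.fst ℝ Space Space).integrable_comp hγ.integrable.2⟩

theorem prodMk_intervalIntegral {f g : ℝ → Space} {a b : ℝ} (hf : IntervalIntegrable f volume a b)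
    (hg : IntervalIntegrable g volume a b) :
    ∫ s in a..b, ((f s, g s) : Phase) = (∫ s in a..b, f s, ∫ s in a..b, g s) := by
  have h : IntervalIntegrable (fun s => ((f s, g s) : Phase)) volume a b :=
    ⟨hf.1.prodMk hg.1, hf.2.prodMk hg.2⟩
  ext1
  · exact ((ContinuousLinearMap.fst ℝ Space Space).intervalIntegral_comp_comm h).symm
  · exact ((ContinuousLinearMap.snd ℝ Space Space).intervalIntegral_comp_comm h).symm

/-- The chain rule along a trajectory, in the frame moving with the velocity `ε η`
(`ε = 1` is the frame of the charge, `ε = 0` the rest frame). -/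
theorem IsTrajectory.integral_fderiv (hγ : IsTrajectory E ξ a b γ) (hξ : IsChargePath E ξ η C T)
    (ha : 0 ≤ a) (hab : a ≤ b) (hb : b ≤ T) (ε : ℝ) {Φ : Phase → ℝ}
    (hΦ : ContDiffOn ℝ 1 Φ {p | p.1 ≠ 0}) :
    IntervalIntegrable (fun s => fderiv ℝ Φ ((γ s).1 - ξ s, (γ s).2 - ε • η s)
      ((γ s).2 - η s, E s (γ s).1 + coulomb ((γ s).1 - ξ s) - ε • E s (ξ s))) volume a b ∧
    ∫ s in a..b, fderiv ℝ Φ ((γ s).1 - ξ s, (γ s).2 - ε • η s)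
      ((γ s).2 - η s, E s (γ s).1 + coulomb ((γ s).1 - ξ s) - ε • E s (ξ s)) =
    Φ ((γ b).1 - ξ b, (γ b).2 - ε • η b) - Φ ((γ a).1 - ξ a, (γ a).2 - ε • η a) := by
  have hIcc : ∀ s ∈ Icc a b, s ∈ Icc 0 T := fun s hs => ⟨ha.trans hs.1, hs.2.trans hb⟩
  have haT := hIcc a ⟨le_rfl, hab⟩
  have hη : IntervalIntegrable η volume a b := hξ.continuous_velocity.intervalIntegrable a b
  have hE : IntervalIntegrable (fun s => E s (ξ s)) volume a b :=
    hξ.intervalIntegrable hξ.continuous_position.measurable.aemeasurable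
  have h1 := hγ.intervalIntegrable_fst.sub hη
  have h2 := hγ.intervalIntegrable_snd.sub (hE.smul ε)
  obtain ⟨K₁, hK₁⟩ := hγ.exists_bound hξ
  obtain ⟨K₂, hK₂⟩ := isCompact_Icc.exists_bound_of_continuousOn
    (f := η) (s := Icc a b) hξ.continuous_velocity.continuousOn
  refine integral_fderiv_comp_eq_sub
    (p := fun s => ((γ s).1 - ξ s, (γ s).2 - ε • η s))
    (q := fun s => ((γ s).2 - η s, E s (γ s).1 + coulomb ((γ s).1 - ξ s) - ε • E s (ξ s)))
    (K := max (K₁ + K₂) (K₁ + |ε| * C)) hab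
    (isOpen_ne.preimage continuous_fst) hΦ
    (fun s hs => sub_ne_zero.2 (hγ.ne s hs)) ⟨h1.1.prodMk h2.1, h1.2.prodMk h2.2⟩ ?_ ?_
  · intro s hs
    have hsub : uIcc a s ⊆ uIcc a b := by
      rw [uIcc_of_le hs.1, uIcc_of_le hab]; exact Icc_subset_Icc_right hs.2
    have e1 := intervalIntegral.integral_sub (hγ.intervalIntegrable_fst.mono_set hsub)
      (hη.mono_set hsub)
    have e2 := intervalIntegral.integral_sub (hγ.intervalIntegrable_snd.mono_set hsub)
      ((hE.smul ε).mono_set hsub)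
    refine Eq.trans ?_ (congrArg _ (prodMk_intervalIntegral (h1.mono_set hsub)
      (h2.mono_set hsub)).symm)
    simp only [Pi.smul_apply] at e2
    simp only [Pi.smul_apply, Prod.mk_add_mk]
    rw [e1, e2, intervalIntegral.integral_smul, hγ.fst_eq hs, hγ.snd_eq hs,
      hξ.position_eq haT (hIcc s hs), hξ.velocity_eq haT (hIcc s hs)]
    ext1
    · simp only; abel
    · simp only [smul_add]; abel
  · filter_upwards [ae_restrict_mem measurableSet_Ioc] with s hs
    have hs' := Ioc_subset_Icc_self hs
    have h3 := hK₁ s hs'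
    refine max_le_max ((norm_sub_le _ _).trans (add_le_add ((le_max_left _ _).trans h3)
      (hK₂ s hs'))) ((norm_sub_le _ _).trans (add_le_add ((le_max_right _ _).trans h3) ?_))
    rw [norm_smul, Real.norm_eq_abs]
    exact mul_le_mul_of_nonneg_left (hξ.bound _ _) (abs_nonneg _)

theorem hasDerivAt_norm_line {y w : Space} (hy : y ≠ 0) :
    HasDerivAt (fun τ : ℝ => ‖y + τ • w‖) (inner ℝ y w / ‖y‖) 0 := by
  have h1 : HasDerivAt (fun τ : ℝ => y + τ • w) w 0 := by
    simpa using ((hasDerivAt_id (0 : ℝ)).smul_const w).const_add y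
  have h2 := h1.norm_sq.sqrt (by simpa using hy)
  simp only [Real.sqrt_sq (norm_nonneg _), zero_smul, add_zero] at h2
  convert h2 using 1
  field_simp

/-- Directional derivatives are then computed along a straight line, by one-variable calculus. -/
theorem fderiv_eq_of_hasLineDerivAt {Φ : Phase → ℝ} (hΦ : ContDiffOn ℝ 1 Φ {p | p.1 ≠ 0})
    {p q : Phase} {d : ℝ} (hp : p.1 ≠ 0) (h : HasLineDerivAt ℝ Φ d p q) :
    fderiv ℝ Φ p q = d := by
  have hd : DifferentiableAt ℝ Φ p :=
    (hΦ.contDiffAt ((isOpen_ne.preimage continuous_fst).mem_nhds hp)).differentiableAt one_ne_zero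
  rw [← hd.lineDeriv_eq_fderiv, h.lineDeriv]

/-- The speed equivalent of the energy relative to the charge. -/
noncomputable def relSpeed (p : Phase) : ℝ := Real.sqrt (‖p.2‖ ^ 2 + 2 * ‖p.1‖⁻¹)

theorem relSpeed_nonneg (p : Phase) : 0 ≤ relSpeed p := Real.sqrt_nonneg _

theorem relSpeed_radicand_pos {p : Phase} (hp : p.1 ≠ 0) : 0 < ‖p.2‖ ^ 2 + 2 * ‖p.1‖⁻¹ := by
  have : 0 < ‖p.1‖ := norm_pos_iff.2 hp
  positivity

theorem relSpeed_pos {p : Phase} (hp : p.1 ≠ 0) : 0 < relSpeed p :=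
  Real.sqrt_pos.2 (relSpeed_radicand_pos hp)

theorem contDiffOn_norm_fst : ContDiffOn ℝ 1 (fun p : Phase => ‖p.1‖) {p | p.1 ≠ 0} :=
  fun _ hp => (contDiff_fst.contDiffAt.norm ℝ hp).contDiffWithinAt

theorem contDiffOn_relSpeed : ContDiffOn ℝ 1 relSpeed {p | p.1 ≠ 0} := by
  refine ContDiffOn.sqrt (((contDiff_snd.norm_sq ℝ).contDiffOn).add
    (contDiffOn_const.mul (contDiffOn_norm_fst.inv fun _ hp => norm_ne_zero_iff.2 hp)))
    fun _ hp => (relSpeed_radicand_pos hp).ne'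

/-- In the frame of the charge the work of the Coulomb force cancels the change of `1/|y|`. Only the
remaining force `e` survives, and the square root turns its power into a rate of at most `‖e‖`. -/
theorem fderiv_relSpeed {y w e : Space} (hy : y ≠ 0) :
    fderiv ℝ relSpeed (y, w) (w, e + coulomb y) = inner ℝ w e / relSpeed (y, w) := by
  refine fderiv_eq_of_hasLineDerivAt contDiffOn_relSpeed hy ?_
  have hy' : ‖y‖ ≠ 0 := norm_ne_zero_iff.2 hy
  have h1 := hasDerivAt_norm_line (w := w) hy
  have h2 : HasDerivAt (fun τ : ℝ => w + τ • (e + coulomb y)) (e + coulomb y) 0 := by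
    simpa using ((hasDerivAt_id (0 : ℝ)).smul_const (e + coulomb y)).const_add w
  have h3 := (h2.norm_sq.fun_add ((h1.fun_inv (by simpa using hy)).const_mul 2)).sqrt
    (by simpa using (relSpeed_radicand_pos (p := (y, w)) hy).ne')
  change HasDerivAt (fun τ : ℝ => √(‖w + τ • (e + coulomb y)‖ ^ 2 + 2 * ‖y + τ • w‖⁻¹)) _ 0
  refine h3.congr_deriv ?_
  have hs : √(‖w‖ ^ 2 + 2 * ‖y‖⁻¹) ≠ 0 := (relSpeed_pos (p := (y, w)) hy).ne'
  simp only [zero_smul, add_zero, inner_add_right, coulomb, inner_smul_right,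
    real_inner_comm w y, relSpeed]
  field_simp
  ring

theorem norm_le_relSpeed (p : Phase) : ‖p.2‖ ≤ relSpeed p :=
  Real.le_sqrt_of_sq_le (by linarith [inv_nonneg.2 (norm_nonneg p.1)])

theorem two_mul_inv_le_relSpeed (p : Phase) : 2 * ‖p.1‖⁻¹ ≤ relSpeed p ^ 2 := by
  rw [relSpeed, Real.sq_sqrt (by positivity)]
  linarith [sq_nonneg ‖p.2‖]

/-- The charge itself accelerates by `E(ξ)`, so the relative force is `E(x) - E(ξ)`, of norm at most
`2C`. Since `C` is not controlled by the data, this serves to construct and dominate trajectories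
and not for the final modulus. -/
theorem IsTrajectory.relSpeed_le (hγ : IsTrajectory E ξ a b γ) (hξ : IsChargePath E ξ η C T)
    (ha : 0 ≤ a) (hab : a ≤ b) (hb : b ≤ T) :
    relSpeed ((γ b).1 - ξ b, (γ b).2 - η b) ≤
      relSpeed ((γ a).1 - ξ a, (γ a).2 - η a) + 2 * C * (b - a) := by
  obtain ⟨-, h2⟩ := hγ.integral_fderiv hξ ha hab hb 1 contDiffOn_relSpeed
  simp only [one_smul] at h2
  have h3 : ‖relSpeed ((γ b).1 - ξ b, (γ b).2 - η b) -
      relSpeed ((γ a).1 - ξ a, (γ a).2 - η a)‖ ≤ 2 * C * |b - a| := by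
    rw [← h2]
    refine intervalIntegral.norm_integral_le_of_norm_le_const fun s hs => ?_
    rw [uIoc_of_le hab] at hs
    have hy : (γ s).1 - ξ s ≠ 0 := sub_ne_zero.2 (hγ.ne s (Ioc_subset_Icc_self hs))
    have e : E s (γ s).1 + coulomb ((γ s).1 - ξ s) - E s (ξ s) =
      (E s (γ s).1 - E s (ξ s)) + coulomb ((γ s).1 - ξ s) := by abel
    rw [e, fderiv_relSpeed hy, norm_div,
      Real.norm_of_nonneg (relSpeed_nonneg _),
      div_le_iff₀ (relSpeed_pos (p := ((γ s).1 - ξ s, (γ s).2 - η s)) hy)]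
    refine (norm_inner_le_norm _ _).trans ?_
    rw [mul_comm]
    refine mul_le_mul ?_ (norm_le_relSpeed ((γ s).1 - ξ s, (γ s).2 - η s)) (norm_nonneg _)
      (by linarith [hξ.bound_nonneg])
    refine (norm_sub_le _ _).trans ?_
    linarith [hξ.bound s (γ s).1, hξ.bound s (ξ s)]
  rw [abs_of_nonneg (by linarith)] at h3
  linarith [Real.le_norm_self (relSpeed ((γ b).1 - ξ b, (γ b).2 - η b) -
      relSpeed ((γ a).1 - ξ a, (γ a).2 - η a))]

end

end VPCharge

namespace VPCharge

/-! ### From distributional equations to trajectories -/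

theorem HasDistribDerivOn.exists_ae_eq {u w : ℝ → ℝ} {t T c : ℝ} (hc : c ∈ Ioo t T)
    (h : HasDistribDerivOn u w t T) :
    ∃ p : ℝ, ∀ᵐ s, s ∈ Ioo t T → u s = p + ∫ τ in c..s, w τ :=
  ae_eq_primitive_of_distribDeriv hc h.1 h.2.1 fun φ h1 h2 h3 => by
    simpa only [smul_eq_mul] using h.2.2 φ h1 h2 h3

/-- A function with a locally integrable distributional derivative agrees a.e. with a continuous
one, hence is bounded on compact subintervals. Two exponentials invert the logarithms. -/
theorem ae_norm_le_of_logLog {ζ : ℝ → Phase} {w : ℝ → ℝ} {t T a b : ℝ}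
    (h : HasDistribDerivOn (fun s => logLog (ζ s)) w t T) (ha : a ∈ Ioo t T) (hb : b ∈ Ioo t T) :
    ∃ R : ℝ, ∀ᵐ s, s ∈ Icc a b → ‖ζ s‖ ≤ R := by
  obtain ⟨p, hp⟩ := h.exists_ae_eq ha
  have hab : Icc a b ⊆ Ioo t T := (ordConnected_Ioo.out ha hb)
  obtain ⟨M, hM⟩ := isCompact_Icc.exists_bound_of_continuousOn
    (f := fun s => p + ∫ τ in a..s, w τ) (s := Icc a b)
    (continuousOn_const.add ((continuousOn_primitive_Ioo ha h.2.1).mono hab))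
  refine ⟨Real.exp (Real.exp M), ?_⟩
  filter_upwards [hp] with s hs hsI
  have h1 : logLog (ζ s) ≤ M := by
    rw [hs (hab hsI)]; exact (Real.le_norm_self _).trans (hM s hsI)
  have h2 : 1 + Real.log (1 + phaseNorm (ζ s) ^ 2) ≤ Real.exp M := by
    rw [← Real.log_le_iff_le_exp (by linarith [log_one_add_sq_nonneg (ζ s)])]; exact h1
  have h3 : 1 + phaseNorm (ζ s) ^ 2 ≤ Real.exp (Real.exp M) := by
    rw [← Real.log_le_iff_le_exp (by positivity)]; linarith
  nlinarith [norm_le_phaseNorm (ζ s), sq_nonneg (phaseNorm (ζ s) - 1)]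

/-- Initial values are only seen through times near `t`. This picks such a time at which a property
on a set of positive measure and an almost sure property hold together. -/
theorem exists_mem_of_measure_ne_zero {t h T : ℝ} {P Q : ℝ → Prop} (hh : 0 < h)
    (htT : t < T) (hP : ∀ h > 0, volume {s ∈ Ioo t (t + h) | P s} ≠ 0)
    (hQ : ∀ᵐ s, s ∈ Ioo t T → Q s) : ∃ s ∈ Ioo t T, s < t + h ∧ P s ∧ Q s := by
  by_contra hcon
  push Not at hcon
  refine hP (min h (T - t)) (lt_min hh (by linarith)) (measure_mono_null ?_ (ae_iff.1 hQ))
  rintro s ⟨hs, hsP⟩ hsQ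
  have h1 : s < t + h := hs.2.trans_le (by linarith [min_le_left h (T - t)])
  have h2 : s < T := hs.2.trans_le (by linarith [min_le_right h (T - t)])
  exact hcon s ⟨hs.1, h2⟩ h1 hsP (hsQ ⟨hs.1, h2⟩)

/-- The cutoff along the curve is close to the start equal to `0`, since `z` lies outside its
support, and it equals `1` in the ball of radius `c⁻¹`. A total variation below one cannot bridge
the gap. -/
theorem ae_inv_le_norm_of_cutoff {ζ : ℝ → Phase} {z : Phase} {w : ℝ → ℝ} {t T c : ℝ}
    (htT : t < T) (hc : 0 < c) (hz : 2 * c⁻¹ < ‖z‖)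
    (hd : HasDistribDerivOn (fun s => cutoff c (ζ s)) w t T)
    (hw : ∫⁻ s in Ioo t T, ‖w s‖ₑ < 1)
    (hinit : ∀ ε > 0, ∀ h > 0, volume {s ∈ Ioo t (t + h) | ‖ζ s - z‖ < ε} ≠ 0) :
    ∀ᵐ s, s ∈ Ioo t T → c⁻¹ ≤ ‖ζ s‖ := by
  obtain ⟨c₀, hc₀⟩ : (Ioo t T).Nonempty := nonempty_Ioo.2 htT
  obtain ⟨p, hp⟩ := hd.exists_ae_eq hc₀
  filter_upwards [hp] with s hs hsI
  by_contra hlt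
  have hu1 := hs hsI
  rw [cutoff_eq_one hc (not_le.1 hlt).le] at hu1
  obtain ⟨s₀, hs₀, hs₀s, hs₀z, hs₀p⟩ := exists_mem_of_measure_ne_zero (h := s - t)
    (by linarith [hsI.1]) htT (hinit (‖z‖ - 2 * c⁻¹) (by linarith)) (by
      filter_upwards [hp] with r hr using hr)
  have hu0 := hs₀p
  rw [cutoff_eq_zero hc (by
    have := norm_sub_norm_le z (ζ s₀)
    rw [norm_sub_rev] at this
    linarith)] at hu0
  have hi : ∀ r ∈ Ioo t T, IntervalIntegrable w volume c₀ r := fun r hr =>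
    LocallyIntegrableOn.intervalIntegrable_of_Ioo hd.2.1 hc₀ hr
  have h1 : ∫ τ in s₀..s, w τ = 1 := by
    rw [← intervalIntegral.integral_interval_sub_left (hi _ hsI) (hi _ hs₀)]
    linarith
  have h2 : (1 : ℝ≥0∞) ≤ ∫⁻ s in Ioo t T, ‖w s‖ₑ := by
    calc (1 : ℝ≥0∞) = ‖∫ τ in s₀..s, w τ‖ₑ := by rw [h1]; simp
      _ ≤ ∫⁻ τ in Ioc s₀ s, ‖w τ‖ₑ := by
        rw [intervalIntegral.integral_of_le (by linarith)]
        exact enorm_integral_le_lintegral_enorm _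
      _ ≤ ∫⁻ s in Ioo t T, ‖w s‖ₑ :=
        lintegral_mono_set fun r hr => ⟨hs₀.1.trans hr.1, hr.2.trans_lt hsI.2⟩
  exact absurd hw (not_lt.2 h2)

/-- The coordinate forms of phase space. -/
noncomputable def phaseForm (i : Fin (Module.finrank ℝ Phase)) : Phase →L[ℝ] ℝ :=
  ((Module.finBasis ℝ Phase).coord i).toContinuousLinearMap

theorem sum_phaseForm_smul (z : Phase) :
    ∑ i, phaseForm i z • Module.finBasis ℝ Phase i = z := by
  simp [phaseForm]

theorem phase_ext {z z' : Phase} (h : ∀ i, phaseForm i z = phaseForm i z') : z = z' := by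
  rw [← sum_phaseForm_smul z, ← sum_phaseForm_smul z']
  simp_rw [h]

theorem locallyIntegrableOn_of_phaseForm {u : ℝ → Phase} {t T : ℝ}
    (h : ∀ i, LocallyIntegrableOn (fun s => phaseForm i (u s)) (Ioo t T)) :
    LocallyIntegrableOn u (Ioo t T) := by
  rw [locallyIntegrableOn_iff isOpen_Ioo.isLocallyClosed]
  intro k hk hkc
  have h1 : IntegrableOn (fun s => ∑ i, phaseForm i (u s) • Module.finBasis ℝ Phase i) k :=
    integrable_finsetSum _ fun i _ => ((h i).integrableOn_compact_subset hk hkc).smul_const _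
  simpa only [sum_phaseForm_smul] using h1

/-- On a compact subinterval the curve stays in an annulus, where a cut-off form with large `n`
coincides with `ℓ` together with its derivative. A test function only sees such a subinterval. -/
theorem hasDistribDerivOn_phaseForm {ζ β : ℝ → Phase} {t T δ : ℝ} (htT : t < T) (hδ : 0 < δ)
    (hbelow : ∀ᵐ s, s ∈ Ioo t T → δ ≤ ‖ζ s‖)
    (habove : ∀ a ∈ Ioo t T, ∀ b ∈ Ioo t T, ∃ R : ℝ, ∀ᵐ s, s ∈ Icc a b → ‖ζ s‖ ≤ R)
    {ℓ : Phase →L[ℝ] ℝ}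
    (hform : ∀ n, HasDistribDerivOn (fun s => cutForm n ℓ (ζ s))
      (fun s => fderiv ℝ (cutForm n ℓ) (ζ s) (β s)) t T) :
    HasDistribDerivOn (fun s => ℓ (ζ s)) (fun s => ℓ (β s)) t T := by
  have hn : ∀ a ∈ Ioo t T, ∀ b ∈ Ioo t T, ∃ n : ℕ, ∀ᵐ s, s ∈ Icc a b →
      cutForm n ℓ (ζ s) = ℓ (ζ s) ∧ fderiv ℝ (cutForm n ℓ) (ζ s) (β s) = ℓ (β s) := by
    intro a ha b hb
    obtain ⟨R, hR⟩ := habove a ha b hb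
    obtain ⟨n, hn⟩ := exists_nat_gt (max R (2 * δ⁻¹))
    refine ⟨n, ?_⟩
    filter_upwards [hR, hbelow] with s hs1 hs2 hsI
    have h1 := hs1 hsI
    have h2 := hs2 (ordConnected_Ioo.out ha hb hsI)
    have h3 : ‖ζ s‖ < n + 1 := by linarith [le_max_left R (2 * δ⁻¹)]
    have h4 : 2 * (n + 1 : ℝ)⁻¹ < ‖ζ s‖ := by
      refine lt_of_lt_of_le ?_ h2
      have h5 : 2 * δ⁻¹ < n + 1 := by linarith [le_max_right R (2 * δ⁻¹)]
      rw [← div_eq_mul_inv, div_lt_iff₀ hδ] at h5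
      rw [← div_eq_mul_inv, div_lt_iff₀ (by positivity)]
      linarith
    exact ⟨cutForm_eq h4.le h3.le, by rw [fderiv_cutForm h4 h3]⟩
  have hsub : ∀ k ⊆ Ioo t T, IsCompact k →
      ∃ a ∈ Ioo t T, ∃ b ∈ Ioo t T, k ⊆ Icc a b := by
    intro k hk hkc
    rcases k.eq_empty_or_nonempty with rfl | hne
    · obtain ⟨c, hc⟩ := nonempty_Ioo.2 htT
      exact ⟨c, hc, c, hc, empty_subset _⟩
    · obtain ⟨m, hm, hm'⟩ := hkc.exists_isLeast hne
      obtain ⟨M, hM, hM'⟩ := hkc.exists_isGreatest hne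
      exact ⟨m, hk hm, M, hk hM, fun x hx => ⟨hm' hx, hM' hx⟩⟩
  refine ⟨?_, ?_, fun φ hφ hφc hφs => ?_⟩
  · rw [locallyIntegrableOn_iff isOpen_Ioo.isLocallyClosed]
    intro k hk hkc
    obtain ⟨a, ha, b, hb, hab⟩ := hsub k hk hkc
    obtain ⟨n, hn⟩ := hn a ha b hb
    refine ((hform n).1.integrableOn_compact_subset hk hkc).congr ?_
    refine (ae_restrict_iff' hkc.measurableSet).2 ?_
    filter_upwards [hn] with s hs hsk using (hs (hab hsk)).1
  · rw [locallyIntegrableOn_iff isOpen_Ioo.isLocallyClosed]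
    intro k hk hkc
    obtain ⟨a, ha, b, hb, hab⟩ := hsub k hk hkc
    obtain ⟨n, hn⟩ := hn a ha b hb
    refine ((hform n).2.1.integrableOn_compact_subset hk hkc).congr ?_
    refine (ae_restrict_iff' hkc.measurableSet).2 ?_
    filter_upwards [hn] with s hs hsk using (hs (hab hsk)).2
  · obtain ⟨a, ha, b, hb, hab⟩ := hsub _ hφs hφc
    obtain ⟨n, hn⟩ := hn a ha b hb
    refine Eq.trans (integral_congr_ae ?_) (((hform n).2.2 φ hφ hφc hφs).trans
      (congrArg _ (integral_congr_ae ?_)))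
    · filter_upwards [hn] with s hs
      by_cases h : s ∈ tsupport φ
      · rw [(hs (hab h)).1]
      · rw [image_eq_zero_of_notMem_tsupport fun h' => h (tsupport_deriv_subset h'), zero_mul,
          zero_mul]
    · filter_upwards [hn] with s hs
      by_cases h : s ∈ tsupport φ
      · rw [(hs (hab h)).2]
      · rw [image_eq_zero_of_notMem_tsupport h, zero_mul, zero_mul]

/-- The vector-valued equation `ζ' = β`. -/
theorem exists_ae_eq_primitive_of_phaseForm {ζ β : ℝ → Phase} {t T c : ℝ} (hc : c ∈ Ioo t T)
    (h : ∀ i, HasDistribDerivOn (fun s => phaseForm i (ζ s)) (fun s => phaseForm i (β s)) t T) :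
    LocallyIntegrableOn β (Ioo t T) ∧
      ∃ p : Phase, ∀ᵐ s, s ∈ Ioo t T → ζ s = p + ∫ τ in c..s, β τ := by
  have h1 := locallyIntegrableOn_of_phaseForm fun i => (h i).1
  have h2 := locallyIntegrableOn_of_phaseForm fun i => (h i).2.1
  refine ⟨h2, ae_eq_primitive_of_distribDeriv hc h1 h2 fun φ hφ hφc hφs => phase_ext fun i => ?_⟩
  have hd' : tsupport (deriv φ) ⊆ Ioo t T := (tsupport_deriv_subset).trans hφs
  rw [map_neg, ← (phaseForm i).integral_comp_comm (integrable_smul_of_tsupport_subset h1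
    (hφ.continuous_deriv (by simp)) hφc.deriv hd'),
    ← (phaseForm i).integral_comp_comm
      (integrable_smul_of_tsupport_subset h2 hφ.continuous hφc hφs)]
  simpa only [map_smul, smul_eq_mul] using (h i).2.2 φ hφ hφc hφs

section

variable {E : ℝ → Space → Space} {ξ η : ℝ → Space} {C t T : ℝ}

/-- The primitive is a continuous representative whose position is Lipschitz, so integrability of
the inverse square distance excludes a collision. Replacing `ζ` by it inside the integral changes
nothing. -/
theorem isTrajectory_of_ae_eq_primitive (hξ : IsChargePath E ξ η C T) {ζ : ℝ → Phase} {p : Phase}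
    {a b c : ℝ} (ht : 0 ≤ t) (hc : c ∈ Ioo t T) (ha : a ∈ Ioo t T) (hb : b ∈ Ioo t T) (hab : a < b)
    (hβ : LocallyIntegrableOn (fun s => drift E ξ s (ζ s)) (Ioo t T))
    (hp : ∀ᵐ s, s ∈ Ioo t T → ζ s = p + ∫ τ in c..s, drift E ξ τ (ζ τ))
    (hF : ∫⁻ s in Icc a b, (‖(ζ s).1 - ξ s‖ₑ ^ 2)⁻¹ ≠ ∞) :
    IsTrajectory E ξ a b (fun s => p + ∫ τ in c..s, drift E ξ τ (ζ τ)) := by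
  set γ : ℝ → Phase := fun s => p + ∫ τ in c..s, drift E ξ τ (ζ τ) with hγ
  have hIcc : Icc a b ⊆ Ioo t T := ordConnected_Ioo.out ha hb
  have hcont : ContinuousOn γ (Icc a b) :=
    (continuousOn_const.add (continuousOn_primitive_Ioo hc hβ)).mono hIcc
  have hii : ∀ u ∈ Ioo t T, ∀ v ∈ Ioo t T,
      IntervalIntegrable (fun s => drift E ξ s (ζ s)) volume u v := fun u hu v hv =>
    LocallyIntegrableOn.intervalIntegrable_of_Ioo hβ hu hv
  have hcongr : ∀ s s', s ∈ Icc a b → s' ∈ Icc a b → ∀ᵐ τ, τ ∈ uIoc s s' →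
      ζ τ = γ τ := by
    intro s s' hs hs'
    filter_upwards [hp] with τ hτ hτI
    exact hτ (ordConnected_Ioo.uIcc_subset (hIcc hs) (hIcc hs') (uIoc_subset_uIcc hτI))
  have hdiff : ∀ s ∈ Icc a b, ∀ s' ∈ Icc a b, γ s = γ s' + ∫ τ in s'..s, drift E ξ τ (ζ τ) := by
    intro s hs s' hs'
    simp only [hγ]
    rw [add_assoc, intervalIntegral.integral_add_adjacent_intervals (hii _ hc _ (hIcc hs'))
      (hii _ (hIcc hs') _ (hIcc hs))]
  have hdiff1 : ∀ s ∈ Icc a b, ∀ s' ∈ Icc a b, (γ s).1 - (γ s').1 = ∫ τ in s'..s, (γ τ).2 := by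
    intro s hs s' hs'
    rw [hdiff s hs s' hs', Prod.fst_add, add_sub_cancel_left]
    refine ((ContinuousLinearMap.fst ℝ Space Space).intervalIntegral_comp_comm
      (hii _ (hIcc hs') _ (hIcc hs))).symm.trans ?_
    refine intervalIntegral.integral_congr_ae ?_
    filter_upwards [hcongr s' s hs' hs] with τ hτ hτI
    rw [← hτ hτI]; rfl
  obtain ⟨K₁, hK₁⟩ := isCompact_Icc.exists_bound_of_continuousOn hcont
  obtain ⟨K₂, hK₂⟩ := isCompact_Icc.exists_bound_of_continuousOn
    (f := η) (s := Icc a b) hξ.continuous_velocity.continuousOn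
  have hsub : ∀ s ∈ Icc a b, ∀ s' ∈ Icc a b, ∀ τ ∈ uIoc s' s, τ ∈ Icc a b :=
    fun s hs s' hs' τ hτ => ordConnected_Icc.uIcc_subset hs' hs (uIoc_subset_uIcc hτ)
  have hT : ∀ s ∈ Icc a b, s ∈ Icc 0 T := fun s hs =>
    ⟨ht.trans (hIcc hs).1.le, (hIcc hs).2.le⟩
  have hne : ∀ s ∈ Icc a b, (γ s).1 - ξ s ≠ 0 := by
    refine ne_zero_of_lintegral_inv_sq_ne_top (K := K₁ + K₂) hab (fun s hs s' hs' => ?_) ?_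
    · have e : (γ s).1 - ξ s - ((γ s').1 - ξ s') =
          (∫ τ in s'..s, (γ τ).2) - ∫ τ in s'..s, η τ := by
        rw [← hdiff1 s hs s' hs', hξ.position_eq (hT s' hs') (hT s hs)]
        abel
      rw [e]
      refine (norm_sub_le _ _).trans ?_
      rw [add_mul]
      refine add_le_add
        (intervalIntegral.norm_integral_le_of_norm_le_const fun τ hτ => ?_)
        (intervalIntegral.norm_integral_le_of_norm_le_const fun τ hτ => ?_)
      · exact (le_max_right _ _).trans (hK₁ τ (hsub s hs s' hs' τ hτ))
      · exact hK₂ τ (hsub s hs s' hs' τ hτ)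
    · refine ne_of_eq_of_ne (lintegral_congr_ae ((ae_restrict_iff' measurableSet_Icc).2 ?_)) hF
      filter_upwards [hp] with s hs hsI
      rw [hs (hIcc hsI)]
  have hcongr' : ∀ s s', s ∈ Icc a b → s' ∈ Icc a b → ∀ᵐ τ, τ ∈ uIoc s s' →
      drift E ξ τ (ζ τ) = drift E ξ τ (γ τ) := by
    intro s s' hs hs'
    filter_upwards [hcongr s s' hs hs'] with τ hτ hτI
    rw [hτ hτI]
  have haI : a ∈ Icc a b := ⟨le_rfl, hab.le⟩
  have hbI : b ∈ Icc a b := ⟨hab.le, le_rfl⟩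
  refine ⟨hcont, fun s hs => sub_ne_zero.1 (hne s hs), ?_, fun s hs => ?_⟩
  · exact (hii a ha b hb).congr_ae
      ((ae_restrict_iff' measurableSet_uIoc).2 (hcongr' a b haI hbI))
  · rw [hdiff s hs a haI]
    exact congrArg _ (intervalIntegral.integral_congr_ae (hcongr' a s haI hs))

/-- The integral curve from `z` with the velocities of `ζ`. -/
noncomputable def pathFrom (E : ℝ → Space → Space) (ξ : ℝ → Space) (t : ℝ) (ζ : ℝ → Phase)
    (z : Phase) (s : ℝ) : Phase := z + ∫ τ in t..s, drift E ξ τ (ζ τ)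

/-- A renormalized solution issuing from `z` off the charge agrees a.e. with a trajectory. -/
theorem isTrajectory_pathFrom (hξ : IsChargePath E ξ η C T) {ζ : ℝ → Phase} {z : Phase}
    (ht : 0 ≤ t) (htT : t < T) (hζ : Measurable ζ) (hz : z.1 ≠ ξ t)
    (hlog : ∃ w, HasDistribDerivOn (fun s => logLog (ζ s)) w t T)
    (hcut : ∃ c > 0, 2 * c⁻¹ < ‖z‖ ∧ ∃ w, HasDistribDerivOn (fun s => cutoff c (ζ s)) w t T ∧
      ∫⁻ s in Ioo t T, ‖w s‖ₑ < 1)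
    (hform : ∀ i n, HasDistribDerivOn (fun s => cutForm n (phaseForm i) (ζ s))
      (fun s => fderiv ℝ (cutForm n (phaseForm i)) (ζ s) (drift E ξ s (ζ s))) t T)
    (hinit : ∀ ε > 0, ∀ h > 0, volume {s ∈ Ioo t (t + h) | ‖ζ s - z‖ < ε} ≠ 0)
    (hF : ∀ R : ℕ, ∫⁻ s in Ioo t T ∩ {s | ‖ζ s‖ ≤ R}, (‖(ζ s).1 - ξ s‖ₑ ^ 2)⁻¹ ≠ ∞) :
    IsTrajectory E ξ t T (pathFrom E ξ t ζ z) ∧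
      ∀ᵐ s, s ∈ Ioo t T → ζ s = pathFrom E ξ t ζ z s := by
  obtain ⟨w, hw⟩ := hlog
  obtain ⟨c₁, hc₁, hzc, w₁, hw₁, hw₁'⟩ := hcut
  obtain ⟨c, hc⟩ : (Ioo t T).Nonempty := nonempty_Ioo.2 htT
  have habove : ∀ a ∈ Ioo t T, ∀ b ∈ Ioo t T, ∃ R : ℝ, ∀ᵐ s, s ∈ Icc a b → ‖ζ s‖ ≤ R :=
    fun a ha b hb => ae_norm_le_of_logLog hw ha hb
  obtain ⟨hβ, p, hp⟩ := exists_ae_eq_primitive_of_phaseForm (ζ := ζ)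
    (β := fun s => drift E ξ s (ζ s)) hc fun i =>
      hasDistribDerivOn_phaseForm htT (inv_pos.2 hc₁)
        (ae_inv_le_norm_of_cutoff htT hc₁ hzc hw₁ hw₁' hinit) habove fun n => hform i n
  set γ : ℝ → Phase := fun s => p + ∫ τ in c..s, drift E ξ τ (ζ τ) with hγ
  -- So far only compact subintervals are reached. The growth of `relSpeed` has to exclude a
  -- collision or an escape to infinity at the two endpoints.
  have htraj : ∀ a ∈ Ioo t T, ∀ b ∈ Ioo t T, a < b → IsTrajectory E ξ a b γ := by
    intro a ha b hb hab
    refine isTrajectory_of_ae_eq_primitive hξ ht hc ha hb hab hβ hp ?_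
    obtain ⟨R, hR⟩ := habove a ha b hb
    obtain ⟨n, hn⟩ := exists_nat_ge R
    refine ne_top_of_le_ne_top (hF n) (lintegral_mono_set' ?_)
    filter_upwards [hR] with s hs hsI
    exact ⟨ordConnected_Ioo.out ha hb hsI, (hs hsI).trans hn⟩
  have hγc : ContinuousOn γ (Ioo t T) := continuousOn_const.add (continuousOn_primitive_Ioo hc hβ)
  -- the initial value
  have hseq : ∀ n : ℕ, ∃ s ∈ Ioo t T, s < t + 1 / (n + 1 : ℝ) ∧ ‖ζ s - z‖ < 1 / (n + 1 : ℝ) ∧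
      ζ s = γ s := fun n =>
    exists_mem_of_measure_ne_zero Nat.one_div_pos_of_nat htT (hinit _ Nat.one_div_pos_of_nat) hp
  choose σ hσ hσt hσz hσγ using hseq
  have hσlim : Tendsto σ atTop (𝓝 t) :=
    tendsto_of_tendsto_of_tendsto_of_le_of_le tendsto_const_nhds
      (by simpa using tendsto_one_div_add_atTop_nhds_zero_nat.const_add t)
      (fun n => (hσ n).1.le) (fun n => (hσt n).le)
  have hγlim : Tendsto (fun n => γ (σ n)) atTop (𝓝 z) := by
    rw [tendsto_iff_norm_sub_tendsto_zero]
    refine squeeze_zero (fun _ => norm_nonneg _) (fun n => ?_)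
      tendsto_one_div_add_atTop_nhds_zero_nat
    rw [← hσγ]; exact (hσz n).le
  have hz' : z.1 - ξ t ≠ 0 := sub_ne_zero.2 hz
  have hrel : Tendsto (fun n => relSpeed ((γ (σ n)).1 - ξ (σ n), (γ (σ n)).2 - η (σ n))) atTop
      (𝓝 (relSpeed (z.1 - ξ t, z.2 - η t))) := by
    have h1 : ContinuousAt relSpeed (z.1 - ξ t, z.2 - η t) :=
      (contDiffOn_relSpeed.contDiffAt ((isOpen_ne.preimage continuous_fst).mem_nhds
        hz')).continuousAt
    refine h1.tendsto.comp (Tendsto.prodMk_nhds ?_ ?_)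
    · exact ((continuous_fst.tendsto z).comp hγlim).sub
        ((hξ.continuous_position.tendsto t).comp hσlim)
    · exact ((continuous_snd.tendsto z).comp hγlim).sub
        ((hξ.continuous_velocity.tendsto t).comp hσlim)
  -- The starting times `σ n` decrease to `t` and the starting points tend to `z`, which is off the
  -- charge. The bounds from `σ n` therefore pass to the limit and give one constant on all of `(t,
  -- T)`.
  set A : ℝ := relSpeed (z.1 - ξ t, z.2 - η t) + 2 * C * (T - t) with hA
  have hC := hξ.bound_nonneg
  have hbd : ∀ s ∈ Ioo t T, relSpeed ((γ s).1 - ξ s, (γ s).2 - η s) ≤ A := by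
    intro s hs
    refine ge_of_tendsto (hrel.add_const (2 * C * (T - t))) ?_
    filter_upwards [hσlim.eventually (gt_mem_nhds hs.1)] with n hn
    refine ((htraj _ (hσ n) s hs hn).relSpeed_le hξ (ht.trans (hσ n).1.le) hn.le hs.2.le).trans ?_
    have : s - σ n ≤ T - t := by linarith [hs.2, (hσ n).1]
    gcongr
  have hApos : 0 ≤ A := by
    obtain ⟨s, hs⟩ := nonempty_Ioo.2 htT
    exact (relSpeed_nonneg _).trans (hbd s hs)
  have hne : ∀ s ∈ Ioo t T, (γ s).1 - ξ s ≠ 0 := by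
    intro s hs
    obtain ⟨b, hb⟩ := exists_between hs.2
    exact sub_ne_zero.2 ((htraj s hs b ⟨hs.1.trans hb.1, hb.2⟩ hb.1).ne s ⟨le_rfl, hb.1.le⟩)
  have hinv : ∀ s ∈ Ioo t T, ‖(γ s).1 - ξ s‖⁻¹ ≤ A ^ 2 / 2 := by
    intro s hs
    have h1 := two_mul_inv_le_relSpeed ((γ s).1 - ξ s, (γ s).2 - η s)
    have h2 := pow_le_pow_left₀ (relSpeed_nonneg _) (hbd s hs) 2
    simp only at h1
    linarith
  obtain ⟨K₂, hK₂⟩ := isCompact_Icc.exists_bound_of_continuousOn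
    (f := η) (s := Icc t T) hξ.continuous_velocity.continuousOn
  have hdrift : ∀ s ∈ Ioo t T,
      ‖drift E ξ s (γ s)‖ ≤ max (A + K₂) (C + (A ^ 2 / 2) ^ 2) := by
    intro s hs
    refine max_le_max ?_ ((norm_add_le _ _).trans (add_le_add (hξ.bound _ _) ?_))
    · have h1 := (norm_le_relSpeed ((γ s).1 - ξ s, (γ s).2 - η s)).trans (hbd s hs)
      have h2 := norm_sub_norm_le (γ s).2 (η s)
      have h3 := hK₂ s (Ioo_subset_Icc_self hs)
      simp only at h1
      change ‖(γ s).2‖ ≤ _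
      linarith
    · rw [norm_coulomb, ← inv_pow]
      exact pow_le_pow_left₀ (by positivity) (hinv s hs) 2
  have hmeas : AEStronglyMeasurable (fun s => drift E ξ s (ζ s)) (volume.restrict (Ioc t T)) := by
    refine (Measurable.prodMk hζ.snd (Measurable.add ?_ ?_)).aestronglyMeasurable
    · exact hξ.measurable_comp hζ.fst
    · exact measurable_coulomb.comp (hζ.fst.sub hξ.continuous_position.measurable)
  have hint : IntervalIntegrable (fun s => drift E ξ s (ζ s)) volume t T := by
    rw [intervalIntegrable_iff, uIoc_of_le htT.le]
    refine IntegrableOn.of_bound measure_Ioc_lt_top hmeas (max (A + K₂) (C + (A ^ 2 / 2) ^ 2)) ?_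
    rw [← restrict_Ioo_eq_restrict_Ioc]
    refine (ae_restrict_iff' measurableSet_Ioo).2 ?_
    filter_upwards [hp] with s hs hsI
    rw [hs hsI]
    exact hdrift s hsI
  have hsubI : ∀ u ∈ Icc t T, ∀ v ∈ Icc t T,
      IntervalIntegrable (fun s => drift E ξ s (ζ s)) volume u v := fun u hu v hv =>
    hint.mono_set (by rw [uIcc_of_le htT.le]; exact ordConnected_Icc.uIcc_subset hu hv)
  have hpc : ContinuousOn (pathFrom E ξ t ζ z) (Icc t T) := by
    have := intervalIntegral.continuousOn_primitive_interval' (μ := volume) hint left_mem_uIcc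
    rw [uIcc_of_le htT.le] at this
    exact continuousOn_const.add this
  -- Convergence of `γ (σ n)` to `z` fixes the constant of integration.
  have hγeq : ∀ s ∈ Ioo t T, γ s = pathFrom E ξ t ζ z s := by
    intro s hs
    have h1 : ∀ n, γ s = γ (σ n) + ∫ τ in (σ n)..s, drift E ξ τ (ζ τ) := by
      intro n
      simp only [hγ]
      rw [add_assoc, intervalIntegral.integral_add_adjacent_intervals
        (hsubI _ (Ioo_subset_Icc_self hc) _ (Ioo_subset_Icc_self (hσ n)))
        (hsubI _ (Ioo_subset_Icc_self (hσ n)) _ (Ioo_subset_Icc_self hs))]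
    have h2 : ∀ n, γ s = γ (σ n) + (pathFrom E ξ t ζ z s - pathFrom E ξ t ζ z (σ n)) := by
      intro n
      rw [h1 n, pathFrom, pathFrom, add_sub_add_left_eq_sub,
        intervalIntegral.integral_interval_sub_left
          (hsubI _ ⟨le_rfl, htT.le⟩ _ (Ioo_subset_Icc_self hs))
          (hsubI _ ⟨le_rfl, htT.le⟩ _ (Ioo_subset_Icc_self (hσ n)))]
    have h3 : Tendsto (fun n => pathFrom E ξ t ζ z (σ n)) atTop (𝓝 z) := by
      have h4 := (hpc t ⟨le_rfl, htT.le⟩).tendsto.comp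
        (tendsto_nhdsWithin_iff.2 ⟨hσlim, Eventually.of_forall fun n =>
          Ioo_subset_Icc_self (hσ n)⟩)
      simpa [pathFrom, Function.comp_def] using h4
    have h5 := hγlim.add (h3.const_sub (pathFrom E ξ t ζ z s))
    simp_rw [← h2] at h5
    rw [tendsto_nhds_unique tendsto_const_nhds h5]
    abel
  have hpath : ∀ᵐ s, s ∈ Ioo t T → ζ s = pathFrom E ξ t ζ z s := by
    filter_upwards [hp] with s hs hsI
    rw [← hγeq s hsI]; exact hs hsI
  have hcongr : ∀ᵐ s, s ∈ Ioc t T →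
      drift E ξ s (ζ s) = drift E ξ s (pathFrom E ξ t ζ z s) := by
    have hT : ∀ᵐ s : ℝ, s ≠ T := by simp [ae_iff, measure_singleton]
    filter_upwards [hpath, hT] with s hs hsT hsI
    rw [hs ⟨hsI.1, lt_of_le_of_ne hsI.2 hsT⟩]
  have hstart : pathFrom E ξ t ζ z t = z := by simp [pathFrom]
  refine ⟨⟨hpc, fun s hs => ?_, ?_, fun s hs => ?_⟩, hpath⟩
  · have hbound : ∀ u ∈ Ioo t T, 2 ≤ A ^ 2 * ‖(pathFrom E ξ t ζ z u).1 - ξ u‖ := by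
      intro u hu
      have h1 := hinv u hu
      have h2 : 0 < ‖(γ u).1 - ξ u‖ := norm_pos_iff.2 (hne u hu)
      rw [inv_le_iff_one_le_mul₀ h2] at h1
      rw [← hγeq u hu]
      linarith
    have hcl : ∀ u ∈ Icc t T, 2 ≤ A ^ 2 * ‖(pathFrom E ξ t ζ z u).1 - ξ u‖ := by
      intro u hu
      rw [← closure_Ioo htT.ne] at hu
      refine le_on_closure (f := fun _ => (2 : ℝ)) hbound continuousOn_const ?_ hu
      rw [closure_Ioo htT.ne]
      exact continuousOn_const.mul ((continuous_fst.comp_continuousOn hpc).sub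
        hξ.continuous_position.continuousOn).norm
    intro heq
    have := hcl s hs
    rw [heq, sub_self, norm_zero, mul_zero] at this
    linarith
  · refine hint.congr_ae ((ae_restrict_iff' measurableSet_uIoc).2 ?_)
    rwa [uIoc_of_le htT.le]
  · rw [hstart, pathFrom]
    refine congrArg _ (intervalIntegral.integral_congr_ae ?_)
    filter_upwards [hcongr] with τ hτ hτI
    rw [uIoc_of_le hs.1] at hτI
    exact hτ ⟨hτI.1, hτI.2.trans hs.2⟩

end

end VPCharge

namespace VPCharge

/-! ### Singular integrals over balls -/

theorem finrank_space : Module.finrank ℝ Space = 3 := by simp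

theorem integrableOn_ball_norm_rpow {p : ℝ} (hp : p < 3) (R : ℝ) :
    IntegrableOn (fun x : Space => ‖x‖ ^ (-p)) (Metric.ball 0 R) := by
  refine integrableOn_ball_of_norm_le_rpow (C := 1) (α := p) (by simp) (by simpa using hp) ?_ ?_
  · refine Eventually.of_forall fun x => ?_
    rw [one_mul, Real.norm_of_nonneg (Real.rpow_nonneg (norm_nonneg _) _)]
  · exact (measurable_norm.pow_const _).aestronglyMeasurable

theorem lintegral_ball_norm_rpow_lt_top {p : ℝ} (hp : p < 3) (R : ℝ) :
    ∫⁻ x in Metric.ball (0 : Space) R, ENNReal.ofReal (‖x‖ ^ (-p)) < ∞ := by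
  refine lt_of_le_of_lt (lintegral_mono fun x => ?_) (integrableOn_ball_norm_rpow hp R).2
  rw [Real.enorm_of_nonneg (Real.rpow_nonneg (norm_nonneg _) _)]

theorem inv_enorm_sq_eq {x : Space} (hx : x ≠ 0) :
    (‖x‖ₑ ^ 2)⁻¹ = ENNReal.ofReal (‖x‖ ^ (-2 : ℝ)) := by
  have : 0 < ‖x‖ := norm_pos_iff.2 hx
  rw [Real.rpow_neg (norm_nonneg _), ENNReal.ofReal_inv_of_pos (by positivity), Real.rpow_two,
    ENNReal.ofReal_pow (norm_nonneg _), ofReal_norm]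

theorem measurable_inv_enorm_sq : Measurable fun x : Space => (‖x‖ₑ ^ 2)⁻¹ := by fun_prop

theorem ae_ne (a : Space) : ∀ᵐ x : Space, x ≠ a := by simp [ae_iff, measure_singleton]

/-- The integral of `|x|⁻²` over the unit ball. -/
noncomputable def invSqMass : ℝ≥0∞ := ∫⁻ x in Metric.ball (0 : Space) 1, (‖x‖ₑ ^ 2)⁻¹

theorem invSqMass_lt_top : invSqMass < ∞ := by
  refine lt_of_le_of_lt (lintegral_mono_ae ?_)
    (lintegral_ball_norm_rpow_lt_top (p := 2) (by norm_num) 1)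
  filter_upwards [ae_restrict_of_ae (ae_ne 0)] with x hx
  exact (inv_enorm_sq_eq hx).le

/-- Within distance one of `a` a translation gives `invSqMass`; farther away the kernel is at most
one. -/
theorem lintegral_inv_enorm_sq_le (a : Space) (S : Set Space) :
    ∫⁻ x in S, (‖x - a‖ₑ ^ 2)⁻¹ ≤ invSqMass + volume S := by
  have h : ∀ x : Space, (‖x - a‖ₑ ^ 2)⁻¹ ≤
      (Metric.ball a 1).indicator (fun x => (‖x - a‖ₑ ^ 2)⁻¹) x + 1 := by
    intro x
    by_cases hx : x ∈ Metric.ball a 1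
    · rw [indicator_of_mem hx]; exact le_self_add
    · rw [indicator_of_notMem hx, zero_add, ENNReal.inv_le_one]
      have : 1 ≤ ‖x - a‖ := by simpa [dist_eq_norm] using hx
      have h2 : (1 : ℝ≥0∞) ≤ ‖x - a‖ₑ := by
        rw [← ofReal_norm]; exact ENNReal.one_le_ofReal.2 this
      exact one_le_pow₀ h2
  refine (lintegral_mono h).trans ?_
  rw [lintegral_add_right _ measurable_const, lintegral_const, one_mul, Measure.restrict_apply_univ]
  gcongr
  refine (setLIntegral_le_lintegral _ _).trans ?_
  rw [lintegral_indicator measurableSet_ball]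
  have h1 : ∫⁻ x in Metric.ball a 1, (‖x - a‖ₑ ^ 2)⁻¹ =
      ∫⁻ x, (Metric.ball (0 : Space) 1).indicator (fun x => (‖x‖ₑ ^ 2)⁻¹) (x - a) := by
    rw [← lintegral_indicator measurableSet_ball]
    congr 1; ext x
    by_cases hx : x ∈ Metric.ball a 1
    · rw [indicator_of_mem hx, indicator_of_mem]
      simpa [dist_eq_norm] using hx
    · rw [indicator_of_notMem hx, indicator_of_notMem]
      simpa [dist_eq_norm] using hx
  rw [h1, lintegral_sub_right_eq_self, lintegral_indicator measurableSet_ball, invSqMass]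

theorem setLIntegral_closedBall_fst {ρ : ℝ} {g : Space → ℝ≥0∞} (hg : Measurable g) :
    ∫⁻ z in Metric.closedBall (0 : Phase) ρ, g z.1 =
      volume (Metric.closedBall (0 : Space) ρ) * ∫⁻ x in Metric.closedBall (0 : Space) ρ, g x := by
  have h0 : (0 : Phase) = ((0 : Space), (0 : Space)) := rfl
  rw [h0, ← closedBall_prod_same, Measure.volume_eq_prod, ← Measure.prod_restrict,
    lintegral_prod (fun z : Space × Space => g z.1) (hg.comp measurable_fst).aemeasurable]
  simp only [lintegral_const, Measure.restrict_apply_univ]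
  rw [lintegral_mul_const _ hg, mul_comm]

/-! ### Flows are made of trajectories -/

theorem HasDistribDerivOn.congr_right {u w w' : ℝ → ℝ} {t T : ℝ}
    (h : HasDistribDerivOn u w t T) (hw : ∀ᵐ s, s ∈ Ioo t T → w s = w' s) :
    HasDistribDerivOn u w' t T := by
  refine ⟨h.1, ?_, fun φ h1 h2 h3 => (h.2.2 φ h1 h2 h3).trans (congrArg _ ?_)⟩
  · rw [locallyIntegrableOn_iff isOpen_Ioo.isLocallyClosed]
    intro k hk hkc
    refine (h.2.1.integrableOn_compact_subset hk hkc).congr ?_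
    refine (ae_restrict_iff' hkc.measurableSet).2 ?_
    filter_upwards [hw] with s hs hsk using hs (hk hsk)
  · refine integral_congr_ae ?_
    filter_upwards [hw] with s hs
    by_cases hsφ : s ∈ tsupport φ
    · rw [hs (h3 hsφ)]
    · rw [image_eq_zero_of_notMem_tsupport hsφ, zero_mul, zero_mul]

theorem IsRegularLagrangianFlow.congr_field {μ : Measure Phase} {L : ℝ≥0∞}
    {b b' : ℝ → Phase → Phase} {t T : ℝ} {Z : ℝ → Phase → Phase}
    (h : IsRegularLagrangianFlow μ L b t T Z) (hb : ∀ᵐ s, s ∈ Ioo t T → b s = b' s) :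
    IsRegularLagrangianFlow μ L b' t T Z where
  measurable := h.measurable
  continuous_in_measure := h.continuous_in_measure
  bounded_loglog := h.bounded_loglog
  initial := h.initial
  compression := h.compression
  renormalized β hβ := by
    filter_upwards [h.renormalized β hβ] with z hz
    refine hz.congr_right ?_
    filter_upwards [hb] with s hs hsI
    rw [hs hsI]

section

variable {μ : Measure Phase} {L : ℝ≥0∞} {E : ℝ → Space → Space}
  {ξ η : ℝ → Space} {C t T : ℝ} {Z : ℝ → Phase → Phase} {b : ℝ → Phase → Phase}

theorem IsRegularLagrangianFlow.measure_le (h : IsRegularLagrangianFlow μ L b t T Z)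
    (htT : t < T) : μ ≤ L • (volume : Measure Phase) := by
  have h1 := h.compression t ⟨le_rfl, htT.le⟩
  rwa [Measure.map_congr (g := id) h.initial, Measure.map_id] at h1

theorem ae_fst_ne (hμ : μ ≤ L • (volume : Measure Phase)) (a : Space) : ∀ᵐ z ∂μ, z.1 ≠ a := by
  have h1 : ∀ᵐ z : Phase, z.1 ≠ a := by
    rw [Measure.volume_eq_prod]
    exact Measure.quasiMeasurePreserving_fst.ae (ae_ne a)
  exact (Measure.absolutelyContinuous_of_le_smul hμ).ae_le h1

/-- Tonelli's theorem and the compression bound. This is how a singularity that is integrable in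
phase space becomes integrable in time along almost every curve. -/
theorem lintegral_flow_le [SFinite μ] (hZm : Measurable (Function.uncurry Z))
    (hcomp : ∀ᵐ s, s ∈ Ioo t T → μ.map (Z s) ≤ L • (volume : Measure Phase))
    {G : ℝ → Phase → ℝ≥0∞} (hG : Measurable (Function.uncurry G)) {B : ℝ≥0∞}
    (hB : ∀ s ∈ Ioo t T, ∫⁻ y, G s y ≤ B) :
    ∫⁻ z, (∫⁻ s in Ioo t T, G s (Z s z)) ∂μ ≤ L * B * ENNReal.ofReal (T - t) := by
  have hm : Measurable fun p : ℝ × Phase => G p.1 (Z p.1 p.2) :=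
    hG.comp (measurable_fst.prodMk hZm)
  rw [lintegral_lintegral_swap (f := fun z s => G s (Z s z))
    (hm.comp measurable_swap).aemeasurable]
  calc ∫⁻ s in Ioo t T, ∫⁻ z, G s (Z s z) ∂μ
      ≤ ∫⁻ _ in Ioo t T, L * B := by
        refine lintegral_mono_ae ((ae_restrict_iff' measurableSet_Ioo).2 ?_)
        filter_upwards [hcomp] with s hs hsI
        have hGs : Measurable (G s) := hG.comp measurable_prodMk_left
        have hZs : Measurable (Z s) := hZm.comp measurable_prodMk_left
        rw [← lintegral_map hGs hZs]
        refine (lintegral_mono' (hs hsI) le_rfl).trans ?_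
        rw [lintegral_smul_measure]
        exact mul_le_mul_right (hB s hsI) L
    _ = L * B * ENNReal.ofReal (T - t) := by
        rw [setLIntegral_const, Real.volume_Ioo]

/-- If the curves of a set of positive measure avoided the `ε`-ball about their initial points for
almost every time in `(t, t + δ)`, Fubini's theorem would give times arbitrarily near `t` at which
this set contradicts continuity in measure. -/
theorem IsRegularLagrangianFlow.ae_initial_trace [IsFiniteMeasure μ]
    (h : IsRegularLagrangianFlow μ L b t T Z)
    (htT : t < T) : ∀ᵐ z ∂μ, ∀ ε > 0, ∀ δ > 0,
      volume {s ∈ Ioo t (t + δ) | ‖Z s z - z‖ < ε} ≠ 0 := by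
  have hset : ∀ ε δ : ℝ, MeasurableSet
      {p : Phase × ℝ | p.2 ∈ Ioo t (t + δ) ∧ ‖Z p.2 p.1 - p.1‖ < ε} := fun ε δ =>
    (measurable_snd measurableSet_Ioo).inter (measurableSet_lt
      (((h.measurable.comp measurable_swap).sub measurable_fst).norm) measurable_const)
  have key : ∀ ε > 0, ∀ δ > 0, ∀ R : ℕ, ∀ᵐ z ∂μ, z ∈ phaseBall R →
      volume {s ∈ Ioo t (t + δ) | ‖Z s z - z‖ < ε} ≠ 0 := by
    intro ε hε δ hδ R
    set B : Set Phase := {z | z ∈ phaseBall R ∧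
      volume {s ∈ Ioo t (t + δ) | ‖Z s z - z‖ < ε} = 0} with hB
    have hBm : MeasurableSet B := by
      refine (measurableSet_lt continuous_phaseNorm.measurable measurable_const).inter ?_
      exact (measurable_measure_prodMk_left (hset ε δ)) (measurableSet_singleton 0)
    have hB0 : μ B = 0 := by
      by_contra hne
      have hlim := h.continuous_in_measure t ⟨le_rfl, htT.le⟩ R (ENNReal.ofReal ε)
        (ENNReal.ofReal_pos.2 hε)
      have hev := hlim.eventually (gt_mem_nhds (pos_iff_ne_zero.2 hne))
      rw [eventually_nhdsWithin_iff, Metric.eventually_nhds_iff] at hev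
      obtain ⟨r, hr, hev⟩ := hev
      have hcomm : ∀ᵐ s ∂(volume.restrict (Ioo t (t + δ))), ∀ᵐ z ∂(μ.restrict B),
          ¬ (‖Z s z - z‖ < ε) := by
        rw [Measure.ae_ae_comm]
        · refine (ae_restrict_iff' hBm).2 (Eventually.of_forall fun z hz => ?_)
          refine (ae_restrict_iff' measurableSet_Ioo).2 ?_
          filter_upwards [measure_eq_zero_iff_ae_notMem.1 hz.2] with s hs hsI hlt
          exact hs ⟨hsI, hlt⟩
        · exact (measurableSet_lt ((h.measurable.sub measurable_snd).norm) measurable_const).compl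
      have htδ : t < t + δ := by linarith
      obtain ⟨s, hs, hsr, -, hsQ⟩ := exists_mem_of_measure_ne_zero (P := fun _ => True)
        (lt_min hr (sub_pos.2 htT)) htδ
        (fun k hk => by
          have e : {s | s ∈ Ioo t (t + k) ∧ True} = Ioo t (t + k) := by ext; simp
          rw [e, Real.volume_Ioo]
          simpa using hk) ((ae_restrict_iff' measurableSet_Ioo).1 hcomm)
      have hs1 : s < t + r := hsr.trans_le (by linarith [min_le_left r (T - t)])
      have hs2 : s < T := hsr.trans_le (by linarith [min_le_right r (T - t)])
      have hlt := hev (y := s) (by rw [Real.dist_eq, abs_of_pos (by linarith [hs.1])]; linarith)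
        ⟨hs.1.le, hs2.le⟩
      refine absurd hlt (not_lt.2 ?_)
      have hBR : B ⊆ phaseBall R := fun z hz => hz.1
      calc μ B = μ.restrict B univ := by simp
        _ ≤ μ.restrict B {x | ENNReal.ofReal ε ≤ edist (Z s x) (Z t x)} := by
          refine measure_mono_ae ?_
          filter_upwards [hsQ, ae_restrict_of_ae h.initial] with z hz hzt _
          change ENNReal.ofReal ε ≤ edist (Z s z) (Z t z)
          rw [hzt, edist_dist, dist_eq_norm]
          exact ENNReal.ofReal_le_ofReal (not_lt.1 hz)
        _ ≤ _ := Measure.restrict_mono hBR le_rfl _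
    filter_upwards [measure_eq_zero_iff_ae_notMem.1 hB0] with z hz hzR h0
    exact hz ⟨hzR, h0⟩
  have h1 : ∀ᵐ z ∂μ, ∀ k m R : ℕ, z ∈ phaseBall R →
      volume {s ∈ Ioo t (t + 1 / (m + 1 : ℝ)) | ‖Z s z - z‖ < 1 / (k + 1 : ℝ)} ≠ 0 := by
    simp only [ae_all_iff]
    exact fun k m R => key _ Nat.one_div_pos_of_nat _ Nat.one_div_pos_of_nat R
  filter_upwards [h1] with z hz ε hε δ hδ
  obtain ⟨k, hk⟩ := exists_nat_one_div_lt hε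
  obtain ⟨m, hm⟩ := exists_nat_one_div_lt hδ
  obtain ⟨R, hR⟩ := exists_nat_gt (phaseNorm z)
  refine fun h0 => hz k m R hR (measure_mono_null ?_ h0)
  rintro s ⟨hs, hs'⟩
  exact ⟨⟨hs.1, hs.2.trans (by linarith)⟩, hs'.trans hk⟩

/-- The inverse square distance to the charge, cut off to a ball of phase space. -/
noncomputable def localInvSq (ξ : ℝ → Space) (R : ℝ) (s : ℝ) (y : Phase) : ℝ≥0∞ :=
  (Metric.closedBall (0 : Phase) R).indicator (fun y => (‖y.1 - ξ s‖ₑ ^ 2)⁻¹) y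

theorem measurable_localInvSq (hξ : Continuous ξ) (R : ℝ) :
    Measurable (Function.uncurry (localInvSq ξ R)) := by
  have h1 : Measurable fun p : ℝ × Phase => (‖p.2.1 - ξ p.1‖ₑ ^ 2)⁻¹ :=
    measurable_inv_enorm_sq.comp
      ((measurable_fst.comp measurable_snd).sub (hξ.measurable.comp measurable_fst))
  have h2 : MeasurableSet {p : ℝ × Phase | p.2 ∈ Metric.closedBall (0 : Phase) R} :=
    measurable_snd Metric.isClosed_closedBall.measurableSet
  exact h1.indicator h2

theorem lintegral_localInvSq_le (ξ : ℝ → Space) (R s : ℝ) :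
    ∫⁻ y, localInvSq ξ R s y ≤ volume (Metric.closedBall (0 : Space) R) *
      (invSqMass + volume (Metric.closedBall (0 : Space) R)) := by
  unfold localInvSq
  rw [lintegral_indicator Metric.isClosed_closedBall.measurableSet,
    setLIntegral_closedBall_fst (g := fun x => (‖x - ξ s‖ₑ ^ 2)⁻¹)
      (measurable_inv_enorm_sq.comp (measurable_id.sub_const _))]
  gcongr
  exact lintegral_inv_enorm_sq_le _ _

theorem measurable_lintegral_flow (hZm : Measurable (Function.uncurry Z))
    {G : ℝ → Phase → ℝ≥0∞} (hG : Measurable (Function.uncurry G)) (ν : Measure ℝ) [SFinite ν] :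
    Measurable fun z => ∫⁻ s, G s (Z s z) ∂ν :=
  Measurable.lintegral_prod_right' (f := fun p : Phase × ℝ => G p.2 (Z p.2 p.1))
    (hG.comp (measurable_snd.prodMk (hZm.comp measurable_swap)))

theorem measurable_along_flow {β : Type*} [MeasurableSpace β]
    (hZm : Measurable (Function.uncurry Z))
    {G : ℝ → Phase → β} (hG : Measurable (Function.uncurry G)) (z : Phase) :
    Measurable fun s => G s (Z s z) := by
  have hZz : Measurable fun s : ℝ => (s, Z s z) :=
    measurable_id.prodMk (hZm.comp measurable_prodMk_right)
  exact hG.comp hZz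

theorem IsRegularLagrangianFlow.ae_lintegral_inv_sq_ne_top [IsFiniteMeasure μ]
    (h : IsRegularLagrangianFlow μ L b t T Z) (hL : L ≠ ∞) (hξ : Continuous ξ) :
    ∀ᵐ z ∂μ, ∀ R : ℕ,
      ∫⁻ s in Ioo t T ∩ {s | ‖Z s z‖ ≤ R}, (‖(Z s z).1 - ξ s‖ₑ ^ 2)⁻¹ ≠ ∞ := by
  rw [ae_all_iff]
  intro R
  have hvol : volume (Metric.closedBall (0 : Space) R) ≠ ∞ := measure_closedBall_lt_top.ne
  have hint := lintegral_flow_le (μ := μ) (t := t) (T := T) h.measurable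
    (Eventually.of_forall fun s hs => h.compression s (Ioo_subset_Icc_self hs))
    (measurable_localInvSq hξ R) fun s _ => lintegral_localInvSq_le ξ R s
  have hfin : ∫⁻ z, (∫⁻ s in Ioo t T, localInvSq ξ R s (Z s z)) ∂μ ≠ ∞ :=
    ne_top_of_le_ne_top (ENNReal.mul_ne_top (ENNReal.mul_ne_top hL (ENNReal.mul_ne_top hvol
      (ENNReal.add_ne_top.2 ⟨invSqMass_lt_top.ne, hvol⟩))) ENNReal.ofReal_ne_top) hint
  filter_upwards [ae_lt_top (measurable_lintegral_flow h.measurable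
    (measurable_localInvSq hξ R) _) hfin] with z hz
  refine ne_top_of_le_ne_top hz.ne ?_
  have hSm : MeasurableSet {s | ‖Z s z‖ ≤ R} :=
    measurableSet_le (h.measurable.comp measurable_prodMk_right).norm measurable_const
  rw [inter_comm, ← Measure.restrict_restrict hSm, ← lintegral_indicator hSm]
  refine lintegral_mono fun s => ?_
  by_cases hs : ‖Z s z‖ ≤ R
  · rw [indicator_of_mem (show s ∈ {s | ‖Z s z‖ ≤ R} from hs), localInvSq,
      indicator_of_mem (by simpa using hs)]
  · rw [indicator_of_notMem (show s ∉ {s | ‖Z s z‖ ≤ R} from hs)]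
    exact zero_le

end

end VPCharge

/-! ### Avoiding the origin of phase space, and the passage from flows to trajectories -/

namespace VPCharge

section

variable {μ : Measure Phase} {L : ℝ≥0∞} {E : ℝ → Space → Space}
  {ξ η : ℝ → Space} {C t T : ℝ} {Z : ℝ → Phase → Phase}

theorem enorm_drift_le (hξ : IsChargePath E ξ η C T) (s : ℝ) (y : Phase) :
    ‖drift E ξ s y‖ₑ ≤ ENNReal.ofReal (‖y‖ + C) + (‖y.1 - ξ s‖ₑ ^ 2)⁻¹ := by
  have h1 : ‖drift E ξ s y‖ₑ = max ‖y.2‖ₑ ‖E s y.1 + coulomb (y.1 - ξ s)‖ₑ := rfl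
  have hC := hξ.bound_nonneg
  rw [h1]
  refine max_le (le_add_right ?_) ((enorm_add_le _ _).trans (add_le_add ?_ (enorm_coulomb_le _)))
  · rw [← ofReal_norm]
    have : ‖y.2‖ ≤ ‖y‖ := le_max_right _ _
    exact ENNReal.ofReal_le_ofReal (by linarith)
  · rw [← ofReal_norm]
    exact ENNReal.ofReal_le_ofReal (by linarith [hξ.bound s y.1, norm_nonneg y])

theorem measurable_drift (hE : Measurable (Function.uncurry E)) (hξ : Continuous ξ) :
    Measurable (Function.uncurry (drift E ξ)) := by
  have h1 : Measurable fun p : ℝ × Phase => E p.1 p.2.1 :=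
    hE.comp (measurable_fst.prodMk (measurable_fst.comp measurable_snd))
  have h2 : Measurable fun p : ℝ × Phase => coulomb (p.2.1 - ξ p.1) :=
    measurable_coulomb.comp
      ((measurable_fst.comp measurable_snd).sub (hξ.measurable.comp measurable_fst))
  exact (measurable_snd.comp measurable_snd).prodMk (h1.add h2)

/-- The speed of `drift E ξ`, cut off to a ball of phase space. -/
noncomputable def localSpeed (E : ℝ → Space → Space) (ξ : ℝ → Space) (R : ℝ) (s : ℝ)
    (y : Phase) : ℝ≥0∞ :=
  (Metric.closedBall (0 : Phase) R).indicator (fun y => ‖drift E ξ s y‖ₑ) y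

theorem measurable_localSpeed (hE : Measurable (Function.uncurry E)) (hξ : Continuous ξ) (R : ℝ) :
    Measurable (Function.uncurry (localSpeed E ξ R)) := by
  have h2 : MeasurableSet {p : ℝ × Phase | p.2 ∈ Metric.closedBall (0 : Phase) R} :=
    measurable_snd Metric.isClosed_closedBall.measurableSet
  exact (measurable_drift hE hξ).enorm.indicator h2

theorem lintegral_localSpeed_le (hξ : IsChargePath E ξ η C T) (R s : ℝ) :
    ∫⁻ y, localSpeed E ξ R s y ≤ volume (Metric.closedBall (0 : Space) R) *
      (ENNReal.ofReal (R + C) * volume (Metric.closedBall (0 : Space) R) +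
        (invSqMass + volume (Metric.closedBall (0 : Space) R))) := by
  have h1 : ∫⁻ y, localSpeed E ξ R s y ≤ ∫⁻ y in Metric.closedBall (0 : Phase) R,
      (ENNReal.ofReal (R + C) + (‖y.1 - ξ s‖ₑ ^ 2)⁻¹) := by
    unfold localSpeed
    rw [lintegral_indicator Metric.isClosed_closedBall.measurableSet]
    refine setLIntegral_mono' Metric.isClosed_closedBall.measurableSet fun y hy => ?_
    refine (enorm_drift_le hξ s y).trans ?_
    gcongr
    simpa using hy
  refine h1.trans ?_
  rw [setLIntegral_closedBall_fst (g := fun x => ENNReal.ofReal (R + C) + (‖x - ξ s‖ₑ ^ 2)⁻¹)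
      (measurable_const.add (measurable_inv_enorm_sq.comp (measurable_id.sub_const _))),
    lintegral_add_left measurable_const, lintegral_const, Measure.restrict_apply_univ]
  gcongr
  exact lintegral_inv_enorm_sq_le _ _

theorem enorm_fderiv_cutoff_le {A c : ℝ} (hA : ∀ c : ℝ, 0 < c → ∀ z,
    ‖fderiv ℝ (cutoff c) z‖ ≤ A * c) (hc : 0 < c) (s : ℝ) (y : Phase) :
    ‖fderiv ℝ (cutoff c) y (drift E ξ s y)‖ₑ ≤
      ENNReal.ofReal (A * c) * localSpeed E ξ (2 * c⁻¹) s y := by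
  by_cases hy : y ∈ Metric.closedBall (0 : Phase) (2 * c⁻¹)
  · rw [localSpeed, indicator_of_mem hy]
    refine (ContinuousLinearMap.le_opENorm _ _).trans ?_
    gcongr
    rw [← ofReal_norm]
    exact ENNReal.ofReal_le_ofReal (hA c hc y)
  · rw [fderiv_cutoff_eq_zero_of_gt hc (by simpa using hy)]
    simp

/-- A ball of phase space is a product of balls. The velocity factor already contributes `r³`, while
the position factor stays bounded; this beats the derivative, of order `1/r`, of a cutoff at scale
`r`. -/
theorem lintegral_localSpeed_small (hξ : IsChargePath E ξ η C T) {r : ℝ} (hr0 : 0 ≤ r) (hr : r ≤ 2)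
    (s : ℝ) : ∫⁻ y, localSpeed E ξ r s y ≤
      ENNReal.ofReal (r ^ 3) * (volume (Metric.ball (0 : Space) 1) *
        (ENNReal.ofReal (2 + C) * volume (Metric.closedBall (0 : Space) 2) +
          (invSqMass + volume (Metric.closedBall (0 : Space) 2)))) := by
  have hball : volume (Metric.closedBall (0 : Space) r) ≤ volume (Metric.closedBall (0 : Space) 2) :=
    measure_mono (Metric.closedBall_subset_closedBall hr)
  have hball' : volume (Metric.closedBall (0 : Space) r) =
      ENNReal.ofReal (r ^ 3) * volume (Metric.ball (0 : Space) 1) := by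
    rw [Measure.addHaar_closedBall _ _ hr0, finrank_space]
  refine (lintegral_localSpeed_le hξ r s).trans ?_
  rw [← mul_assoc, ← hball']
  gcongr

/-- Almost no trajectory comes close to the origin of phase space. -/
theorem IsRegularLagrangianFlow.ae_exists_cutoff [IsFiniteMeasure μ]
    (h : IsRegularLagrangianFlow μ L (drift E ξ) t T Z) (hL : L ≠ ∞)
    (hξ : IsChargePath E ξ η C T) (htT : t < T) :
    ∀ᵐ z ∂μ, ∃ n : ℕ, 2 * (n + 1 : ℝ)⁻¹ < ‖z‖ ∧ ∫⁻ s in Ioo t T,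
      ‖fderiv ℝ (cutoff (n + 1)) (Z s z) (drift E ξ s (Z s z))‖ₑ < 1 := by
  obtain ⟨A, hA0, hA⟩ := exists_fderiv_cutoff_bound
  have hlsm := fun R => measurable_localSpeed hξ.measurable hξ.continuous_position R
  obtain ⟨Q, hQtop, hQ⟩ : ∃ Q : ℝ≥0∞, Q ≠ ∞ ∧ ∀ r : ℝ, 0 ≤ r → r ≤ 2 → ∀ s,
      ∫⁻ y, localSpeed E ξ r s y ≤ ENNReal.ofReal (r ^ 3) * Q := by
    refine ⟨_, ?_, fun r hr0 hr s => lintegral_localSpeed_small hξ hr0 hr s⟩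
    have hVtop : volume (Metric.closedBall (0 : Space) 2) ≠ ∞ := measure_closedBall_lt_top.ne
    exact ENNReal.mul_ne_top measure_ball_lt_top.ne (ENNReal.add_ne_top.2
      ⟨ENNReal.mul_ne_top ENNReal.ofReal_ne_top hVtop,
        ENNReal.add_ne_top.2 ⟨invSqMass_lt_top.ne, hVtop⟩⟩)
  set D : ℝ≥0∞ := L * Q * ENNReal.ofReal (T - t) with hD
  have hDtop : D ≠ ∞ := ENNReal.mul_ne_top (ENNReal.mul_ne_top hL hQtop) ENNReal.ofReal_ne_top
  -- `W n z` dominates the total variation of the cutoff at scale `1/(n + 1)` along the curve from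
  -- `z`.
  obtain ⟨W, hW⟩ : ∃ W : ℕ → Phase → ℝ≥0∞, ∀ n z, W n z = ENNReal.ofReal (A * (n + 1)) *
      ∫⁻ s in Ioo t T, localSpeed E ξ (2 * (n + 1 : ℝ)⁻¹) s (Z s z) := ⟨_, fun _ _ => rfl⟩
  have hWm : ∀ n, Measurable (W n) := fun n => by
    rw [show W n = _ from funext (hW n)]
    exact (measurable_lintegral_flow h.measurable (hlsm _) _).const_mul _
  have hWint : ∀ n : ℕ, ∫⁻ z, W n z ∂μ ≤ ENNReal.ofReal (8 * A * (1 / (n + 1 : ℝ))) * D := by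
    intro n
    have hn : (1 : ℝ) ≤ n + 1 := by linarith [n.cast_nonneg (α := ℝ)]
    have hinv : (n + 1 : ℝ)⁻¹ ≤ 1 := inv_le_one_of_one_le₀ hn
    have h1 := lintegral_flow_le (μ := μ) (t := t) (T := T) h.measurable
      (Eventually.of_forall fun s hs => h.compression s (Ioo_subset_Icc_self hs))
      (hlsm (2 * (n + 1 : ℝ)⁻¹)) (fun s _ => hQ _ (by positivity) (by linarith) s)
    have e : A * (n + 1) * (2 * (n + 1 : ℝ)⁻¹) ^ 3 ≤ 8 * A * (1 / (n + 1 : ℝ)) := by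
      have e1 : A * (n + 1) * (2 * (n + 1 : ℝ)⁻¹) ^ 3 =
          8 * A * (1 / (n + 1 : ℝ)) * (n + 1 : ℝ)⁻¹ := by field_simp; ring
      rw [e1]
      exact mul_le_of_le_one_right (by positivity) hinv
    simp only [hW]
    rw [lintegral_const_mul _ (measurable_lintegral_flow h.measurable (hlsm _) _)]
    refine (mul_le_mul_right h1 _).trans ?_
    calc _ = ENNReal.ofReal (A * (n + 1) * (2 * (n + 1 : ℝ)⁻¹) ^ 3) * D := by
          rw [ENNReal.ofReal_mul (p := A * (n + 1)) (by positivity), hD]; ring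
      _ ≤ _ := by gcongr
  -- A bad point of norm above `1/(k + 1)` satisfies `W n z ≥ 1` for every large `n`, while the mean
  -- of `W n` is of order `1/n`. Markov's inequality makes the bad set null.
  have hS : ∀ k : ℕ, ∀ᵐ z ∂μ, 1 / (k + 1 : ℝ) < ‖z‖ →
      ∃ n : ℕ, 2 * (n + 1 : ℝ)⁻¹ < ‖z‖ ∧ W n z < 1 := by
    intro k
    have hmono : ∀ n : ℕ, 2 * (n + 1 : ℝ)⁻¹ ≤ 1 / (k + 1 : ℝ) →
        μ {z | ¬ (1 / (k + 1 : ℝ) < ‖z‖ → ∃ n : ℕ, 2 * (n + 1 : ℝ)⁻¹ < ‖z‖ ∧ W n z < 1)} ≤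
          ENNReal.ofReal (8 * A * (1 / (n + 1 : ℝ))) * D := by
      intro n hn
      have h1 := mul_meas_ge_le_lintegral (μ := μ) (hWm n) 1
      rw [one_mul] at h1
      refine (measure_mono fun z hz => ?_).trans (h1.trans (hWint n))
      rw [mem_ofPred_eq, Classical.not_imp] at hz
      by_contra hlt
      exact hz.2 ⟨n, hn.trans_lt hz.1, not_le.1 hlt⟩
    refine ae_iff.2 (le_antisymm (ge_of_tendsto (x := atTop) (f := fun n : ℕ =>
      ENNReal.ofReal (8 * A * (1 / (n + 1 : ℝ))) * D) ?_ ?_) zero_le)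
    · have h1 : Tendsto (fun n : ℕ => 8 * A * (1 / (n + 1 : ℝ))) atTop (𝓝 0) := by
        simpa using tendsto_one_div_add_atTop_nhds_zero_nat.const_mul (8 * A)
      have h2 := ENNReal.Tendsto.mul_const (b := D) (ENNReal.tendsto_ofReal h1) (Or.inr hDtop)
      simpa using h2
    · obtain ⟨N, hN⟩ := exists_nat_gt (2 * (k + 1 : ℝ))
      filter_upwards [eventually_ge_atTop N] with n hn
      apply hmono
      have : (N : ℝ) ≤ n := by exact_mod_cast hn
      rw [← div_eq_mul_inv, div_le_div_iff₀ (by positivity) (by positivity)]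
      linarith
  have hz0 : ∀ᵐ z ∂μ, z ≠ 0 := by
    filter_upwards [ae_fst_ne (h.measure_le htT) 0] with z hz h0
    exact hz (by rw [h0]; rfl)
  filter_upwards [ae_all_iff.2 hS, hz0] with z hz hz0
  obtain ⟨k, hk⟩ := exists_nat_one_div_lt (norm_pos_iff.2 hz0)
  obtain ⟨n, hn, hn'⟩ := hz k hk
  rw [hW] at hn'
  refine ⟨n, hn, lt_of_le_of_lt ?_ hn'⟩
  have hm := measurable_along_flow h.measurable (hlsm (2 * (n + 1 : ℝ)⁻¹)) z
  rw [← lintegral_const_mul _ hm]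
  refine lintegral_mono fun s => ?_
  have hn0 : (0 : ℝ) < n + 1 := by positivity
  exact enorm_fderiv_cutoff_le hA hn0 s (Z s z)

/-- Almost every curve of a regular Lagrangian flow is a trajectory. -/
theorem IsRegularLagrangianFlow.ae_isTrajectory [IsFiniteMeasure μ]
    (h : IsRegularLagrangianFlow μ L (drift E ξ) t T Z) (hL : L ≠ ∞)
    (hξ : IsChargePath E ξ η C T) (ht : 0 ≤ t) (htT : t < T) :
    ∀ᵐ z ∂μ, z.1 ≠ ξ t ∧ IsTrajectory E ξ t T (pathFrom E ξ t (fun s => Z s z) z) ∧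
      ∀ᵐ s, s ∈ Ioo t T → Z s z = pathFrom E ξ t (fun s => Z s z) z s := by
  have hcut : ∀ᵐ z ∂μ, ∀ n : ℕ, HasDistribDerivOn (fun s => cutoff (n + 1) (Z s z))
      (fun s => fderiv ℝ (cutoff (n + 1)) (Z s z) (drift E ξ s (Z s z))) t T :=
    ae_all_iff.2 fun n => h.renormalized _ (isRenormalization_cutoff (by positivity))
  have hform : ∀ᵐ z ∂μ, ∀ i, ∀ n : ℕ, HasDistribDerivOn (fun s => cutForm n (phaseForm i) (Z s z))
      (fun s => fderiv ℝ (cutForm n (phaseForm i)) (Z s z) (drift E ξ s (Z s z))) t T :=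
    ae_all_iff.2 fun i => ae_all_iff.2 fun n => h.renormalized _ (isRenormalization_cutForm n _)
  filter_upwards [ae_fst_ne (h.measure_le htT) (ξ t), h.renormalized _ isRenormalization_logLog,
    hcut, hform, h.ae_exists_cutoff hL hξ htT, h.ae_initial_trace htT,
    h.ae_lintegral_inv_sq_ne_top hL hξ.continuous_position] with z h1 h2 h3 h4 h5 h6 h7
  obtain ⟨n, hn, hn'⟩ := h5
  exact ⟨h1, isTrajectory_pathFrom hξ ht htT (h.measurable.comp measurable_prodMk_right) h1
    ⟨_, h2⟩ ⟨n + 1, by positivity, hn, _, h3 n, hn'⟩ h4 h6 h7⟩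

end

end VPCharge

namespace VPCharge

/-! ### Gauss' law and a bound of the potential -/

/-- The total mass of the surface measure of the unit sphere. -/
noncomputable def sphereMass : ℝ := (volume : Measure Space).toSphere.real univ

theorem sphereMass_pos : 0 < sphereMass := by
  rw [sphereMass, measureReal_def]
  refine ENNReal.toReal_pos ?_ (measure_ne_top _ _)
  rw [Measure.measure_univ_ne_zero]
  exact Measure.toSphere_ne_zero _

theorem continuous_fderiv_of_contDiff {φ : Space → ℝ} (hφ : ContDiff ℝ 1 φ) :
    Continuous (fderiv ℝ φ) := hφ.continuous_fderiv one_ne_zero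

theorem measurable_fderiv_apply {φ : Space → ℝ} (hφ : ContDiff ℝ 1 φ) {g : Space → Space}
    (hg : Measurable g) : Measurable fun x => fderiv ℝ φ x (g x) := by
  have h1 : Continuous fun p : (Space →L[ℝ] ℝ) × Space => p.1 p.2 := by fun_prop
  exact h1.measurable.comp ((continuous_fderiv_of_contDiff hφ).measurable.prodMk hg)

theorem exists_bound_fderiv {φ : Space → ℝ} (hφ : ContDiff ℝ 1 φ) (hc : HasCompactSupport φ) :
    ∃ A R : ℝ, 0 ≤ A ∧ 0 < R ∧ (∀ x, ‖fderiv ℝ φ x‖ ≤ A) ∧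
      ∀ x, x ∉ Metric.ball (0 : Space) R → fderiv ℝ φ x = 0 ∧ φ x = 0 := by
  obtain ⟨A, hA⟩ := (continuous_fderiv_of_contDiff hφ).bounded_above_of_compact_support
    (hc.fderiv (𝕜 := ℝ))
  obtain ⟨R, hR0, hR⟩ := hc.isCompact.isBounded.subset_ball_lt 0 0
  refine ⟨A, R, (norm_nonneg _).trans (hA 0), hR0, hA, fun x hx => ⟨?_, ?_⟩⟩
  · exact image_eq_zero_of_notMem_tsupport fun h => hx (hR (tsupport_fderiv_subset ℝ h))
  · exact image_eq_zero_of_notMem_tsupport fun h => hx (hR h)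

theorem measurable_inv_enorm_sq_sub (y : Space) : Measurable fun x : Space => (‖x - y‖ₑ ^ 2)⁻¹ :=
  measurable_inv_enorm_sq.comp (measurable_id.sub_const y)

theorem lintegral_enorm_fderiv_coulomb_le {φ : Space → ℝ} {A R : ℝ}
    (hA : ∀ x, ‖fderiv ℝ φ x‖ ≤ A)
    (hR : ∀ x, x ∉ Metric.ball (0 : Space) R → fderiv ℝ φ x = 0 ∧ φ x = 0) (y : Space) :
    ∫⁻ x, ‖fderiv ℝ φ x (coulomb (x - y))‖ₑ ≤
      ENNReal.ofReal A * (invSqMass + volume (Metric.ball (0 : Space) R)) := by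
  calc ∫⁻ x, ‖fderiv ℝ φ x (coulomb (x - y))‖ₑ
      ≤ ∫⁻ x, (Metric.ball (0 : Space) R).indicator
          (fun x => ENNReal.ofReal A * (‖x - y‖ₑ ^ 2)⁻¹) x := by
        refine lintegral_mono fun x => ?_
        by_cases hx : x ∈ Metric.ball (0 : Space) R
        · rw [indicator_of_mem hx]
          refine (ContinuousLinearMap.le_opENorm _ _).trans (mul_le_mul' ?_ (enorm_coulomb_le _))
          rw [← ofReal_norm]
          exact ENNReal.ofReal_le_ofReal (hA x)
        · rw [(hR x hx).1]; simp
    _ ≤ _ := by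
        rw [lintegral_indicator measurableSet_ball,
          lintegral_const_mul _ (measurable_inv_enorm_sq_sub y)]
        gcongr
        exact lintegral_inv_enorm_sq_le _ _

theorem integrable_fderiv_coulomb {φ : Space → ℝ} (hφ : ContDiff ℝ 1 φ)
    (hc : HasCompactSupport φ) (y : Space) :
    Integrable fun x => fderiv ℝ φ x (coulomb (x - y)) := by
  obtain ⟨A, R, -, -, hA, hR⟩ := exists_bound_fderiv hφ hc
  refine ⟨(measurable_fderiv_apply hφ
    (measurable_coulomb.comp (measurable_id.sub_const y))).aestronglyMeasurable, ?_⟩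
  exact (lintegral_enorm_fderiv_coulomb_le hA hR y).trans_lt (ENNReal.mul_lt_top
    ENNReal.ofReal_lt_top (ENNReal.add_lt_top.2 ⟨invSqMass_lt_top, measure_ball_lt_top⟩))

/-- Gauss' law, tested against `φ`. -/
theorem integral_fderiv_coulomb {φ : Space → ℝ} (hφ : ContDiff ℝ 1 φ)
    (hc : HasCompactSupport φ) :
    ∫ x, fderiv ℝ φ x (coulomb x) = -(sphereMass * φ 0) := by
  obtain ⟨A, R, hA0, hR0, hA, hR⟩ := exists_bound_fderiv hφ hc
  have hint : Integrable fun x => fderiv ℝ φ x (coulomb x) := by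
    simpa using integrable_fderiv_coulomb hφ hc 0
  have hmp := (volume : Measure Space).measurePreserving_homeomorphUnitSphereProd
  have hemb := (homeomorphUnitSphereProd Space).measurableEmbedding
  set f : Space → ℝ := fun x => fderiv ℝ φ x (coulomb x) with hf
  set F : Metric.sphere (0 : Space) 1 × Ioi (0 : ℝ) → ℝ := fun p => f (p.2.1 • p.1.1) with hF
  have hFcomp : ∀ x : ({0}ᶜ : Set Space), F (homeomorphUnitSphereProd Space x) = f x := by
    intro x
    have : (((homeomorphUnitSphereProd Space).symm (homeomorphUnitSphereProd Space x) :
      ({0}ᶜ : Set Space)) : Space) = x := by rw [Homeomorph.symm_apply_apply]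
    rw [homeomorphUnitSphereProd_symm_apply_coe] at this
    simp only [hF]
    rw [this]
  -- The radial weight `r²` cancels the size of the Coulomb field. What remains on each ray is the
  -- integral of the radial derivative of `φ`, which is `-φ 0`.
  have hradial : ∀ ω : Metric.sphere (0 : Space) 1,
      ∫ r : Ioi (0 : ℝ), F (ω, r) ∂(Measure.volumeIoiPow 2) = -φ 0 := by
    intro ω
    have hω : ‖(ω : Space)‖ = 1 := by simp
    have h1 : ∀ r : ℝ, HasDerivAt (fun r : ℝ => φ (r • (ω : Space)))
        (fderiv ℝ φ (r • (ω : Space)) ω) r := by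
      intro r
      have h2 : HasDerivAt (fun r : ℝ => r • (ω : Space)) (ω : Space) r := by
        simpa using (hasDerivAt_id r).smul_const (ω : Space)
      exact ((hφ.differentiable one_ne_zero _).hasFDerivAt).comp_hasDerivAt r h2
    have hout : ∀ r : ℝ, R ≤ r → r • (ω : Space) ∉ Metric.ball (0 : Space) R := by
      intro r hr
      simp [norm_smul, hω, abs_of_nonneg (hR0.le.trans hr), hr]
    have h3 : IntegrableOn (fun r : ℝ => fderiv ℝ φ (r • (ω : Space)) ω) (Ioi 0) := by
      have hcont : Continuous fun r : ℝ => fderiv ℝ φ (r • (ω : Space)) ω :=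
        ((continuous_fderiv_of_contDiff hφ).comp (continuous_id.smul continuous_const)).clm_apply
          continuous_const
      rw [← Ioc_union_Ioi_eq_Ioi hR0.le]
      refine IntegrableOn.union ?_ ?_
      · exact (hcont.continuousOn.integrableOn_Icc).mono_set Ioc_subset_Icc_self
      · refine (integrableOn_zero).congr_fun (fun r hr => ?_) measurableSet_Ioi
        rw [(hR _ (hout r (le_of_lt hr))).1]; rfl
    have h4 : ∫ r in Ioi (0 : ℝ), fderiv ℝ φ (r • (ω : Space)) ω = 0 - φ ((0 : ℝ) • (ω : Space)) := by
      refine integral_Ioi_of_hasDerivAt_of_tendsto (h1 0).continuousAt.continuousWithinAt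
        (fun r _ => h1 r) h3 ?_
      refine tendsto_const_nhds.congr' ?_
      filter_upwards [eventually_ge_atTop R] with r hr
      exact ((hR _ (hout r hr)).2).symm
    rw [zero_smul, zero_sub] at h4
    rw [← h4, Measure.volumeIoiPow, ← integral_subtype_comap measurableSet_Ioi]
    simp only [ENNReal.ofReal]
    rw [integral_withDensity_eq_integral_smul
      ((measurable_subtype_coe.pow_const _).real_toNNReal)]
    refine integral_congr_ae (Eventually.of_forall fun r => ?_)
    have hr : (0 : ℝ) < r := r.2
    simp only [hF, hf]
    rw [NNReal.smul_def, Real.coe_toNNReal _ (pow_nonneg hr.le _), coulomb, norm_smul, hω,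
      Real.norm_of_nonneg hr.le, mul_one, smul_smul, map_smul, smul_smul]
    have : (r : ℝ) ^ 2 • ((((r : ℝ) ^ 3)⁻¹ * r) : ℝ) = (1 : ℝ) := by
      rw [smul_eq_mul]; field_simp
    rw [smul_eq_mul] at this
    simp only [smul_eq_mul]
    rw [this, one_mul]
  have hFint : Integrable F ((volume : Measure Space).toSphere.prod (Measure.volumeIoiPow 2)) := by
    have h5 := hmp.integrable_comp_emb (g := F) hemb
    rw [finrank_space] at h5
    refine h5.1 ?_
    have h6 : F ∘ (homeomorphUnitSphereProd Space) = fun x : ({0}ᶜ : Set Space) => f x :=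
      funext hFcomp
    rw [h6]
    exact (integrableOn_iff_comap_subtypeVal (measurableSet_singleton 0).compl).1 hint.integrableOn
  calc ∫ x, f x = ∫ x : ({0}ᶜ : Set Space), f x ∂((volume : Measure Space).comap (↑)) := by
        rw [integral_subtype_comap (measurableSet_singleton _).compl f, restrict_compl_singleton]
    _ = ∫ p, F p ∂((volume : Measure Space).toSphere.prod (Measure.volumeIoiPow 2)) := by
        have h5 := hmp.integral_comp hemb F
        rw [finrank_space] at h5
        rw [← h5]
        simp only [hFcomp]
    _ = ∫ _ : Metric.sphere (0 : Space) 1, -φ 0 ∂(volume : Measure Space).toSphere := by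
        rw [integral_prod _ hFint]
        simp only [hradial]
    _ = _ := by
        rw [integral_const, smul_eq_mul, sphereMass]; ring

end VPCharge

/-! ### Fields of densities, and the consequence of their Hölder continuity -/

namespace VPCharge

/-- The field `∫ ρ(y) (x - y) / |x - y|³ dy` of a spatial density. -/
noncomputable def densityField (ρ : Space → ℝ) (x : Space) : Space := ∫ y, ρ y • coulomb (x - y)

theorem integral_fderiv_const {φ : Space → ℝ} (hφ : ContDiff ℝ 1 φ) (hc : HasCompactSupport φ)
    (e : Space) : ∫ x, fderiv ℝ φ x e = 0 := by
  have h1 : Integrable fun x => fderiv ℝ φ x e :=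
    ((continuous_fderiv_of_contDiff hφ).clm_apply continuous_const).integrable_of_hasCompactSupport
      (by
        refine (hc.fderiv (𝕜 := ℝ)).mono fun x hx h => hx ?_
        simp [h])
  have h2 := integral_mul_fderiv_eq_neg_fderiv_mul_of_integrable (μ := (volume : Measure Space))
    (f := fun _ => (1 : ℝ)) (g := φ) (v := e) (by simp) (by simpa using h1)
    (by simpa using hφ.continuous.integrable_of_hasCompactSupport hc)
    (fun x _ => differentiableAt_const _) (fun x _ => hφ.differentiable one_ne_zero x)
  simpa using h2

theorem integrable_prod_fderiv_coulomb {ρ φ : Space → ℝ} (hρm : Measurable ρ)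
    (hρi : Integrable ρ) (hφ : ContDiff ℝ 1 φ) (hc : HasCompactSupport φ) :
    Integrable (fun p : Space × Space => ρ p.1 * fderiv ℝ φ p.2 (coulomb (p.2 - p.1)))
      ((volume : Measure Space).prod volume) := by
  obtain ⟨A, R, -, -, hA, hR⟩ := exists_bound_fderiv hφ hc
  have h1 : Continuous fun p : (Space →L[ℝ] ℝ) × Space => p.1 p.2 := by fun_prop
  have hm : Measurable fun p : Space × Space => ρ p.1 * fderiv ℝ φ p.2 (coulomb (p.2 - p.1)) := by
    refine (hρm.comp measurable_fst).mul (h1.measurable.comp (Measurable.prodMk ?_ ?_))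
    · exact (continuous_fderiv_of_contDiff hφ).measurable.comp measurable_snd
    · exact measurable_coulomb.comp (measurable_snd.sub measurable_fst)
  refine ⟨hm.aestronglyMeasurable, ?_⟩
  rw [hasFiniteIntegral_iff_enorm, lintegral_prod _ hm.enorm.aemeasurable]
  simp only [enorm_mul]
  calc ∫⁻ y, ∫⁻ x, ‖ρ y‖ₑ * ‖fderiv ℝ φ x (coulomb (x - y))‖ₑ
      ≤ ∫⁻ y, ‖ρ y‖ₑ *
          (ENNReal.ofReal A * (invSqMass + volume (Metric.ball (0 : Space) R))) := by
        refine lintegral_mono fun y => ?_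
        rw [lintegral_const_mul _ (show Measurable fun x => ‖fderiv ℝ φ x (coulomb (x - y))‖ₑ from
          (measurable_fderiv_apply hφ (measurable_coulomb.comp (measurable_id.sub_const y))).enorm)]
        gcongr
        exact lintegral_enorm_fderiv_coulomb_le hA hR y
    _ < ∞ := by
        rw [lintegral_mul_const _ hρm.enorm]
        exact ENNReal.mul_lt_top hρi.2 (ENNReal.mul_lt_top ENNReal.ofReal_lt_top
          (ENNReal.add_lt_top.2 ⟨invSqMass_lt_top, measure_ball_lt_top⟩))

/-- The field of an integrable density is defined by an integrable integrand almost everywhere. -/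
theorem ae_integrable_smul_coulomb {ρ : Space → ℝ} (hρm : Measurable ρ) (hρi : Integrable ρ) :
    ∀ᵐ x : Space, Integrable fun y => ρ y • coulomb (x - y) := by
  have key : ∀ n : ℕ, ∀ᵐ x : Space, x ∈ Metric.ball (0 : Space) n →
      Integrable fun y => ρ y • coulomb (x - y) := by
    intro n
    have hm : Measurable fun p : Space × Space => ‖ρ p.2‖ₑ * (‖p.1 - p.2‖ₑ ^ 2)⁻¹ :=
      (hρm.comp measurable_snd).enorm.mul
        (measurable_inv_enorm_sq.comp (measurable_fst.sub measurable_snd))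
    have hfin : ∫⁻ x in Metric.ball (0 : Space) n, ∫⁻ y, ‖ρ y‖ₑ * (‖x - y‖ₑ ^ 2)⁻¹ ≠ ∞ := by
      rw [lintegral_lintegral_swap hm.aemeasurable]
      refine ne_of_lt ?_
      calc ∫⁻ y, ∫⁻ x in Metric.ball (0 : Space) n, ‖ρ y‖ₑ * (‖x - y‖ₑ ^ 2)⁻¹
          ≤ ∫⁻ y, ‖ρ y‖ₑ * (invSqMass + volume (Metric.ball (0 : Space) n)) := by
            refine lintegral_mono fun y => ?_
            rw [lintegral_const_mul _ (measurable_inv_enorm_sq_sub y)]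
            gcongr
            exact lintegral_inv_enorm_sq_le _ _
        _ < ∞ := by
          rw [lintegral_mul_const _ hρm.enorm]
          exact ENNReal.mul_lt_top hρi.2 (ENNReal.add_lt_top.2
            ⟨invSqMass_lt_top, measure_ball_lt_top⟩)
    have := ae_lt_top hm.lintegral_prod_right' hfin
    filter_upwards [(ae_restrict_iff' measurableSet_ball).1 this] with x hx hxn
    refine ⟨(hρm.smul (measurable_coulomb.comp
      (measurable_const.sub measurable_id))).aestronglyMeasurable, lt_of_le_of_lt ?_ (hx hxn)⟩
    refine lintegral_mono fun y => ?_
    rw [enorm_smul]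
    gcongr
    exact enorm_coulomb_le _
  filter_upwards [ae_all_iff.2 key] with x hx
  obtain ⟨n, hn⟩ := exists_nat_gt ‖x‖
  exact hx n (by simpa using hn)

/-- Superposition: Gauss' law for a unit charge at `y`, integrated against `ρ(y)` by Fubini's
theorem. -/
theorem integral_fderiv_densityField {ρ φ : Space → ℝ} (hρm : Measurable ρ)
    (hρi : Integrable ρ) (hφ : ContDiff ℝ 1 φ) (hc : HasCompactSupport φ) :
    ∫ x, fderiv ℝ φ x (densityField ρ x) = -(sphereMass * ∫ y, ρ y * φ y) := by
  have h1 : ∀ y, ∫ x, ρ y * fderiv ℝ φ x (coulomb (x - y)) = -(sphereMass * (ρ y * φ y)) := by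
    intro y
    have h2 := integral_fderiv_coulomb (φ := fun x => φ (x + y))
      (hφ.comp (contDiff_id.add contDiff_const)) (hc.comp_homeomorph (Homeomorph.addRight y))
    simp only [fderiv_comp_add_right, zero_add] at h2
    have h3 := integral_add_right_eq_self (μ := (volume : Measure Space))
      (fun x => fderiv ℝ φ x (coulomb (x - y))) y
    simp only [add_sub_cancel_right] at h3
    rw [integral_const_mul, ← h3, h2]
    ring
  have h4 : ∫ x, fderiv ℝ φ x (densityField ρ x) =
      ∫ x, ∫ y, ρ y * fderiv ℝ φ x (coulomb (x - y)) := by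
    refine integral_congr_ae ?_
    filter_upwards [ae_integrable_smul_coulomb hρm hρi] with x hx
    rw [densityField, ← (fderiv ℝ φ x).integral_comp_comm hx]
    simp only [map_smul, smul_eq_mul]
  rw [h4, integral_integral_swap (f := fun x y => ρ y * fderiv ℝ φ x (coulomb (x - y)))
    (integrable_prod_fderiv_coulomb hρm hρi hφ hc).swap]
  simp only [h1]
  rw [integral_neg, integral_const_mul]

/-- A bump on physical space, `1` on the unit ball and `0` off the ball of radius `2`. -/
noncomputable def spaceBump : ContDiffBump (0 : Space) := ⟨1, 2, one_pos, one_lt_two⟩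

/-- A regularization of `|x|⁻²`, cut off to a ball. -/
noncomputable def softInvSq (ε : ℝ) (x : Space) : ℝ := (‖x‖ ^ 2 + ε ^ 2)⁻¹ * spaceBump x

theorem contDiff_softInvSq {ε : ℝ} (hε : 0 < ε) : ContDiff ℝ 1 (softInvSq ε) :=
  (((contDiff_id.norm_sq ℝ).add contDiff_const).inv fun x => by
    have : 0 < ‖(id x : Space)‖ ^ 2 + ε ^ 2 := by positivity
    exact this.ne').mul spaceBump.contDiff

theorem softInvSq_nonneg (ε : ℝ) (x : Space) : 0 ≤ softInvSq ε x :=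
  mul_nonneg (by positivity) spaceBump.nonneg

theorem hasCompactSupport_softInvSq (ε : ℝ) : HasCompactSupport (softInvSq ε) :=
  spaceBump.hasCompactSupport.mul_left

/-- What matters is that the constant does not depend on `ε`. The radius `3` only has to exceed the
support radius `2` of the bump. -/
theorem exists_fderiv_softInvSq_bound : ∃ A : ℝ, 0 ≤ A ∧ ∀ ε : ℝ, 0 < ε → ∀ x : Space, x ≠ 0 →
    ‖fderiv ℝ (softInvSq ε) x‖ ≤
      (Metric.ball (0 : Space) 3).indicator (fun x => A * ‖x‖ ^ (-3 : ℝ)) x := by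
  have hsm : ContDiff ℝ 1 spaceBump := spaceBump.contDiff
  obtain ⟨A, hA⟩ := (continuous_fderiv_of_contDiff hsm).bounded_above_of_compact_support
    (spaceBump.hasCompactSupport.fderiv (𝕜 := ℝ))
  have hA0 : 0 ≤ A := (norm_nonneg _).trans (hA 0)
  -- `2` comes from differentiating the inverse square, and `3 * A` from the bump, since `|x|⁻² ≤ 3
  -- |x|⁻³` for `|x| ≤ 3`.
  refine ⟨2 + 3 * A, by positivity, fun ε hε x hx => ?_⟩
  have hx0 : 0 < ‖x‖ := norm_pos_iff.2 hx
  by_cases hxb : x ∈ Metric.ball (0 : Space) 3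
  · have hx3 : ‖x‖ ≤ 3 := by
      have := mem_ball_zero_iff.1 hxb
      exact this.le
    rw [indicator_of_mem hxb]
    have hq : 0 < ‖x‖ ^ 2 + ε ^ 2 := by positivity
    have h1 : HasFDerivAt (fun x : Space => (‖x‖ ^ 2 + ε ^ 2)⁻¹)
        (-((‖x‖ ^ 2 + ε ^ 2) ^ 2)⁻¹ • (2 • innerSL ℝ x)) x :=
      (HasDerivAt.comp_hasFDerivAt x (hasDerivAt_inv hq.ne')
        (((hasStrictFDerivAt_norm_sq x).hasFDerivAt).add_const (ε ^ 2)))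
    have h2 : HasFDerivAt (softInvSq ε) _ x :=
      h1.mul (hsm.differentiable one_ne_zero x).hasFDerivAt
    have h3 : (‖x‖ ^ 2 + ε ^ 2)⁻¹ ≤ (‖x‖ ^ 2)⁻¹ :=
      inv_anti₀ (by positivity) (by nlinarith [sq_nonneg ε])
    have hpow : ‖x‖ ^ (-3 : ℝ) = (‖x‖ ^ 3)⁻¹ := by
      rw [Real.rpow_neg (norm_nonneg _)]; norm_cast
    rw [h2.fderiv, hpow]
    refine (norm_add_le _ _).trans ?_
    rw [norm_smul, norm_smul, norm_smul, Real.norm_of_nonneg (inv_nonneg.2 hq.le),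
      Real.norm_of_nonneg spaceBump.nonneg, norm_neg, Real.norm_of_nonneg (by positivity)]
    have h4 : ‖(2 • innerSL ℝ x : Space →L[ℝ] ℝ)‖ ≤ 2 * ‖x‖ := by
      rw [two_nsmul]
      refine (norm_add_le _ _).trans ?_
      rw [innerSL_apply_norm]; linarith
    have h5 : ((‖x‖ ^ 2 + ε ^ 2) ^ 2)⁻¹ ≤ ((‖x‖ ^ 2) ^ 2)⁻¹ := by
      rw [← inv_pow, ← inv_pow]
      exact pow_le_pow_left₀ (by positivity) h3 2
    have h6 : (‖x‖ ^ 2 + ε ^ 2)⁻¹ * ‖fderiv ℝ spaceBump x‖ ≤ 3 * A * (‖x‖ ^ 3)⁻¹ := by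
      calc (‖x‖ ^ 2 + ε ^ 2)⁻¹ * ‖fderiv ℝ spaceBump x‖ ≤ (‖x‖ ^ 2)⁻¹ * A :=
            mul_le_mul h3 (hA x) (norm_nonneg _) (by positivity)
        _ = ‖x‖ * A * (‖x‖ ^ 3)⁻¹ := by field_simp
        _ ≤ 3 * A * (‖x‖ ^ 3)⁻¹ := by gcongr
    have h7 : spaceBump x * (((‖x‖ ^ 2 + ε ^ 2) ^ 2)⁻¹ * ‖(2 • innerSL ℝ x : Space →L[ℝ] ℝ)‖) ≤
        2 * (‖x‖ ^ 3)⁻¹ := by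
      calc _ ≤ 1 * (((‖x‖ ^ 2) ^ 2)⁻¹ * (2 * ‖x‖)) :=
            mul_le_mul spaceBump.le_one (mul_le_mul h5 h4 (norm_nonneg _) (by positivity))
              (by positivity) zero_le_one
        _ = 2 * (‖x‖ ^ 3)⁻¹ := by field_simp
    linarith
  · rw [indicator_of_notMem hxb]
    have : fderiv ℝ (softInvSq ε) x = 0 := by
      refine image_eq_zero_of_notMem_tsupport fun h => hxb ?_
      have h8 := tsupport_fderiv_subset ℝ h
      have h9 : tsupport (softInvSq ε) ⊆ Metric.closedBall 0 2 := by
        rw [← show tsupport spaceBump = Metric.closedBall 0 2 from spaceBump.tsupport_eq]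
        exact tsupport_mul_subset_right
      have := h9 h8
      rw [mem_closedBall_zero_iff] at this
      rw [mem_ball_zero_iff]; linarith
    rw [this, norm_zero]

/-- A field in `C^{0,α}` forces a uniform bound on the potential with kernel `|x|⁻²`. -/
theorem exists_lintegral_inv_sq_bound {α C : ℝ} (hα : 0 < α) (M : ℝ≥0∞) (hM : M ≠ ∞) :
    ∃ B : ℝ≥0∞, B ≠ ∞ ∧ ∀ ρ : Space → ℝ, Measurable ρ → (∀ x, 0 ≤ ρ x) →
      ∫⁻ x, ENNReal.ofReal (ρ x) ≤ M →
      (∀ x y, ‖densityField ρ x - densityField ρ y‖ ≤ C * ‖x - y‖ ^ α) →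
      ∀ x₀, ∫⁻ y, ENNReal.ofReal (ρ y) * (‖y - x₀‖ₑ ^ 2)⁻¹ ≤ B := by
  obtain ⟨A, hA0, hA⟩ := exists_fderiv_softInvSq_bound
  set D : ℝ≥0∞ := ∫⁻ x in Metric.ball (0 : Space) 3, ENNReal.ofReal (A * |C| * ‖x‖ ^ (α - 3))
    with hD
  have hDt : D < ∞ := by
    have h1 := lintegral_ball_norm_rpow_lt_top (p := 3 - α) (by linarith) 3
    have h2 : D = ENNReal.ofReal (A * |C|) *
        ∫⁻ x in Metric.ball (0 : Space) 3, ENNReal.ofReal (‖x‖ ^ (-(3 - α))) := by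
      rw [hD, ← lintegral_const_mul' _ _ ENNReal.ofReal_ne_top]
      refine lintegral_congr fun x => ?_
      rw [← ENNReal.ofReal_mul (by positivity), neg_sub]
    rw [h2]
    exact ENNReal.mul_lt_top ENNReal.ofReal_lt_top h1
  refine ⟨ENNReal.ofReal sphereMass⁻¹ * D + M, by finiteness, ?_⟩
  intro ρ hρm hρ0 hρM hρC x₀
  have hρi : Integrable ρ := ⟨hρm.aestronglyMeasurable, by
    rw [hasFiniteIntegral_iff_ofReal (Eventually.of_forall hρ0)]
    exact hρM.trans_lt hM.lt_top⟩
  have key : ∀ ε : ℝ, 0 < ε → ∫⁻ y, ENNReal.ofReal (ρ y * softInvSq ε (y - x₀)) ≤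
      ENNReal.ofReal sphereMass⁻¹ * D := by
    intro ε hε
    set φ : Space → ℝ := fun x => softInvSq ε (x - x₀) with hφd
    have hφ : ContDiff ℝ 1 φ := (contDiff_softInvSq hε).comp (contDiff_id.sub contDiff_const)
    have hc : HasCompactSupport φ :=
      (hasCompactSupport_softInvSq ε).comp_homeomorph (Homeomorph.subRight x₀)
    have h1 := integral_fderiv_densityField hρm hρi hφ hc
    have h2 := integral_fderiv_const hφ hc (densityField ρ x₀)
    have hcont : Continuous (densityField ρ) := by
      refine continuous_iff_continuousAt.2 fun x => tendsto_iff_norm_sub_tendsto_zero.2 ?_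
      refine squeeze_zero (fun _ => norm_nonneg _) (fun y => hρC y x) ?_
      have h : Continuous fun y : Space => C * ‖y - x‖ ^ α :=
        continuous_const.mul ((continuous_id.sub continuous_const).norm.rpow_const
          fun _ => Or.inr hα.le)
      simpa [hα.ne'] using h.tendsto x
    have h3 : ∀ e : Space → Space, Continuous e → Integrable fun x => fderiv ℝ φ x (e x) := by
      intro e he
      refine ((continuous_fderiv_of_contDiff hφ).clm_apply he).integrable_of_hasCompactSupport ?_
      exact (hc.fderiv (𝕜 := ℝ)).mono fun x hx h => hx (by simp [h])
    -- A constant field pairs to zero with `∇φ`, so the value of the field at `x₀` may be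
    -- subtracted. The Hölder bound then improves `|x - x₀|⁻³` to the integrable `|x - x₀|^(α - 3)`,
    -- uniformly in `ε`, `ρ` and `x₀`.
    have h4 : sphereMass * ∫ y, ρ y * φ y =
        ∫ x, fderiv ℝ φ x (densityField ρ x₀ - densityField ρ x) := by
      simp only [map_sub]
      rw [integral_sub (h3 _ continuous_const) (h3 _ hcont), h1, h2]; ring
    have h5 : ∫ y, ρ y * φ y = sphereMass⁻¹ *
        ∫ x, fderiv ℝ φ x (densityField ρ x₀ - densityField ρ x) := by
      rw [← h4, inv_mul_cancel_left₀ sphereMass_pos.ne']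
    have h6 : ∫⁻ x, ‖fderiv ℝ φ x (densityField ρ x₀ - densityField ρ x)‖ₑ ≤ D := by
      have h7 : D = ∫⁻ x, (Metric.ball (0 : Space) 3).indicator
          (fun u => ENNReal.ofReal (A * |C| * ‖u‖ ^ (α - 3))) (x - x₀) := by
        rw [lintegral_sub_right_eq_self (fun x => (Metric.ball (0 : Space) 3).indicator
          (fun u => ENNReal.ofReal (A * |C| * ‖u‖ ^ (α - 3))) x), hD,
          lintegral_indicator measurableSet_ball]
      rw [h7]
      refine lintegral_mono_ae ?_
      filter_upwards [ae_ne x₀] with x hx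
      have hx0 : x - x₀ ≠ 0 := sub_ne_zero.2 hx
      have h8 := hA ε hε _ hx0
      have h9 : fderiv ℝ φ x = fderiv ℝ (softInvSq ε) (x - x₀) := by simp only [hφd, fderiv_comp_sub]
      rw [h9]
      by_cases hb : x - x₀ ∈ Metric.ball (0 : Space) 3
      · rw [indicator_of_mem hb] at h8 ⊢
        rw [← ofReal_norm]
        refine ENNReal.ofReal_le_ofReal ((ContinuousLinearMap.le_opNorm _ _).trans ?_)
        have hn : 0 < ‖x - x₀‖ := norm_pos_iff.2 hx0
        calc _ ≤ (A * ‖x - x₀‖ ^ (-3 : ℝ)) * (|C| * ‖x - x₀‖ ^ α) := by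
              refine mul_le_mul h8 ?_ (norm_nonneg _) (by positivity)
              rw [← norm_sub_rev x₀ x]
              exact (hρC _ _).trans (by gcongr; exact le_abs_self C)
          _ = A * |C| * (‖x - x₀‖ ^ α * ‖x - x₀‖ ^ (-3 : ℝ)) := by ring
          _ = _ := by rw [← Real.rpow_add hn]; rfl
      · rw [indicator_of_notMem hb] at h8 ⊢
        rw [norm_le_zero_iff.1 h8]; simp
    have hb : Integrable fun y => ρ y * φ y := by
      obtain ⟨K, hK⟩ := hφ.continuous.bounded_above_of_compact_support hc
      exact hρi.mul_bdd hφ.continuous.aestronglyMeasurable (Eventually.of_forall hK)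
    rw [← ofReal_integral_eq_lintegral_ofReal hb
      (Eventually.of_forall fun y => mul_nonneg (hρ0 y) (softInvSq_nonneg _ _)), h5,
      ENNReal.ofReal_mul (inv_nonneg.2 sphereMass_pos.le)]
    gcongr
    calc ENNReal.ofReal (∫ x, fderiv ℝ φ x (densityField ρ x₀ - densityField ρ x))
        ≤ ‖∫ x, fderiv ℝ φ x (densityField ρ x₀ - densityField ρ x)‖ₑ := by
          rw [← ofReal_norm]
          exact ENNReal.ofReal_le_ofReal (Real.le_norm_self _)
      _ ≤ _ := (enorm_integral_le_lintegral_enorm _).trans h6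
  -- Fatou's lemma removes the regularization where the bump equals one. Outside this ball the
  -- kernel is at most one and the total mass suffices.
  have hlim : ∫⁻ y in Metric.ball x₀ 1, ENNReal.ofReal (ρ y) * (‖y - x₀‖ₑ ^ 2)⁻¹ ≤
      ENNReal.ofReal sphereMass⁻¹ * D := by
    have hε : ∀ n : ℕ, (0 : ℝ) < 1 / ((n : ℝ) + 1) := fun n => by positivity
    calc ∫⁻ y in Metric.ball x₀ 1, ENNReal.ofReal (ρ y) * (‖y - x₀‖ₑ ^ 2)⁻¹
        ≤ ∫⁻ y in Metric.ball x₀ 1, liminf (fun n : ℕ =>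
            ENNReal.ofReal (ρ y * softInvSq (1 / ((n : ℝ) + 1)) (y - x₀))) atTop := by
          refine lintegral_mono_ae ?_
          filter_upwards [ae_restrict_of_ae (ae_ne x₀), ae_restrict_mem measurableSet_ball]
            with y hy hyb
          have hy0 : y - x₀ ≠ 0 := sub_ne_zero.2 hy
          have hpos : 0 < ‖y - x₀‖ := norm_pos_iff.2 hy0
          have hone : spaceBump (y - x₀) = 1 :=
            spaceBump.one_of_mem_closedBall (by
              rw [mem_closedBall_zero_iff, ← dist_eq_norm]; exact (Metric.mem_ball.1 hyb).le)
          have h1 : Tendsto (fun n : ℕ => ENNReal.ofReal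
              (ρ y * softInvSq (1 / ((n : ℝ) + 1)) (y - x₀))) atTop
              (𝓝 (ENNReal.ofReal (ρ y * ((‖y - x₀‖ ^ 2 + 0 ^ 2)⁻¹ * 1)))) := by
            refine (ENNReal.continuous_ofReal.tendsto _).comp (Tendsto.const_mul _ ?_)
            simp only [softInvSq, hone]
            refine Tendsto.mul_const _ (Tendsto.inv₀ (Tendsto.const_add _
              (tendsto_one_div_add_atTop_nhds_zero_nat.pow 2)) (by positivity))
          rw [h1.liminf_eq, ENNReal.ofReal_mul (hρ0 y), inv_enorm_sq_eq hy0,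
            Real.rpow_neg (norm_nonneg _), Real.rpow_two]
          simp
      _ ≤ liminf (fun n : ℕ => ∫⁻ y in Metric.ball x₀ 1,
            ENNReal.ofReal (ρ y * softInvSq (1 / ((n : ℝ) + 1)) (y - x₀))) atTop := by
          refine lintegral_liminf_le fun n => ?_
          exact (hρm.mul ((contDiff_softInvSq (hε n)).continuous.measurable.comp
            (measurable_id.sub_const x₀))).ennreal_ofReal
      _ ≤ _ := liminf_le_of_frequently_le' (Frequently.of_forall fun n =>
          (setLIntegral_le_lintegral _ _).trans (key _ (hε n)))
  rw [← lintegral_add_compl _ (measurableSet_ball (x := x₀) (ε := 1))]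
  refine add_le_add hlim ?_
  refine le_trans ?_ ((setLIntegral_le_lintegral (Metric.ball x₀ 1)ᶜ _).trans hρM)
  refine setLIntegral_mono hρm.ennreal_ofReal fun y hy => ?_
  refine mul_le_of_le_one_right' ?_
  have : 1 ≤ ‖y - x₀‖ := by simpa [dist_eq_norm] using hy
  rw [ENNReal.inv_le_one]
  refine one_le_pow₀ ?_
  rw [← ofReal_norm]
  exact ENNReal.one_le_ofReal.2 this

end VPCharge

/-! ### Measurable families of characteristics -/

namespace VPCharge

variable {E : ℝ → Space → Space} {ξ η : ℝ → Space} {C T t : ℝ} {μ : Measure Phase} {L : ℝ≥0∞}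
  {Z Γ : ℝ → Phase → Phase}

theorem measurable_pathFrom (hE : Measurable (Function.uncurry E)) (hξ : Continuous ξ)
    (hZ : Measurable (Function.uncurry Z)) :
    Measurable (Function.uncurry fun s z => pathFrom E ξ t (fun τ => Z τ z) z s) := by
  have hD : Measurable fun p : (ℝ × Phase) × ℝ => drift E ξ p.2 (Z p.2 p.1.2) :=
    (measurable_drift hE hξ).comp (measurable_snd.prodMk (hZ.comp
      (measurable_snd.prodMk (measurable_snd.comp measurable_fst))))
  have key : ∀ S : Set ((ℝ × Phase) × ℝ), MeasurableSet S → Measurable fun p : ℝ × Phase =>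
      ∫ τ, S.indicator (fun q => drift E ξ q.2 (Z q.2 q.1.2)) (p, τ) := by
    intro S hS
    exact ((hD.indicator hS).stronglyMeasurable.integral_prod_right').measurable
  have h1 : MeasurableSet {q : (ℝ × Phase) × ℝ | t < q.2 ∧ q.2 ≤ q.1.1} :=
    (measurableSet_lt measurable_const measurable_snd).inter
      (measurableSet_le measurable_snd (measurable_fst.comp measurable_fst))
  have h2 : MeasurableSet {q : (ℝ × Phase) × ℝ | q.1.1 < q.2 ∧ q.2 ≤ t} :=
    (measurableSet_lt (measurable_fst.comp measurable_fst) measurable_snd).inter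
      (measurableSet_le measurable_snd measurable_const)
  have h3 := measurable_snd.add ((key _ h1).sub (key _ h2))
  convert h3 using 1
  funext ⟨s, z⟩
  simp only [Function.uncurry_apply_pair, pathFrom, intervalIntegral, Pi.add_apply, Pi.sub_apply]
  rw [← integral_indicator measurableSet_Ioc, ← integral_indicator measurableSet_Ioc]
  rfl

/-- A measurable family of characteristics of `(v, E + F)`, one from `μ`-almost every point. -/
structure IsPathFlow (E : ℝ → Space → Space) (ξ : ℝ → Space) (μ : Measure Phase) (t T : ℝ)
    (Γ : ℝ → Phase → Phase) : Prop where
  measurable : Measurable (Function.uncurry Γ)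
  trajectory : ∀ᵐ z ∂μ, IsTrajectory E ξ t T (fun s => Γ s z)
  initial : ∀ z, Γ t z = z

/-- Each curve is replaced by its continuous representative. Fubini's theorem turns equality for
a.e. point and a.e. time into equality of the push-forwards at a.e. time. -/
theorem IsRegularLagrangianFlow.exists_isPathFlow [IsFiniteMeasure μ]
    (h : IsRegularLagrangianFlow μ L (drift E ξ) t T Z) (hL : L ≠ ∞)
    (hξ : IsChargePath E ξ η C T) (ht : 0 ≤ t) (htT : t < T) :
    ∃ Γ, IsPathFlow E ξ μ t T Γ ∧ (∀ᵐ z ∂μ, ∀ᵐ s, s ∈ Ioo t T → Z s z = Γ s z) ∧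
      ∀ᵐ s, s ∈ Ioo t T → μ.map (Z s) = μ.map (Γ s) := by
  have hm := measurable_pathFrom (t := t) hξ.measurable hξ.continuous_position h.measurable
  have hae := h.ae_isTrajectory hL hξ ht htT
  refine ⟨fun s z => pathFrom E ξ t (fun τ => Z τ z) z s, ⟨hm, ?_, fun z => ?_⟩, ?_, ?_⟩
  · filter_upwards [hae] with z hz using hz.2.1
  · simp [pathFrom]
  · filter_upwards [hae] with z hz using hz.2.2
  · have h1 : ∀ᵐ z ∂μ, ∀ᵐ s, s ∈ Ioo t T → Z s z = pathFrom E ξ t (fun τ => Z τ z) z s := by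
      filter_upwards [hae] with z hz using hz.2.2
    have h2 : MeasurableSet {p : Phase × ℝ | p.2 ∈ Ioo t T →
        Z p.2 p.1 = pathFrom E ξ t (fun τ => Z τ p.1) p.1 p.2} := by
      have h3 : MeasurableSet {p : Phase × ℝ | Z p.2 p.1 =
          pathFrom E ξ t (fun τ => Z τ p.1) p.1 p.2} :=
        measurableSet_eq_fun (h.measurable.comp measurable_swap) (hm.comp measurable_swap)
      exact (measurable_snd measurableSet_Ioo).imp h3
    have h4 := (Measure.ae_ae_comm h2).1 h1
    filter_upwards [h4] with s hs hsI
    refine Measure.map_congr ?_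
    filter_upwards [hs] with z hz using hz hsI

end VPCharge

/-! ### Energy identities along characteristics -/

namespace VPCharge

variable {E : ℝ → Space → Space} {ξ η : ℝ → Space} {C T a b : ℝ} {γ γ' : ℝ → Phase}

/-- The energy of a particle in the field of a charge at the origin. -/
noncomputable def chargeEnergy (p : Phase) : ℝ := ‖p.2‖ ^ 2 / 2 + ‖p.1‖⁻¹

theorem contDiffOn_chargeEnergy : ContDiffOn ℝ 1 chargeEnergy {p | p.1 ≠ 0} :=
  ((contDiff_snd.norm_sq ℝ).div_const 2).contDiffOn.add
    (contDiffOn_norm_fst.inv fun _ hp => norm_ne_zero_iff.2 hp)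

theorem hasDerivAt_inv_norm_line {y w : Space} (hy : y ≠ 0) :
    HasDerivAt (fun τ : ℝ => ‖y + τ • w‖⁻¹) (-inner ℝ w (coulomb y)) 0 := by
  have h := (hasDerivAt_norm_line (w := w) hy).fun_inv (by simpa using hy)
  refine h.congr_deriv ?_
  have : ‖y‖ ≠ 0 := norm_ne_zero_iff.2 hy
  simp only [coulomb, inner_smul_right, zero_smul, add_zero, real_inner_comm w y]
  field_simp

theorem hasDerivAt_norm_sq_line (v e : Space) :
    HasDerivAt (fun τ : ℝ => ‖v + τ • e‖ ^ 2) (2 * inner ℝ v e) 0 := by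
  have h1 : HasDerivAt (fun τ : ℝ => v + τ • e) e 0 := by
    simpa using ((hasDerivAt_id (0 : ℝ)).smul_const e).const_add v
  simpa using h1.norm_sq

theorem fderiv_chargeEnergy {y v w e : Space} (hy : y ≠ 0) :
    fderiv ℝ chargeEnergy (y, v) (w, e) = inner ℝ v e - inner ℝ w (coulomb y) := by
  refine fderiv_eq_of_hasLineDerivAt contDiffOn_chargeEnergy hy ?_
  have h := ((hasDerivAt_norm_sq_line v e).div_const 2).fun_add (hasDerivAt_inv_norm_line (w := w) hy)
  refine h.congr_deriv ?_
  ring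

/-- In the rest frame the work of the Coulomb force cancels except for the part due to the velocity
of the charge. That part is later matched with the kinetic energy of the charge. -/
theorem IsTrajectory.energy_eq (hγ : IsTrajectory E ξ a b γ) (hξ : IsChargePath E ξ η C T)
    (ha : 0 ≤ a) (hab : a ≤ b) (hb : b ≤ T) :
    ∫ s in a..b, (inner ℝ (γ s).2 (E s (γ s).1) + inner ℝ (η s) (coulomb ((γ s).1 - ξ s))) =
      chargeEnergy ((γ b).1 - ξ b, (γ b).2) - chargeEnergy ((γ a).1 - ξ a, (γ a).2) := by
  have h := (hγ.integral_fderiv hξ ha hab hb 0 contDiffOn_chargeEnergy).2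
  simp only [zero_smul, sub_zero] at h
  rw [← h]
  refine intervalIntegral.integral_congr fun s hs => ?_
  rw [uIcc_of_le hab] at hs
  rw [fderiv_chargeEnergy (sub_ne_zero.2 (hγ.ne s hs)), inner_add_right, inner_sub_left]
  ring

theorem IsTrajectory.norm_snd_le (hγ : IsTrajectory E ξ a b γ) :
    ∃ K : ℝ, ∀ s ∈ Icc a b, ‖(γ s).2‖ ≤ K := by
  obtain ⟨K, hK⟩ := isCompact_Icc.exists_bound_of_continuousOn
    (continuous_snd.comp_continuousOn hγ.continuousOn)
  exact ⟨K, hK⟩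

/-- The relative position is Lipschitz, so the integrability hypothesis excludes a collision of the
two particles, and `1/|x - x'|` can be differentiated along the pair. -/
theorem IsTrajectory.pair_energy_eq (hγ : IsTrajectory E ξ a b γ) (hγ' : IsTrajectory E ξ a b γ')
    (hab : a < b) (hint : ∫⁻ s in Icc a b, (‖(γ s).1 - (γ' s).1‖ₑ ^ 2)⁻¹ ≠ ∞) {s : ℝ}
    (hs : s ∈ Icc a b) :
    ∫ τ in a..s, inner ℝ ((γ τ).2 - (γ' τ).2) (coulomb ((γ τ).1 - (γ' τ).1)) =
      ‖(γ a).1 - (γ' a).1‖⁻¹ - ‖(γ s).1 - (γ' s).1‖⁻¹ := by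
  obtain ⟨K, hK⟩ := hγ.norm_snd_le
  obtain ⟨K', hK'⟩ := hγ'.norm_snd_le
  have hii := hγ.intervalIntegrable_fst.sub hγ'.intervalIntegrable_fst
  have hp : ∀ s ∈ Icc a b, (γ s).1 - (γ' s).1 =
      (γ a).1 - (γ' a).1 + ∫ τ in a..s, ((γ τ).2 - (γ' τ).2) := by
    intro s hs
    have hsub : uIcc a s ⊆ uIcc a b := by
      rw [uIcc_of_le hs.1, uIcc_of_le hab.le]; exact Icc_subset_Icc_right hs.2
    rw [intervalIntegral.integral_sub (hγ.intervalIntegrable_fst.mono_set hsub)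
      (hγ'.intervalIntegrable_fst.mono_set hsub), hγ.fst_eq hs, hγ'.fst_eq hs]
    abel
  have hne := ne_zero_of_lintegral_inv_sq_ne_top (y := fun s => (γ s).1 - (γ' s).1)
    (K := K + K') hab ?_ hint
  · have hsub : uIcc a s ⊆ uIcc a b := by
      rw [uIcc_of_le hs.1, uIcc_of_le hab.le]; exact Icc_subset_Icc_right hs.2
    have hU : IsOpen {y : Space | y ≠ 0} := isOpen_ne
    have hΦ : ContDiffOn ℝ 1 (fun y : Space => ‖y‖⁻¹) {y : Space | y ≠ 0} :=
      ContDiffOn.inv (fun y hy => (contDiffAt_norm ℝ hy).contDiffWithinAt)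
        fun _ hy => norm_ne_zero_iff.2 hy
    have h := (integral_fderiv_comp_eq_sub hs.1 hU hΦ (p := fun s => (γ s).1 - (γ' s).1)
      (q := fun s => (γ s).2 - (γ' s).2) (K := K + K')
      (fun τ hτ => hne τ ⟨hτ.1, hτ.2.trans hs.2⟩) (hii.mono_set hsub)
      (fun τ hτ => hp τ ⟨hτ.1, hτ.2.trans hs.2⟩) ?_).2
    · rw [← neg_inj, neg_sub, ← h, ← intervalIntegral.integral_neg]
      refine intervalIntegral.integral_congr fun τ hτ => ?_
      rw [uIcc_of_le hs.1] at hτ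
      have hy := hne τ ⟨hτ.1, hτ.2.trans hs.2⟩
      have hd := (hΦ.contDiffAt (hU.mem_nhds hy)).differentiableAt one_ne_zero
      exact ((hd.hasFDerivAt.hasLineDerivAt _).unique (hasDerivAt_inv_norm_line hy)).symm
    · filter_upwards [ae_restrict_mem measurableSet_Ioc] with τ hτ
      have hτ' : τ ∈ Icc a b := ⟨hτ.1.le, hτ.2.trans hs.2⟩
      exact (norm_sub_le _ _).trans (add_le_add (hK τ hτ') (hK' τ hτ'))
  · intro τ hτ τ' hτ'
    have h1 : ∀ σ ∈ Icc a b, IntervalIntegrable (fun τ => (γ τ).2 - (γ' τ).2) volume a σ :=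
      fun σ hσ => hii.mono_set (by
        rw [uIcc_of_le hσ.1, uIcc_of_le hab.le]; exact Icc_subset_Icc_right hσ.2)
    rw [hp τ hτ, hp τ' hτ', add_sub_add_left_eq_sub,
      intervalIntegral.integral_interval_sub_left (h1 τ hτ) (h1 τ' hτ')]
    refine intervalIntegral.norm_integral_le_of_norm_le_const fun σ hσ => ?_
    have hσ' : σ ∈ Icc a b := by
      have := uIoc_subset_uIcc hσ
      exact (uIcc_subset_Icc hτ' hτ) this
    exact (norm_sub_le _ _).trans (add_le_add (hK σ hσ') (hK' σ hσ'))

theorem IsChargePath.norm_velocity_sq_eq (hξ : IsChargePath E ξ η C T) {s : ℝ}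
    (hs : s ∈ Icc 0 T) :
    ∫ τ in (0 : ℝ)..s, inner ℝ (η τ) (E τ (ξ τ)) = ‖η s‖ ^ 2 / 2 - ‖η 0‖ ^ 2 / 2 := by
  have hΦ : ContDiff ℝ 1 (fun v : Space => ‖v‖ ^ 2 / 2) := (contDiff_id.norm_sq ℝ).div_const 2
  have h := (integral_fderiv_comp_eq_sub hs.1 isOpen_univ hΦ.contDiffOn (p := η)
    (q := fun τ => E τ (ξ τ)) (K := C) (fun _ _ => mem_univ _)
    (hξ.intervalIntegrable hξ.continuous_position.measurable.aemeasurable)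
    (fun τ hτ => hξ.velocity τ ⟨hτ.1, hτ.2.trans hs.2⟩)
    (Eventually.of_forall fun τ => hξ.bound τ _)).2
  rw [← h]
  refine intervalIntegral.integral_congr fun τ _ => ?_
  have hd := hΦ.differentiable one_ne_zero (η τ)
  refine ((hd.hasFDerivAt.hasLineDerivAt (E τ (ξ τ))).unique ?_).symm
  have := (hasDerivAt_norm_sq_line (η τ) (E τ (ξ τ))).div_const 2
  refine this.congr_deriv ?_
  ring

end VPCharge

/-! ### Self-consistent families: integrability of all the powers -/

namespace VPCharge

variable {E : ℝ → Space → Space} {ξ η : ℝ → Space} {C T : ℝ} {μ : Measure Phase}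
  {Γ : ℝ → Phase → Phase} {B : ℝ≥0∞} {s : ℝ}

theorem measurable_relSpeed : Measurable relSpeed := by
  unfold relSpeed; fun_prop

theorem memLp_relSpeed [IsFiniteMeasure μ] (hkin : Integrable (fun z : Phase => ‖z.2‖ ^ 2) μ)
    {x₀ v₀ : Space} (hpot : Integrable (fun z : Phase => ‖z.1 - x₀‖⁻¹) μ) :
    MemLp (fun z : Phase => relSpeed (z.1 - x₀, z.2 - v₀)) 2 μ := by
  have hm : Measurable fun z : Phase => relSpeed (z.1 - x₀, z.2 - v₀) :=
    measurable_relSpeed.comp ((measurable_fst.sub_const _).prodMk (measurable_snd.sub_const _))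
  rw [memLp_two_iff_integrable_sq hm.aestronglyMeasurable]
  refine (((hkin.const_mul 2).add (integrable_const (2 * ‖v₀‖ ^ 2))).add (hpot.const_mul 2)).mono'
    (hm.pow_const 2).aestronglyMeasurable (Eventually.of_forall fun z => ?_)
  rw [Real.norm_of_nonneg (sq_nonneg _), relSpeed, Real.sq_sqrt (by positivity)]
  have h := norm_sub_le z.2 v₀
  have h' : ‖z.2 - v₀‖ ^ 2 ≤ (‖z.2‖ + ‖v₀‖) ^ 2 := pow_le_pow_left₀ (norm_nonneg _) h 2
  simp only [Pi.add_apply]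
  nlinarith [sq_nonneg (‖z.2‖ - ‖v₀‖)]

/-- The linear growth of `relSpeed` bounds the speed at all times by its initial value, which is
square integrable once the initial energies are finite. -/
theorem IsPathFlow.exists_speed_bound (hΓ : IsPathFlow E ξ μ 0 T Γ)
    (hξ : IsChargePath E ξ η C T) : ∃ K : ℝ, 0 ≤ K ∧ (∀ s ∈ Icc 0 T, ‖η s‖ ≤ K) ∧
      ∀ᵐ z ∂μ, ∀ s ∈ Icc 0 T, ‖(Γ s z).2‖ ≤ relSpeed (z.1 - ξ 0, z.2 - η 0) + K := by
  obtain ⟨K, hK⟩ := isCompact_Icc.exists_bound_of_continuousOn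
    (s := Icc 0 T) hξ.continuous_velocity.continuousOn
  refine ⟨2 * C * |T| + |K|, ?_, ?_, ?_⟩
  · have := hξ.bound_nonneg; positivity
  · intro s hs
    have := hξ.bound_nonneg
    have h : 0 ≤ 2 * C * |T| := by positivity
    linarith [hK s hs, le_abs_self K]
  · filter_upwards [hΓ.trajectory] with z hz s hs
    have h1 := (hz.mono le_rfl hs.1 hs.2).relSpeed_le hξ le_rfl hs.1 hs.2
    rw [hΓ.initial] at h1
    have h2 := norm_le_relSpeed ((Γ s z).1 - ξ s, (Γ s z).2 - η s)
    have h3 : ‖(Γ s z).2‖ ≤ ‖(Γ s z).2 - η s‖ + ‖η s‖ := norm_le_norm_sub_add _ _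
    have h4 : 2 * C * (s - 0) ≤ 2 * C * |T| := by
      have := hξ.bound_nonneg
      gcongr
      linarith [hs.2, le_abs_self T]
    linarith [hK s hs, le_abs_self K]

/-- Characteristics of `(v, E + F)` where `E` is the field of the transported charge itself, with
a bound on the potential of the transported charge with kernel `|x|⁻²`. -/
structure IsSelfConsistent (E : ℝ → Space → Space) (ξ η : ℝ → Space) (C T : ℝ)
    (μ : Measure Phase) (Γ : ℝ → Phase → Phase) (B : ℝ≥0∞) : Prop where
  pathFlow : IsPathFlow E ξ μ 0 T Γ
  chargePath : IsChargePath E ξ η C T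
  pos : 0 < T
  kinetic : Integrable (fun z : Phase => ‖z.2‖ ^ 2) μ
  potential : Integrable (fun z : Phase => ‖z.1 - ξ 0‖⁻¹) μ
  interaction : Integrable (fun p : Phase × Phase => ‖p.1.1 - p.2.1‖⁻¹) (μ.prod μ)
  bound_ne_top : B ≠ ∞
  bound : ∀ᵐ s, s ∈ Ioo 0 T → ∀ x, ∫⁻ z, (‖(Γ s z).1 - x‖ₑ ^ 2)⁻¹ ∂μ ≤ B
  field_eq : ∀ᵐ s, s ∈ Ioo 0 T → ∀ x, E s x = ∫ z, coulomb (x - (Γ s z).1) ∂μ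

theorem ae_restrict_Ioc_of_Ioo {P : ℝ → Prop} (h : ∀ᵐ s, s ∈ Ioo 0 T → P s) (hs : s ≤ T) :
    ∀ᵐ τ ∂(volume.restrict (Ioc 0 s)), τ ∈ Ioo 0 T ∧ P τ := by
  have hne : ∀ᵐ τ : ℝ, τ ≠ T := by simp [ae_iff, measure_singleton]
  filter_upwards [ae_restrict_of_ae h, ae_restrict_mem measurableSet_Ioc, ae_restrict_of_ae hne]
    with τ hτ hτs hτT
  have : τ ∈ Ioo 0 T := ⟨hτs.1, lt_of_le_of_ne (hτs.2.trans hs) hτT⟩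
  exact ⟨this, hτ this⟩

namespace IsSelfConsistent

theorem measurable_swap (h : IsSelfConsistent E ξ η C T μ Γ B) :
    Measurable fun p : Phase × ℝ => Γ p.2 p.1 :=
  h.pathFlow.measurable.comp (measurable_snd.prodMk measurable_fst)

theorem exists_majorant [IsFiniteMeasure μ] (h : IsSelfConsistent E ξ η C T μ Γ B) :
    ∃ m : Phase → ℝ, Measurable m ∧ (∀ z, 0 ≤ m z) ∧ MemLp m 2 μ ∧
      ∀ᵐ z ∂μ, ∀ s ∈ Icc 0 T, ‖(Γ s z).2‖ ≤ m z := by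
  obtain ⟨K, hK0, -, hK⟩ := h.pathFlow.exists_speed_bound h.chargePath
  refine ⟨fun z => relSpeed (z.1 - ξ 0, z.2 - η 0) + K, ?_, ?_, ?_, hK⟩
  · exact (measurable_relSpeed.comp ((measurable_fst.sub_const _).prodMk
      (measurable_snd.sub_const _))).add_const K
  · intro z
    have := relSpeed_nonneg (z.1 - ξ 0, z.2 - η 0)
    positivity
  · exact (memLp_relSpeed h.kinetic h.potential).add (memLp_const K)

theorem integrable_inner_field [IsFiniteMeasure μ] (h : IsSelfConsistent E ξ η C T μ Γ B) (hs : s ≤ T) :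
    Integrable (fun p : Phase × ℝ => inner ℝ (Γ p.2 p.1).2 (E p.2 (Γ p.2 p.1).1))
      (μ.prod (volume.restrict (Ioc 0 s))) := by
  obtain ⟨m, hm, hm0, hmL, hmb⟩ := h.exists_majorant
  have hG := h.measurable_swap
  have hmi : Integrable m μ := hmL.integrable one_le_two
  refine (hmi.mul_prod (integrable_const C)).mono' ?_ ?_
  · exact (hG.snd.inner (h.chargePath.measurable.comp
      (measurable_snd.prodMk hG.fst))).aestronglyMeasurable
  · filter_upwards [Measure.quasiMeasurePreserving_fst.ae hmb,
      Measure.quasiMeasurePreserving_snd.ae (ae_restrict_mem measurableSet_Ioc)] with p hp hp2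
    refine (norm_inner_le_norm _ _).trans (mul_le_mul (hp _ ⟨hp2.1.le, hp2.2.trans hs⟩)
      (h.chargePath.bound _ _) (norm_nonneg _) (hm0 _))

theorem integrable_inner_charge [IsFiniteMeasure μ] (h : IsSelfConsistent E ξ η C T μ Γ B) (hs : s ≤ T) :
    Integrable (fun p : Phase × ℝ => inner ℝ (η p.2) (coulomb ((Γ p.2 p.1).1 - ξ p.2)))
      (μ.prod (volume.restrict (Ioc 0 s))) := by
  obtain ⟨K, hK0, hK, -⟩ := h.pathFlow.exists_speed_bound h.chargePath
  have hG := h.measurable_swap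
  have hm : Measurable fun p : Phase × ℝ =>
      (inner ℝ (η p.2) (coulomb ((Γ p.2 p.1).1 - ξ p.2)) : ℝ) :=
    (h.chargePath.continuous_velocity.measurable.comp measurable_snd).inner
      (measurable_coulomb.comp (hG.fst.sub
        (h.chargePath.continuous_position.measurable.comp measurable_snd)))
  refine ⟨hm.aestronglyMeasurable, ?_⟩
  rw [hasFiniteIntegral_iff_enorm, lintegral_prod_symm' _ hm.enorm]
  calc ∫⁻ τ in Ioc 0 s, ∫⁻ z, ‖(inner ℝ (η τ) (coulomb ((Γ τ z).1 - ξ τ)) : ℝ)‖ₑ ∂μ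
      ≤ ∫⁻ _ in Ioc 0 s, ENNReal.ofReal K * B := by
        refine lintegral_mono_ae ?_
        filter_upwards [ae_restrict_Ioc_of_Ioo h.bound hs] with τ hτ
        calc ∫⁻ z, ‖(inner ℝ (η τ) (coulomb ((Γ τ z).1 - ξ τ)) : ℝ)‖ₑ ∂μ
            ≤ ∫⁻ z, ENNReal.ofReal K * (‖(Γ τ z).1 - ξ τ‖ₑ ^ 2)⁻¹ ∂μ := by
              refine lintegral_mono fun z => ?_
              refine le_trans ?_ (mul_le_mul' le_rfl (enorm_coulomb_le _))
              rw [← ofReal_norm, ← ofReal_norm, ← ENNReal.ofReal_mul hK0]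
              refine ENNReal.ofReal_le_ofReal ((norm_inner_le_norm _ _).trans ?_)
              gcongr
              exact hK τ ⟨hτ.1.1.le, hτ.1.2.le⟩
          _ ≤ ENNReal.ofReal K * B := by
              rw [lintegral_const_mul' _ _ ENNReal.ofReal_ne_top]
              gcongr
              exact hτ.2 _
    _ < ∞ := by
        rw [setLIntegral_const]
        exact ENNReal.mul_lt_top (ENNReal.mul_lt_top ENNReal.ofReal_lt_top h.bound_ne_top.lt_top)
          measure_Ioc_lt_top

/-- The power that the second particle exerts on the first. -/
noncomputable def pairPower (Γ : ℝ → Phase → Phase) (p : (Phase × Phase) × ℝ) : ℝ :=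
  inner ℝ (Γ p.2 p.1.1).2 (coulomb ((Γ p.2 p.1.1).1 - (Γ p.2 p.1.2).1))

theorem measurable_pairPower (h : IsSelfConsistent E ξ η C T μ Γ B) :
    Measurable (pairPower Γ) := by
  have h1 : Measurable fun p : (Phase × Phase) × ℝ => Γ p.2 p.1.1 :=
    h.pathFlow.measurable.comp (measurable_snd.prodMk measurable_fst.fst)
  have h2 : Measurable fun p : (Phase × Phase) × ℝ => Γ p.2 p.1.2 :=
    h.pathFlow.measurable.comp (measurable_snd.prodMk measurable_fst.snd)
  exact h1.snd.inner (measurable_coulomb.comp (h1.fst.sub h2.fst))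

/-- For a fixed first particle, the integral over the second is at most its speed times `B`, and the
majorant of the speed is integrable. -/
theorem integrable_pairPower [IsFiniteMeasure μ] (h : IsSelfConsistent E ξ η C T μ Γ B) (hs : s ≤ T) :
    Integrable (pairPower Γ) ((μ.prod μ).prod (volume.restrict (Ioc 0 s))) := by
  obtain ⟨m, hm, hm0, hmL, hmb⟩ := h.exists_majorant
  have hmi : Integrable m μ := hmL.integrable one_le_two
  have hM := h.measurable_pairPower
  refine ⟨hM.aestronglyMeasurable, ?_⟩
  rw [hasFiniteIntegral_iff_enorm, lintegral_prod_symm' _ hM.enorm]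
  calc ∫⁻ τ in Ioc 0 s, ∫⁻ q, ‖pairPower Γ (q, τ)‖ₑ ∂(μ.prod μ)
      ≤ ∫⁻ _ in Ioc 0 s, ∫⁻ z, ENNReal.ofReal (m z) * B ∂μ := by
        refine lintegral_mono_ae ?_
        filter_upwards [ae_restrict_Ioc_of_Ioo h.bound hs] with τ hτ
        rw [lintegral_prod _ (show Measurable fun q => ‖pairPower Γ (q, τ)‖ₑ from
          (hM.comp measurable_prodMk_right).enorm).aemeasurable]
        refine lintegral_mono_ae ?_
        filter_upwards [hmb] with z hz
        calc ∫⁻ z', ‖pairPower Γ ((z, z'), τ)‖ₑ ∂μ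
            ≤ ∫⁻ z', ENNReal.ofReal (m z) * (‖(Γ τ z').1 - (Γ τ z).1‖ₑ ^ 2)⁻¹ ∂μ := by
              refine lintegral_mono fun z' => ?_
              rw [← enorm_neg ((Γ τ z').1 - (Γ τ z).1), neg_sub]
              refine le_trans ?_ (mul_le_mul' le_rfl (enorm_coulomb_le _))
              rw [← ofReal_norm, ← ofReal_norm, ← ENNReal.ofReal_mul (hm0 _)]
              refine ENNReal.ofReal_le_ofReal ((norm_inner_le_norm _ _).trans ?_)
              gcongr
              exact hz τ ⟨hτ.1.1.le, hτ.1.2.le⟩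
          _ ≤ ENNReal.ofReal (m z) * B := by
              rw [lintegral_const_mul' _ _ ENNReal.ofReal_ne_top]
              gcongr
              exact hτ.2 _
    _ < ∞ := by
        rw [setLIntegral_const, lintegral_mul_const' _ _ h.bound_ne_top]
        refine ENNReal.mul_lt_top (ENNReal.mul_lt_top ?_ h.bound_ne_top.lt_top)
          measure_Ioc_lt_top
        rw [← hasFiniteIntegral_iff_ofReal (Eventually.of_forall hm0)]
        exact hmi.2

/-- This is the hypothesis of `IsTrajectory.pair_energy_eq`: almost no pair collides. It follows
from the bound `B` with one particle fixed. -/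
theorem ae_pair_ne_top [IsFiniteMeasure μ] (h : IsSelfConsistent E ξ η C T μ Γ B) :
    ∀ᵐ q ∂(μ.prod μ), ∫⁻ s in Icc 0 T, (‖(Γ s q.1).1 - (Γ s q.2).1‖ₑ ^ 2)⁻¹ ≠ ∞ := by
  have h1 : Measurable fun p : (Phase × Phase) × ℝ => Γ p.2 p.1.1 :=
    h.pathFlow.measurable.comp (measurable_snd.prodMk measurable_fst.fst)
  have h2 : Measurable fun p : (Phase × Phase) × ℝ => Γ p.2 p.1.2 :=
    h.pathFlow.measurable.comp (measurable_snd.prodMk measurable_fst.snd)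
  have hm : Measurable fun p : (Phase × Phase) × ℝ =>
      (‖(Γ p.2 p.1.1).1 - (Γ p.2 p.1.2).1‖ₑ ^ 2)⁻¹ :=
    measurable_inv_enorm_sq.comp (h1.fst.sub h2.fst)
  have hslice : ∀ τ, Measurable fun q : Phase × Phase =>
      (‖(Γ τ q.1).1 - (Γ τ q.2).1‖ₑ ^ 2)⁻¹ := by
    intro τ
    have hτ : Measurable (Γ τ) := h.pathFlow.measurable.comp measurable_prodMk_left
    exact measurable_inv_enorm_sq.comp
      ((hτ.comp measurable_fst).fst.sub (hτ.comp measurable_snd).fst)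
  have hpair : ∀ τ, (∀ x, ∫⁻ z, (‖(Γ τ z).1 - x‖ₑ ^ 2)⁻¹ ∂μ ≤ B) →
      ∫⁻ q, (‖(Γ τ q.1).1 - (Γ τ q.2).1‖ₑ ^ 2)⁻¹ ∂(μ.prod μ) ≤ B * μ univ := by
    intro τ hτ
    have e := lintegral_prod_symm' (μ := μ) (ν := μ) (fun q : Phase × Phase =>
      (‖(Γ τ q.1).1 - (Γ τ q.2).1‖ₑ ^ 2)⁻¹) (hslice τ)
    rw [e, ← lintegral_const]
    exact lintegral_mono fun z' => hτ (Γ τ z').1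
  have hfin : ∫⁻ q, (∫⁻ s in Ioc 0 T, (‖(Γ s q.1).1 - (Γ s q.2).1‖ₑ ^ 2)⁻¹) ∂(μ.prod μ) ≠ ∞ := by
    rw [lintegral_lintegral_swap hm.aemeasurable]
    refine ne_of_lt ?_
    calc ∫⁻ s in Ioc 0 T, ∫⁻ q, (‖(Γ s q.1).1 - (Γ s q.2).1‖ₑ ^ 2)⁻¹ ∂(μ.prod μ)
        ≤ ∫⁻ _ in Ioc 0 T, B * μ univ := by
          refine lintegral_mono_ae ?_
          filter_upwards [ae_restrict_Ioc_of_Ioo h.bound le_rfl] with τ hτ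
          exact hpair τ hτ.2
      _ < ∞ := by
          rw [setLIntegral_const]
          exact ENNReal.mul_lt_top (ENNReal.mul_lt_top h.bound_ne_top.lt_top
            (measure_lt_top _ _)) measure_Ioc_lt_top
  filter_upwards [ae_lt_top hm.lintegral_prod_right' hfin] with q hq
  rw [setLIntegral_congr Ioc_ae_eq_Icc.symm]
  exact hq.ne

end IsSelfConsistent

end VPCharge

/-! ### The energy inequality -/

namespace VPCharge

variable {E : ℝ → Space → Space} {ξ η : ℝ → Space} {C T : ℝ} {μ : Measure Phase}
  {Γ : ℝ → Phase → Phase} {B : ℝ≥0∞} {s : ℝ}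

namespace IsSelfConsistent

theorem integrable_coulomb (h : IsSelfConsistent E ξ η C T μ Γ B) {τ : ℝ}
    (hB : ∀ x, ∫⁻ z, (‖(Γ τ z).1 - x‖ₑ ^ 2)⁻¹ ∂μ ≤ B) (x : Space) :
    Integrable (fun z => coulomb ((Γ τ z).1 - x)) μ := by
  have hG : Measurable fun z => Γ τ z := h.pathFlow.measurable.comp measurable_prodMk_left
  refine ⟨(measurable_coulomb.comp (hG.fst.sub_const x)).aestronglyMeasurable, ?_⟩
  exact (lintegral_mono fun z => enorm_coulomb_le _).trans_lt ((hB x).trans_lt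
    h.bound_ne_top.lt_top)

/-- Action and reaction: the forces of the charge on all particles add up to `-E(ξ)`, by oddness of
the kernel. So their power is opposite to that of the field on the charge. -/
theorem integral_inner_charge [IsFiniteMeasure μ] (h : IsSelfConsistent E ξ η C T μ Γ B)
    (hs : s ∈ Icc 0 T) :
    ∫ z, (∫ τ in (0 : ℝ)..s, inner ℝ (η τ) (coulomb ((Γ τ z).1 - ξ τ))) ∂μ =
      ‖η 0‖ ^ 2 / 2 - ‖η s‖ ^ 2 / 2 := by
  simp only [intervalIntegral.integral_of_le hs.1]
  rw [integral_integral_swap (h.integrable_inner_charge hs.2), ← neg_sub,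
    ← h.chargePath.norm_velocity_sq_eq hs, intervalIntegral.integral_of_le hs.1, ← integral_neg]
  refine integral_congr_ae ?_
  filter_upwards [ae_restrict_Ioc_of_Ioo h.bound hs.2, ae_restrict_Ioc_of_Ioo h.field_eq hs.2]
    with τ hB hE
  rw [integral_inner (h.integrable_coulomb hB.2 (ξ τ)) (η τ), hE.2 (ξ τ), ← inner_neg_right,
    ← integral_neg]
  congr 2 with z
  rw [← coulomb_neg, neg_sub]

theorem integral_inner_field [IsFiniteMeasure μ] (h : IsSelfConsistent E ξ η C T μ Γ B)
    (hs : s ∈ Icc 0 T) :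
    ∫ z, (∫ τ in (0 : ℝ)..s, inner ℝ (Γ τ z).2 (E τ (Γ τ z).1)) ∂μ =
      ∫ q, (∫ τ in (0 : ℝ)..s, pairPower Γ (q, τ)) ∂(μ.prod μ) := by
  have hI := h.integrable_pairPower hs.2
  simp only [intervalIntegral.integral_of_le hs.1]
  rw [integral_integral_swap (h.integrable_inner_field hs.2),
    integral_integral_swap (f := fun q τ => pairPower Γ (q, τ)) hI]
  refine integral_congr_ae ?_
  filter_upwards [ae_restrict_Ioc_of_Ioo h.bound hs.2, ae_restrict_Ioc_of_Ioo h.field_eq hs.2,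
    hI.prod_left_ae] with τ hB hE hτ
  rw [integral_prod _ hτ]
  refine integral_congr_ae (Eventually.of_forall fun z => ?_)
  simp only [pairPower]
  have h1 : Integrable (fun z' => coulomb ((Γ τ z).1 - (Γ τ z').1)) μ := by
    refine (h.integrable_coulomb hB.2 (Γ τ z).1).neg.congr (Eventually.of_forall fun z' => ?_)
    simp only [Pi.neg_apply]
    rw [← coulomb_neg, neg_sub]
  rw [hE.2, integral_inner h1]

/-- Exchanging the two particles and using that the kernel is odd produces the relative velocity
against the relative force, which is the derivative of `-1/|x - x'|`. The interaction energy at time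
`s` is nonnegative and is dropped. -/
theorem two_mul_integral_inner_field_le [IsFiniteMeasure μ]
    (h : IsSelfConsistent E ξ η C T μ Γ B) (hs : s ∈ Icc 0 T) :
    2 * ∫ z, (∫ τ in (0 : ℝ)..s, inner ℝ (Γ τ z).2 (E τ (Γ τ z).1)) ∂μ ≤
      ∫ p : Phase × Phase, ‖p.1.1 - p.2.1‖⁻¹ ∂(μ.prod μ) := by
  have hI := h.integrable_pairPower hs.2
  have hJ : Integrable (fun q => ∫ τ in (0 : ℝ)..s, pairPower Γ (q, τ)) (μ.prod μ) := by
    simp only [intervalIntegral.integral_of_le hs.1]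
    exact hI.integral_prod_left
  have hswap : ∫ q, (∫ τ in (0 : ℝ)..s, pairPower Γ (q, τ)) ∂(μ.prod μ) =
      ∫ q, (∫ τ in (0 : ℝ)..s, pairPower Γ (q.swap, τ)) ∂(μ.prod μ) :=
    (integral_prod_swap fun q => ∫ τ in (0 : ℝ)..s, pairPower Γ (q, τ)).symm
  rw [h.integral_inner_field hs, two_mul]
  nth_rewrite 2 [hswap]
  have hJ' : Integrable (fun q : Phase × Phase => ∫ τ in (0 : ℝ)..s, pairPower Γ (q.swap, τ))
    (μ.prod μ) := hJ.swap
  rw [← integral_add hJ hJ']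
  refine integral_mono_ae (hJ.add hJ') h.interaction ?_
  have hI' : ∀ᵐ q ∂(μ.prod μ), Integrable (fun τ => pairPower Γ (q, τ))
    (volume.restrict (Ioc 0 s)) := hI.prod_right_ae
  filter_upwards [h.ae_pair_ne_top, hI',
    Measure.measurePreserving_swap.quasiMeasurePreserving.ae hI',
    Measure.quasiMeasurePreserving_fst.ae h.pathFlow.trajectory,
    Measure.quasiMeasurePreserving_snd.ae h.pathFlow.trajectory] with q hq hi hi' ht ht'
  have e := ht.pair_energy_eq ht' h.pos hq hs
  rw [h.pathFlow.initial, h.pathFlow.initial] at e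
  rw [← intervalIntegral.integral_add
    ((intervalIntegrable_iff_integrableOn_Ioc_of_le hs.1).2 hi)
    ((intervalIntegrable_iff_integrableOn_Ioc_of_le hs.1).2 hi')]
  have e2 : ∀ τ, pairPower Γ (q, τ) + pairPower Γ (q.swap, τ) =
      inner ℝ ((Γ τ q.1).2 - (Γ τ q.2).2) (coulomb ((Γ τ q.1).1 - (Γ τ q.2).1)) := by
    intro τ
    simp only [pairPower, Prod.fst_swap, Prod.snd_swap]
    rw [← neg_sub (Γ τ q.1).1 (Γ τ q.2).1, coulomb_neg, inner_neg_right, inner_sub_left]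
    ring
  simp only [e2, e]
  have := inv_nonneg.2 (norm_nonneg ((Γ s q.1).1 - (Γ s q.2).1))
  linarith

theorem integrable_norm_sq [IsFiniteMeasure μ] (h : IsSelfConsistent E ξ η C T μ Γ B)
    (hs : s ∈ Icc 0 T) : Integrable (fun z => ‖(Γ s z).2‖ ^ 2) μ := by
  obtain ⟨m, hm, hm0, hmL, hmb⟩ := h.exists_majorant
  have hG : Measurable fun z => Γ s z := h.pathFlow.measurable.comp measurable_prodMk_left
  refine hmL.integrable_sq.mono' (hG.snd.norm.pow_const 2).aestronglyMeasurable ?_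
  filter_upwards [hmb] with z hz
  rw [Real.norm_of_nonneg (sq_nonneg _)]
  exact pow_le_pow_left₀ (norm_nonneg _) (hz s hs) 2

/-- Conservation of energy, as an inequality for the kinetic part. -/
theorem energy_le [IsFiniteMeasure μ] (h : IsSelfConsistent E ξ η C T μ Γ B)
    (hs : s ∈ Icc 0 T) :
    ∫ z, ‖(Γ s z).2‖ ^ 2 / 2 ∂μ + ‖η s‖ ^ 2 / 2 ≤
      ∫ z : Phase, ‖z.2‖ ^ 2 / 2 ∂μ + ‖η 0‖ ^ 2 / 2 +
        (1 / 2) * ∫ p : Phase × Phase, ‖p.1.1 - p.2.1‖⁻¹ ∂(μ.prod μ) +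
          ∫ z : Phase, ‖z.1 - ξ 0‖⁻¹ ∂μ := by
  have h1 := h.integrable_inner_field hs.2
  have h2 := h.integrable_inner_charge hs.2
  have h1' : Integrable (fun z => ∫ τ in (0 : ℝ)..s, inner ℝ (Γ τ z).2 (E τ (Γ τ z).1)) μ := by
    simp only [intervalIntegral.integral_of_le hs.1]
    exact h1.integral_prod_left
  have h2' : Integrable (fun z => ∫ τ in (0 : ℝ)..s, inner ℝ (η τ) (coulomb ((Γ τ z).1 - ξ τ)))
      μ := by
    simp only [intervalIntegral.integral_of_le hs.1]
    exact h2.integral_prod_left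
  have hk := h.kinetic.div_const 2
  have h3 : ∫ z, ‖(Γ s z).2‖ ^ 2 / 2 ∂μ ≤ ∫ z, (‖z.2‖ ^ 2 / 2 + ‖z.1 - ξ 0‖⁻¹ +
      ((∫ τ in (0 : ℝ)..s, inner ℝ (Γ τ z).2 (E τ (Γ τ z).1)) +
        ∫ τ in (0 : ℝ)..s, inner ℝ (η τ) (coulomb ((Γ τ z).1 - ξ τ)))) ∂μ := by
    refine integral_mono_ae ((h.integrable_norm_sq hs).div_const 2)
      ((hk.add h.potential).add (h1'.add h2')) ?_
    have i1 : ∀ᵐ z ∂μ, Integrable (fun τ => (inner ℝ (Γ τ z).2 (E τ (Γ τ z).1) : ℝ))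
      (volume.restrict (Ioc 0 s)) := h1.prod_right_ae
    have i2 : ∀ᵐ z ∂μ, Integrable (fun τ => (inner ℝ (η τ) (coulomb ((Γ τ z).1 - ξ τ)) : ℝ))
      (volume.restrict (Ioc 0 s)) := h2.prod_right_ae
    filter_upwards [h.pathFlow.trajectory, i1, i2] with z hz i1 i2
    have e := (hz.mono le_rfl hs.1 hs.2).energy_eq h.chargePath le_rfl hs.1 hs.2
    rw [intervalIntegral.integral_add ((intervalIntegrable_iff_integrableOn_Ioc_of_le hs.1).2 i1)
      ((intervalIntegrable_iff_integrableOn_Ioc_of_le hs.1).2 i2), h.pathFlow.initial] at e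
    rw [e]
    simp only [chargeEnergy]
    -- The potential of the charge at time `s` is discarded too, so conservation becomes an
    -- inequality.
    have := inv_nonneg.2 (norm_nonneg ((Γ s z).1 - ξ s))
    linarith
  rw [integral_add (hk.fun_add h.potential) (h1'.fun_add h2'), integral_add hk h.potential,
    integral_add h1' h2', h.integral_inner_charge hs] at h3
  linarith [h.two_mul_integral_inner_field_le hs]

end IsSelfConsistent

end VPCharge

namespace VPCharge

/-! ### The field averaged along a density, with weight `1 / (1 + |v|)` -/

/-- Scaling: `R³` from the volume and `R⁻¹` from the integrand. -/
theorem lintegral_ball_inv_norm {R : ℝ} (hR : 0 < R) :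
    ∫⁻ v in Metric.ball (0 : Space) R, ENNReal.ofReal (‖v‖ ^ (-1 : ℝ)) =
      ENNReal.ofReal (R ^ 2) *
        ∫⁻ v in Metric.ball (0 : Space) 1, ENNReal.ofReal (‖v‖ ^ (-1 : ℝ)) := by
  have h1 := Measure.map_addHaar_smul (volume : Measure Space) hR.ne'
  have h2 : (volume : Measure Space) = ENNReal.ofReal (R ^ 3) •
      (volume : Measure Space).map (R • ·) := by
    rw [h1, finrank_space, smul_smul, ← ENNReal.ofReal_mul (by positivity),
      abs_of_pos (by positivity), mul_inv_cancel₀ (by positivity)]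
    simp
  have hm : Measurable ((Metric.ball (0 : Space) R).indicator
      fun v => ENNReal.ofReal (‖v‖ ^ (-1 : ℝ))) :=
    (by fun_prop : Measurable fun v : Space => ENNReal.ofReal (‖v‖ ^ (-1 : ℝ))).indicator
      measurableSet_ball
  rw [← lintegral_indicator measurableSet_ball, ← lintegral_indicator measurableSet_ball]
  conv_lhs => rw [h2]
  rw [lintegral_smul_measure, lintegral_map hm (measurable_const_smul R), smul_eq_mul,
    show R ^ 3 = R ^ 2 * R by ring, ENNReal.ofReal_mul (by positivity), mul_assoc,
    ← lintegral_const_mul' _ _ ENNReal.ofReal_ne_top]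
  congr 1
  refine lintegral_congr fun v => ?_
  by_cases hv : v ∈ Metric.ball (0 : Space) 1
  · have hv' : R • v ∈ Metric.ball (0 : Space) R := by
      rw [mem_ball_zero_iff] at hv ⊢
      rw [norm_smul, Real.norm_of_nonneg hR.le]; nlinarith
    rw [indicator_of_mem hv, indicator_of_mem hv', ← ENNReal.ofReal_mul hR.le, norm_smul,
      Real.norm_of_nonneg hR.le, Real.rpow_neg_one, Real.rpow_neg_one, mul_inv,
      mul_inv_cancel_left₀ hR.ne']
  · have hv' : R • v ∉ Metric.ball (0 : Space) R := by
      rw [mem_ball_zero_iff] at hv ⊢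
      rw [norm_smul, Real.norm_of_nonneg hR.le]; push Not at hv ⊢; nlinarith
    rw [indicator_of_notMem hv, indicator_of_notMem hv', mul_zero]

/-- The kernel `|x|⁻² / (1 + |v|)`. -/
noncomputable def speedKernel (x v : Space) : ℝ≥0∞ :=
  (‖x‖ₑ ^ 2)⁻¹ * ENNReal.ofReal (1 + ‖v‖)⁻¹

theorem measurable_speedKernel : Measurable (Function.uncurry speedKernel) := by
  unfold speedKernel Function.uncurry; fun_prop

/-- Where the velocity `v` is small compared with `u` and the distance. -/
def lowSpeed (U : ℝ) : Set Phase :=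
  {z | ‖z.1‖ < 1 ∧ (1 + ‖z.2‖) ^ 2 * (‖z.1‖ ^ (1 / 4 : ℝ)) ^ 3 ≤ U ^ 2}

/-- Where the velocity `u` is small compared with `v` and the distance. -/
def highSpeed (V : ℝ) : Set Phase :=
  {z | ‖z.1‖ < 1 ∧ (1 + ‖z.2‖) ^ 3 * (‖z.1‖ ^ (1 / 4 : ℝ)) ^ 3 ≤ V}

/-- Eliminating `V` from the hypotheses gives `1 < U⁴ d^(9/4)`, which is enough because `d < 1`. A
threshold `d^a` in place of `d^(3/4)` works here when `a ≥ 8/11`, while the two remaining regions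
need `|x|^(-2 - a)` integrable near the origin, that is `a < 1`. -/
theorem inv_sq_mul_inv_le {d U V : ℝ} (hd : 0 < d) (hd1 : d < 1) (hU : 1 ≤ U) (hV : 1 ≤ V)
    (h1 : U ^ 2 < V ^ 2 * (d ^ (1 / 4 : ℝ)) ^ 3) (h2 : V < U ^ 3 * (d ^ (1 / 4 : ℝ)) ^ 3) :
    (d ^ 2)⁻¹ * V⁻¹ ≤ U ^ 2 := by
  obtain ⟨p, hp⟩ : ∃ p, p = d ^ (1 / 4 : ℝ) := ⟨_, rfl⟩
  have hp0 : 0 < p := hp ▸ Real.rpow_pos_of_pos hd _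
  have hp1 : p < 1 := hp ▸ Real.rpow_lt_one hd.le hd1 (by norm_num)
  have hp4 : d = p ^ 4 := by
    rw [hp, ← Real.rpow_natCast, ← Real.rpow_mul hd.le]; norm_num
  rw [← hp] at h1 h2
  have e1 : 1 < U ^ 4 * p ^ 9 := by
    have : U ^ 2 < (U ^ 3 * p ^ 3) ^ 2 * p ^ 3 := h1.trans (by gcongr)
    have h3 : U ^ 2 * 1 < U ^ 2 * (U ^ 4 * p ^ 9) := by linarith [this, mul_one (U ^ 2)]
    exact lt_of_mul_lt_mul_left h3 (by positivity)
  -- This is the tight step: the cube of `e1` has `p²⁷` where `p²⁶` is needed, and the spare factor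
  -- `p` is below one.
  have e2 : 1 ≤ U ^ 6 * p ^ 13 := by
    have h3 : 1 ≤ (U ^ 6 * p ^ 13) ^ 2 := by
      calc (1 : ℝ) ≤ (U ^ 4 * p ^ 9) ^ 3 := one_le_pow₀ e1.le
        _ = U ^ 12 * p ^ 26 * p := by ring
        _ ≤ U ^ 12 * p ^ 26 * 1 := by gcongr
        _ = _ := by ring
    exact (one_le_sq_iff₀ (by positivity)).1 h3
  have e3 : 1 ≤ V * U ^ 2 * p ^ 8 := by
    have h3 : 1 ≤ (V * U ^ 2 * p ^ 8) ^ 2 := by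
      calc (1 : ℝ) ≤ U ^ 6 * p ^ 13 := e2
        _ = U ^ 2 * (U ^ 4 * p ^ 13) := by ring
        _ ≤ (V ^ 2 * p ^ 3) * (U ^ 4 * p ^ 13) := by gcongr
        _ = _ := by ring
    exact (one_le_sq_iff₀ (by positivity)).1 h3
  rw [hp4, ← mul_inv, inv_le_iff_one_le_mul₀ (by positivity)]
  linarith [e3, show V * U ^ 2 * p ^ 8 = U ^ 2 * ((p ^ 4) ^ 2 * V) by ring]

theorem speedKernel_le (x v u : Space) : speedKernel x v ≤ 1 + ENNReal.ofReal ((1 + ‖u‖) ^ 2) +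
    (lowSpeed (1 + ‖u‖)).indicator (fun z => speedKernel z.1 z.2) (x, v) +
    (highSpeed (1 + ‖v‖)).indicator (fun _ => speedKernel x v) (x, u) := by
  by_cases hx : ‖x‖ < 1
  · by_cases h1 : (x, v) ∈ lowSpeed (1 + ‖u‖)
    · rw [indicator_of_mem h1]
      exact le_add_right le_add_self
    by_cases h2 : (x, u) ∈ highSpeed (1 + ‖v‖)
    · rw [indicator_of_mem h2]
      exact le_add_self
    have h1' : (1 + ‖u‖) ^ 2 < (1 + ‖v‖) ^ 2 * (‖x‖ ^ (1 / 4 : ℝ)) ^ 3 := by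
      by_contra h; exact h1 ⟨hx, not_lt.1 h⟩
    have h2' : 1 + ‖v‖ < (1 + ‖u‖) ^ 3 * (‖x‖ ^ (1 / 4 : ℝ)) ^ 3 := by
      by_contra h; exact h2 ⟨hx, not_lt.1 h⟩
    have hx0 : 0 < ‖x‖ := by
      rcases (norm_nonneg x).eq_or_lt with h | h
      · rw [← h, Real.zero_rpow (by norm_num)] at h2'
        have := norm_nonneg v
        norm_num at h2'; linarith
      · exact h
    have h3 := inv_sq_mul_inv_le hx0 hx (by linarith [norm_nonneg u]) (by linarith [norm_nonneg v])
      h1' h2'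
    refine le_add_right (le_add_right (le_add_left ?_))
    rw [speedKernel, ← ofReal_norm, ← ENNReal.ofReal_pow (norm_nonneg _),
      ← ENNReal.ofReal_inv_of_pos (by positivity), ← ENNReal.ofReal_mul (by positivity)]
    exact ENNReal.ofReal_le_ofReal h3
  · refine le_add_right (le_add_right (le_add_right ?_))
    rw [speedKernel]
    refine mul_le_one' ?_ ?_
    · rw [ENNReal.inv_le_one]
      refine one_le_pow₀ ?_
      rw [← ofReal_norm]
      exact ENNReal.one_le_ofReal.2 (not_lt.1 hx)
    · rw [ENNReal.ofReal_le_one]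
      exact inv_le_one_of_one_le₀ (by linarith [norm_nonneg v])

theorem measurableSet_lowSpeed (U : ℝ) : MeasurableSet (lowSpeed U) := by
  have h : Measurable fun z : Phase => (1 + ‖z.2‖) ^ 2 * (‖z.1‖ ^ (1 / 4 : ℝ)) ^ 3 := by fun_prop
  exact (measurableSet_lt measurable_fst.norm measurable_const).inter
    (measurableSet_le h measurable_const)

theorem measurableSet_highSpeed (V : ℝ) : MeasurableSet (highSpeed V) := by
  have h : Measurable fun z : Phase => (1 + ‖z.2‖) ^ 3 * (‖z.1‖ ^ (1 / 4 : ℝ)) ^ 3 := by fun_prop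
  exact (measurableSet_lt measurable_fst.norm measurable_const).inter
    (measurableSet_le h measurable_const)

theorem inv_sq_mul_inv_pow {d : ℝ} (hd : 0 < d) :
    (d ^ 2)⁻¹ * ((d ^ (1 / 4 : ℝ)) ^ 3)⁻¹ = d ^ (-(11 / 4 : ℝ)) := by
  rw [← mul_inv, Real.rpow_neg hd.le, ← Real.rpow_natCast, ← Real.rpow_natCast,
    ← Real.rpow_mul hd.le, ← Real.rpow_add hd]
  norm_num

/-- For fixed `x` the velocity lies in a ball with `R² = U² |x|^(-3/4)`, on which `1/|v|` integrates
to a multiple of `R²`. The kernel `|x|^(-11/4)` that is left is integrable on the unit ball. -/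
theorem exists_lintegral_lowSpeed_bound : ∃ c : ℝ≥0∞, c ≠ ∞ ∧ ∀ U : ℝ, 0 < U →
    ∫⁻ z, (lowSpeed U).indicator (fun z => speedKernel z.1 z.2) z ≤ c * ENNReal.ofReal (U ^ 2) := by
  set c₀ := ∫⁻ v in Metric.ball (0 : Space) 1, ENNReal.ofReal (‖v‖ ^ (-1 : ℝ)) with hc₀
  set c₁ := ∫⁻ x in Metric.ball (0 : Space) 1, ENNReal.ofReal (‖x‖ ^ (-(11 / 4 : ℝ))) with hc₁
  have h0 : c₀ ≠ ∞ := (lintegral_ball_norm_rpow_lt_top (by norm_num) 1).ne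
  have h1 : c₁ ≠ ∞ := (lintegral_ball_norm_rpow_lt_top (by norm_num) 1).ne
  refine ⟨c₁ * c₀, ENNReal.mul_ne_top h1 h0, fun U hU => ?_⟩
  have hm : Measurable ((lowSpeed U).indicator fun z : Phase => speedKernel z.1 z.2) :=
    Measurable.indicator measurable_speedKernel (measurableSet_lowSpeed U)
  rw [Measure.volume_eq_prod, lintegral_prod _ hm.aemeasurable]
  calc ∫⁻ x, ∫⁻ v, (lowSpeed U).indicator (fun z => speedKernel z.1 z.2) (x, v)
      ≤ ∫⁻ x, (Metric.ball (0 : Space) 1).indicator (fun x =>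
          ENNReal.ofReal (‖x‖ ^ (-(11 / 4 : ℝ)))) x * (c₀ * ENNReal.ofReal (U ^ 2)) := by
        refine lintegral_mono_ae ?_
        filter_upwards [ae_ne 0] with x hx
        have hx0 : 0 < ‖x‖ := norm_pos_iff.2 hx
        by_cases hx1 : x ∈ Metric.ball (0 : Space) 1
        · rw [indicator_of_mem hx1]
          have hp : 0 < (‖x‖ ^ (1 / 4 : ℝ)) ^ 3 := by positivity
          set R := √(U ^ 2 / (‖x‖ ^ (1 / 4 : ℝ)) ^ 3) with hR
          have hR0 : 0 < R := Real.sqrt_pos.2 (by positivity)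
          have hR2 : R ^ 2 = U ^ 2 / (‖x‖ ^ (1 / 4 : ℝ)) ^ 3 := Real.sq_sqrt (by positivity)
          calc ∫⁻ v, (lowSpeed U).indicator (fun z => speedKernel z.1 z.2) (x, v)
              ≤ ∫⁻ v, (‖x‖ₑ ^ 2)⁻¹ * (Metric.ball (0 : Space) R).indicator
                  (fun v => ENNReal.ofReal (‖v‖ ^ (-1 : ℝ))) v := by
                refine lintegral_mono_ae ?_
                filter_upwards [ae_ne 0] with v hv
                have hv0 : 0 < ‖v‖ := norm_pos_iff.2 hv
                by_cases h : (x, v) ∈ lowSpeed U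
                · rw [indicator_of_mem h]
                  have hvR : v ∈ Metric.ball (0 : Space) R := by
                    rw [mem_ball_zero_iff]
                    have h2 : (1 + ‖v‖) ^ 2 ≤ R ^ 2 := by
                      rw [hR2, le_div_iff₀ hp]; exact h.2
                    have := (abs_le_of_sq_le_sq' h2 hR0.le).2
                    linarith
                  rw [indicator_of_mem hvR, speedKernel]
                  gcongr
                  rw [Real.rpow_neg_one]
                  exact inv_anti₀ hv0 (by linarith)
                · rw [indicator_of_notMem h]; exact zero_le
            _ = (‖x‖ₑ ^ 2)⁻¹ * (ENNReal.ofReal (R ^ 2) * c₀) := by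
                rw [lintegral_const_mul' _ _ (by simp [hx]), lintegral_indicator measurableSet_ball,
                  lintegral_ball_inv_norm hR0]
            _ = ENNReal.ofReal (‖x‖ ^ (-(11 / 4 : ℝ))) * (c₀ * ENNReal.ofReal (U ^ 2)) := by
                rw [hR2, div_eq_mul_inv, ENNReal.ofReal_mul (by positivity), ← ofReal_norm,
                  ← ENNReal.ofReal_pow (norm_nonneg _),
                  ← ENNReal.ofReal_inv_of_pos (by positivity), ← inv_sq_mul_inv_pow hx0,
                  ENNReal.ofReal_mul (by positivity)]
                ring
            _ ≤ _ := le_rfl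
        · rw [indicator_of_notMem hx1, zero_mul]
          refine le_of_eq (lintegral_eq_zero_of_ae_eq_zero (Eventually.of_forall fun v => ?_))
          refine indicator_of_notMem (fun h => hx1 ?_) _
          rw [mem_ball_zero_iff]; exact h.1
    _ = c₁ * c₀ * ENNReal.ofReal (U ^ 2) := by
        rw [lintegral_mul_const' _ _ (ENNReal.mul_ne_top h0 ENNReal.ofReal_ne_top),
          lintegral_indicator measurableSet_ball, mul_assoc]

/-- For fixed `x` the variable `u` lies in a ball with `R³ = (1 + |v|) |x|^(-3/4)`. Its volume
cancels the weight `1/(1 + |v|)` and again leaves `|x|^(-11/4)`. -/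
theorem exists_lintegral_highSpeed_bound : ∃ c : ℝ≥0∞, c ≠ ∞ ∧ ∀ v : Space,
    ∫⁻ z : Phase, (highSpeed (1 + ‖v‖)).indicator (fun z => speedKernel z.1 v) z ≤ c := by
  set c₀ := volume (Metric.ball (0 : Space) 1) with hc₀
  set c₁ := ∫⁻ x in Metric.ball (0 : Space) 1, ENNReal.ofReal (‖x‖ ^ (-(11 / 4 : ℝ))) with hc₁
  have h0 : c₀ ≠ ∞ := measure_ball_lt_top.ne
  have h1 : c₁ ≠ ∞ := (lintegral_ball_norm_rpow_lt_top (by norm_num) 1).ne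
  refine ⟨c₁ * c₀, ENNReal.mul_ne_top h1 h0, fun v => ?_⟩
  have hV : 0 < 1 + ‖v‖ := by positivity
  have hm : Measurable ((highSpeed (1 + ‖v‖)).indicator fun z : Phase => speedKernel z.1 v) :=
    Measurable.indicator (measurable_speedKernel.comp (measurable_fst.prodMk measurable_const))
      (measurableSet_highSpeed _)
  rw [Measure.volume_eq_prod, lintegral_prod _ hm.aemeasurable]
  calc ∫⁻ x, ∫⁻ u, (highSpeed (1 + ‖v‖)).indicator (fun z => speedKernel z.1 v) (x, u)
      ≤ ∫⁻ x, (Metric.ball (0 : Space) 1).indicator (fun x =>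
          ENNReal.ofReal (‖x‖ ^ (-(11 / 4 : ℝ)))) x * c₀ := by
        refine lintegral_mono_ae ?_
        filter_upwards [ae_ne 0] with x hx
        have hx0 : 0 < ‖x‖ := norm_pos_iff.2 hx
        by_cases hx1 : x ∈ Metric.ball (0 : Space) 1
        · rw [indicator_of_mem hx1]
          have hp : 0 < (‖x‖ ^ (1 / 4 : ℝ)) ^ 3 := by positivity
          set R := ((1 + ‖v‖) / (‖x‖ ^ (1 / 4 : ℝ)) ^ 3) ^ (1 / 3 : ℝ) with hR
          have hR0 : 0 ≤ R := by positivity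
          have hR3 : R ^ 3 = (1 + ‖v‖) / (‖x‖ ^ (1 / 4 : ℝ)) ^ 3 := by
            rw [hR, ← Real.rpow_natCast, ← Real.rpow_mul (by positivity)]; norm_num
          calc ∫⁻ u, (highSpeed (1 + ‖v‖)).indicator (fun z => speedKernel z.1 v) (x, u)
              ≤ ∫⁻ u, (Metric.ball (0 : Space) R).indicator (fun _ => speedKernel x v) u := by
                refine lintegral_mono fun u => ?_
                by_cases h : (x, u) ∈ highSpeed (1 + ‖v‖)
                · rw [indicator_of_mem h]
                  have huR : u ∈ Metric.ball (0 : Space) R := by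
                    rw [mem_ball_zero_iff]
                    have h2 : (1 + ‖u‖) ^ 3 ≤ R ^ 3 := by
                      rw [hR3, le_div_iff₀ hp]; exact h.2
                    have := le_of_pow_le_pow_left₀ three_ne_zero hR0 h2
                    linarith
                  rw [indicator_of_mem huR]
                · rw [indicator_of_notMem h]; exact zero_le
            _ = speedKernel x v * (ENNReal.ofReal (R ^ 3) * c₀) := by
                rw [lintegral_indicator measurableSet_ball, setLIntegral_const,
                  Measure.addHaar_ball _ _ hR0, finrank_space]
            _ = ENNReal.ofReal (‖x‖ ^ (-(11 / 4 : ℝ))) * c₀ := by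
                rw [speedKernel, hR3, div_eq_mul_inv, ENNReal.ofReal_mul hV.le, ← ofReal_norm,
                  ← ENNReal.ofReal_pow (norm_nonneg _),
                  ← ENNReal.ofReal_inv_of_pos (by positivity), ← inv_sq_mul_inv_pow hx0,
                  ENNReal.ofReal_mul (by positivity)]
                have : ENNReal.ofReal (1 + ‖v‖)⁻¹ * ENNReal.ofReal (1 + ‖v‖) = 1 := by
                  rw [← ENNReal.ofReal_mul (by positivity), inv_mul_cancel₀ hV.ne']; simp
                calc _ = ENNReal.ofReal (‖x‖ ^ 2)⁻¹ * ENNReal.ofReal ((‖x‖ ^ (1 / 4 : ℝ)) ^ 3)⁻¹ *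
                      c₀ * (ENNReal.ofReal (1 + ‖v‖)⁻¹ * ENNReal.ofReal (1 + ‖v‖)) := by ring
                  _ = _ := by rw [this, mul_one]
            _ ≤ _ := le_rfl
        · rw [indicator_of_notMem hx1, zero_mul]
          refine le_of_eq (lintegral_eq_zero_of_ae_eq_zero (Eventually.of_forall fun v => ?_))
          refine indicator_of_notMem (fun h => hx1 ?_) _
          rw [mem_ball_zero_iff]; exact h.1
    _ = c₁ * c₀ := by
        rw [lintegral_mul_const' _ _ h0, lintegral_indicator measurableSet_ball]

theorem lintegral_le_mul_of_le {N : ℝ≥0∞} {ν : Measure Phase}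
    (hν : ν ≤ N • (volume : Measure Phase)) (G : Phase → ℝ≥0∞) :
    ∫⁻ z, G z ∂ν ≤ N * ∫⁻ z, G z := by
  rw [← smul_eq_mul, ← lintegral_smul_measure]
  exact lintegral_mono' hν le_rfl

/-- The part of the kernel where the velocity of the first particle is small. -/
noncomputable def lowKernel (z y : Phase) : ℝ≥0∞ :=
  (lowSpeed (1 + ‖y.2‖)).indicator (fun w => speedKernel w.1 w.2) (z.1 - y.1, z.2)

/-- The part of the kernel where the velocity of the second particle is small. -/
noncomputable def highKernel (z y : Phase) : ℝ≥0∞ :=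
  (highSpeed (1 + ‖z.2‖)).indicator (fun w => speedKernel w.1 z.2) (y.1 - z.1, y.2)

theorem measurable_lowKernel : Measurable (Function.uncurry lowKernel) := by
  have h1 : Measurable fun p : Phase × Phase => speedKernel (p.1.1 - p.2.1) p.1.2 := by
    unfold speedKernel; fun_prop
  have h2 : MeasurableSet {p : Phase × Phase | ‖p.1.1 - p.2.1‖ < 1 ∧
      (1 + ‖p.1.2‖) ^ 2 * (‖p.1.1 - p.2.1‖ ^ (1 / 4 : ℝ)) ^ 3 ≤ (1 + ‖p.2.2‖) ^ 2} := by
    have h3 : Measurable fun p : Phase × Phase => ‖p.1.1 - p.2.1‖ := by fun_prop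
    have h4 : Measurable fun p : Phase × Phase =>
      (1 + ‖p.1.2‖) ^ 2 * (‖p.1.1 - p.2.1‖ ^ (1 / 4 : ℝ)) ^ 3 := by fun_prop
    have h5 : Measurable fun p : Phase × Phase => (1 + ‖p.2.2‖) ^ 2 := by fun_prop
    exact (measurableSet_lt h3 measurable_const).inter (measurableSet_le h4 h5)
  exact h1.indicator h2

theorem measurable_highKernel (z : Phase) : Measurable (highKernel z) := by
  have h1 : Measurable fun y : Phase => (y.1 - z.1, y.2) := by fun_prop
  have h2 : Measurable fun w : Phase => speedKernel w.1 z.2 :=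
    measurable_speedKernel.comp (measurable_fst.prodMk measurable_const)
  exact (h2.indicator (measurableSet_highSpeed (1 + ‖z.2‖))).comp h1

theorem speedKernel_sub_le (z y : Phase) : speedKernel (z.1 - y.1) z.2 ≤
    1 + ENNReal.ofReal ((1 + ‖y.2‖) ^ 2) + lowKernel z y + highKernel z y := by
  have h1 := speedKernel_le (z.1 - y.1) z.2 y.2
  have h2 : (highSpeed (1 + ‖z.2‖)).indicator (fun _ => speedKernel (z.1 - y.1) z.2)
      (z.1 - y.1, y.2) = highKernel z y := by
    have h3 : ‖z.1 - y.1‖ = ‖y.1 - z.1‖ := norm_sub_rev _ _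
    have h4 : speedKernel (z.1 - y.1) z.2 = speedKernel (y.1 - z.1) z.2 := by
      rw [speedKernel, speedKernel, ← ofReal_norm, ← ofReal_norm, h3]
    have h5 : (z.1 - y.1, y.2) ∈ highSpeed (1 + ‖z.2‖) ↔
        (y.1 - z.1, y.2) ∈ highSpeed (1 + ‖z.2‖) := by
      simp only [highSpeed, mem_ofPred_eq, h3]
    unfold highKernel
    by_cases h : (y.1 - z.1, y.2) ∈ highSpeed (1 + ‖z.2‖)
    · rw [indicator_of_mem h, indicator_of_mem (h5.2 h), h4]
    · rw [indicator_of_notMem h, indicator_of_notMem (mt h5.1 h)]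
  rwa [h2] at h1

instance : (volume : Measure Phase).IsAddRightInvariant :=
  inferInstanceAs ((volume : Measure Space).prod (volume : Measure Space)).IsAddRightInvariant

theorem lintegral_lowKernel (y : Phase) : ∫⁻ z, lowKernel z y =
    ∫⁻ w, (lowSpeed (1 + ‖y.2‖)).indicator (fun w => speedKernel w.1 w.2) w := by
  rw [← lintegral_sub_right_eq_self (μ := (volume : Measure Phase)) (fun w =>
    (lowSpeed (1 + ‖y.2‖)).indicator (fun w => speedKernel w.1 w.2) w) ((y.1, 0) : Phase)]
  refine lintegral_congr fun z => ?_
  rw [lowKernel, show z - ((y.1, 0) : Phase) = (z.1 - y.1, z.2) from Prod.ext rfl (sub_zero _)]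

theorem lintegral_highKernel (z : Phase) : ∫⁻ y, highKernel z y =
    ∫⁻ w, (highSpeed (1 + ‖z.2‖)).indicator (fun w => speedKernel w.1 z.2) w := by
  rw [← lintegral_sub_right_eq_self (μ := (volume : Measure Phase)) (fun w =>
    (highSpeed (1 + ‖z.2‖)).indicator (fun w => speedKernel w.1 z.2) w) ((z.1, 0) : Phase)]
  refine lintegral_congr fun y => ?_
  rw [highKernel, show y - ((z.1, 0) : Phase) = (y.1 - z.1, y.2) from Prod.ext rfl (sub_zero _)]

theorem measurable_lowKernel_right (z : Phase) : Measurable (lowKernel z) :=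
  measurable_lowKernel.of_uncurry_left

theorem measurable_lintegral_lowKernel (κ : Measure Phase) [SFinite κ] :
    Measurable fun z => ∫⁻ y, lowKernel z y ∂κ :=
  measurable_lowKernel.lintegral_prod_right

/-- The potential of a density with kernel `|x|⁻²`, averaged against another density with the weight
`1 / (1 + |v|)`, is controlled by bounds on both densities and the kinetic energy of the first. -/
theorem exists_lintegral_speedKernel_bound {N H : ℝ≥0∞} (hN : N ≠ ∞) (hH : H ≠ ∞) :
    ∃ B : ℝ≥0∞, B ≠ ∞ ∧ ∀ κ ν : Measure Phase, κ ≤ N • (volume : Measure Phase) →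
      ν ≤ N • (volume : Measure Phase) → κ univ ≤ 1 → ν univ ≤ 1 →
      ∫⁻ y : Phase, ENNReal.ofReal ((1 + ‖y.2‖) ^ 2) ∂κ ≤ H →
      ∫⁻ z, (∫⁻ y, speedKernel (z.1 - y.1) z.2 ∂κ) ∂ν ≤ B := by
  obtain ⟨c, hc, hlow⟩ := exists_lintegral_lowSpeed_bound
  obtain ⟨c', hc', hhigh⟩ := exists_lintegral_highSpeed_bound
  refine ⟨1 + H + N * c * H + N * c', by finiteness, fun κ ν hκ hν hκ1 hν1 hH => ?_⟩
  have : IsFiniteMeasure κ := ⟨hκ1.trans_lt ENNReal.one_lt_top⟩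
  have : IsFiniteMeasure ν := ⟨hν1.trans_lt ENNReal.one_lt_top⟩
  have hU : Measurable fun y : Phase => ENNReal.ofReal ((1 + ‖y.2‖) ^ 2) := by fun_prop
  -- Here the integral over the slow first particle comes first, using the density bound of `ν`; the
  -- factor that remains is the second moment of `κ`.
  have hAint : ∫⁻ z, (∫⁻ y, lowKernel z y ∂κ) ∂ν ≤ N * c * H := by
    have e := lintegral_lintegral_swap (μ := ν) (ν := κ) (f := lowKernel)
      measurable_lowKernel.aemeasurable
    rw [e]
    calc ∫⁻ y, (∫⁻ z, lowKernel z y ∂ν) ∂κ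
        ≤ ∫⁻ y, N * (c * ENNReal.ofReal ((1 + ‖y.2‖) ^ 2)) ∂κ := by
          refine lintegral_mono fun y => (lintegral_le_mul_of_le hν _).trans ?_
          gcongr
          rw [lintegral_lowKernel]
          exact hlow (1 + ‖y.2‖) (by positivity)
      _ = N * c * ∫⁻ y : Phase, ENNReal.ofReal ((1 + ‖y.2‖) ^ 2) ∂κ := by
          rw [lintegral_const_mul' _ _ hN, lintegral_const_mul' _ _ hc, mul_assoc]
      _ ≤ N * c * H := by gcongr
  -- Here the second particle is integrated first, using the density bound of `κ`, and no moment is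
  -- needed.
  have hDint : ∫⁻ z, (∫⁻ y, highKernel z y ∂κ) ∂ν ≤ N * c' := by
    calc ∫⁻ z, (∫⁻ y, highKernel z y ∂κ) ∂ν ≤ ∫⁻ _, N * c' ∂ν := by
          refine lintegral_mono fun z => (lintegral_le_mul_of_le hκ _).trans ?_
          gcongr
          rw [lintegral_highKernel]
          exact hhigh z.2
      _ ≤ N * c' := by
          rw [lintegral_const]
          exact mul_le_of_le_one_right' hν1
  have h1 : ∀ z, ∫⁻ y, speedKernel (z.1 - y.1) z.2 ∂κ ≤
      1 + H + ∫⁻ y, lowKernel z y ∂κ + ∫⁻ y, highKernel z y ∂κ := by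
    intro z
    refine (lintegral_mono fun y => speedKernel_sub_le z y).trans ?_
    rw [lintegral_add_right _ (measurable_highKernel z), lintegral_add_right _ (measurable_lowKernel_right z),
      lintegral_add_right _ hU, lintegral_one]
    gcongr
  refine (lintegral_mono h1).trans ?_
  rw [lintegral_add_left ((measurable_lintegral_lowKernel κ).const_add (1 + H)), lintegral_add_left measurable_const,
    lintegral_const]
  gcongr
  exact mul_le_of_le_one_right' hν1

end VPCharge

namespace VPCharge

/-! ### A Lyapunov function for a particle repelled by a moving charge -/

/-- The energy in the field of a charge at the origin, corrected by the radial velocity. -/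
noncomputable def lyapunov (K : ℝ) (p : Phase) : ℝ :=
  ‖p.2‖ ^ 2 / 2 + ‖p.1‖⁻¹ - K * (inner ℝ p.2 p.1 * ‖p.1‖⁻¹) + K ^ 2

theorem abs_inner_mul_inv_norm_le (v y : Space) : |inner ℝ v y * ‖y‖⁻¹| ≤ ‖v‖ := by
  rw [abs_mul, abs_of_nonneg (inv_nonneg.2 (norm_nonneg y))]
  rcases eq_or_ne y 0 with rfl | hy
  · simp
  · rw [← div_eq_mul_inv, div_le_iff₀ (norm_pos_iff.2 hy)]
    exact abs_real_inner_le_norm v y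

/-- Completing the square: `|v|²/2 - K|v| + K² = |v|²/4 + (|v|/2 - K)²`. This is why `K²` is added
in the definition. -/
theorem norm_sq_le_lyapunov {K : ℝ} (hK : 0 ≤ K) (p : Phase) : ‖p.2‖ ^ 2 / 4 ≤ lyapunov K p := by
  have h := (abs_le.1 (abs_inner_mul_inv_norm_le p.2 p.1)).2
  have h2 := mul_le_mul_of_nonneg_left h hK
  have h3 := inv_nonneg.2 (norm_nonneg p.1)
  rw [lyapunov]
  nlinarith [sq_nonneg (‖p.2‖ / 2 - K)]

theorem lyapunov_le {K : ℝ} (hK : 0 ≤ K) (p : Phase) :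
    lyapunov K p ≤ ‖p.2‖ ^ 2 / 2 + ‖p.1‖⁻¹ + K * ‖p.2‖ + K ^ 2 := by
  have h := (abs_le.1 (abs_inner_mul_inv_norm_le p.2 p.1)).1
  have h2 := mul_le_mul_of_nonneg_left h hK
  rw [lyapunov]
  linarith

theorem one_add_lyapunov_pos {K : ℝ} (hK : 0 ≤ K) (p : Phase) : 0 < 1 + lyapunov K p := by
  have := norm_sq_le_lyapunov hK p
  have h0 : 0 ≤ ‖p.2‖ ^ 2 / 4 := by positivity
  linarith

theorem contDiffOn_lyapunov (K : ℝ) : ContDiffOn ℝ 1 (lyapunov K) {p | p.1 ≠ 0} := by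
  have h1 : ContDiffOn ℝ 1 (fun p : Phase => ‖p.1‖⁻¹) {p | p.1 ≠ 0} :=
    contDiffOn_norm_fst.inv fun _ hp => norm_ne_zero_iff.2 hp
  have h2 : ContDiff ℝ 1 fun p : Phase => (inner ℝ p.2 p.1 : ℝ) := contDiff_snd.inner ℝ contDiff_fst
  have h3 : ContDiff ℝ 1 fun p : Phase => ‖p.2‖ ^ 2 / 2 := (contDiff_snd.norm_sq ℝ).div_const 2
  exact ((h3.contDiffOn.add h1).sub (contDiffOn_const.mul (h2.contDiffOn.mul h1))).add
    contDiffOn_const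

theorem contDiffOn_log_lyapunov {K : ℝ} (hK : 0 ≤ K) :
    ContDiffOn ℝ 1 (fun p => Real.log (1 + lyapunov K p)) {p | p.1 ≠ 0} :=
  (contDiffOn_const.add (contDiffOn_lyapunov K)).log fun p _ => (one_add_lyapunov_pos hK p).ne'

theorem fderiv_log_lyapunov {K : ℝ} (hK : 0 ≤ K) {y v w e : Space} (hy : y ≠ 0) :
    fderiv ℝ (fun p => Real.log (1 + lyapunov K p)) (y, v) (w, e) =
      (inner ℝ v e - inner ℝ w (coulomb y) - K * ((inner ℝ v w + inner ℝ e y) * ‖y‖⁻¹ +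
        inner ℝ v y * -inner ℝ w (coulomb y))) / (1 + lyapunov K (y, v)) := by
  refine fderiv_eq_of_hasLineDerivAt (contDiffOn_log_lyapunov hK) hy ?_
  have h1 : HasDerivAt (fun τ : ℝ => v + τ • e) e 0 := by
    simpa using ((hasDerivAt_id (0 : ℝ)).smul_const e).const_add v
  have h2 : HasDerivAt (fun τ : ℝ => y + τ • w) w 0 := by
    simpa using ((hasDerivAt_id (0 : ℝ)).smul_const w).const_add y
  have h3 := h1.inner ℝ h2
  have h4 := hasDerivAt_inv_norm_line (w := w) hy
  have h5 := (((((hasDerivAt_norm_sq_line v e).div_const 2).fun_add h4).fun_sub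
    ((h3.fun_mul h4).const_mul K)).add_const (K ^ 2)).const_add 1
  have h6 := h5.log (by simpa [lyapunov] using (one_add_lyapunov_pos hK (y, v)).ne')
  refine h6.congr_deriv ?_
  simp only [zero_smul, add_zero, lyapunov]
  congr 1
  ring

/-- With `r = 1/|y|`, the motion of the charge costs at most `(K - 1) r²` and the radial correction
gains `K r²`, leaving `-r²`. The curvature term of the correction is at most `K³ r / 4`, and `K³ r /
4 - r² ≤ K⁶ / 64`. -/
theorem lyapunov_deriv_le {K : ℝ} (hK : 1 ≤ K) {y v e u : Space} (hy : y ≠ 0) (he : ‖e‖ ≤ K - 1) :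
    inner ℝ v (u + coulomb y) - inner ℝ (v - e) (coulomb y) -
      K * ((inner ℝ v (v - e) + inner ℝ (u + coulomb y) y) * ‖y‖⁻¹ +
        inner ℝ v y * -inner ℝ (v - e) (coulomb y)) ≤
      (‖v‖ + K) * ‖u‖ + K ^ 6 / 64 := by
  obtain ⟨r, hr⟩ : ∃ r, r = ‖y‖⁻¹ := ⟨_, rfl⟩
  have hy0 : 0 < ‖y‖ := norm_pos_iff.2 hy
  have hr0 : 0 < r := hr ▸ inv_pos.2 hy0
  have hyr : ‖y‖ * r = 1 := by rw [hr]; exact mul_inv_cancel₀ hy0.ne'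
  have hyy : (inner ℝ y y : ℝ) * r ^ 2 = 1 := by
    rw [real_inner_self_eq_norm_sq, ← mul_pow, hyr, one_pow]
  have hc : coulomb y = r ^ 3 • y := by rw [coulomb, hr, inv_pow]
  -- The square of the component of `v` orthogonal to `y`, shifted by `e / 2`, bounds the curvature
  -- term `Q` below by `-|e|²/4`.
  have hperp : 0 ≤ ‖v - (inner ℝ v y * r ^ 2) • y - (1 / 2 : ℝ) • e‖ ^ 2 := sq_nonneg _
  rw [← real_inner_self_eq_norm_sq] at hperp
  simp only [inner_sub_left, inner_sub_right, inner_smul_left, inner_smul_right,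
    real_inner_comm v y, real_inner_comm e y, real_inner_comm v e, conj_trivial] at hperp
  have hee : (inner ℝ e e : ℝ) ≤ K ^ 2 := by
    rw [real_inner_self_eq_norm_sq]
    exact pow_le_pow_left₀ (norm_nonneg _) (by linarith) 2
  rw [hc, ← hr]
  simp only [inner_add_left, inner_add_right, inner_sub_left, inner_sub_right, inner_smul_left,
    inner_smul_right, conj_trivial]
  have hvu : (inner ℝ v u : ℝ) ≤ ‖v‖ * ‖u‖ := real_inner_le_norm v u
  have huy : -(inner ℝ u y * r : ℝ) ≤ ‖u‖ := by
    have := (abs_le.1 (abs_inner_mul_inv_norm_le u y)).1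
    rw [← hr] at this; linarith
  have hey : (inner ℝ e y * r : ℝ) ≤ K - 1 := by
    have := (abs_le.1 (abs_inner_mul_inv_norm_le e y)).2
    rw [← hr] at this; linarith
  generalize (inner ℝ v y : ℝ) = vy at *
  generalize (inner ℝ e y : ℝ) = ey at *
  generalize (inner ℝ u y : ℝ) = uy at *
  generalize (inner ℝ y y : ℝ) = yy at *
  generalize (inner ℝ v v : ℝ) = vv at *
  generalize (inner ℝ v e : ℝ) = ve at *
  generalize (inner ℝ v u : ℝ) = vu at *
  generalize (inner ℝ e e : ℝ) = ee at *
  obtain ⟨Q, hQ⟩ : ∃ Q, Q = vv - ve - r ^ 2 * vy ^ 2 + r ^ 2 * vy * ey := ⟨_, rfl⟩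
  have hQ' : -(K ^ 2 / 4) ≤ Q := by
    have h1 : Q + ee / 4 = vv - 2 * r ^ 2 * vy ^ 2 + r ^ 2 * vy ^ 2 * (yy * r ^ 2) - ve +
        r ^ 2 * vy * ey + ee / 4 := by rw [hyy, hQ]; ring
    linarith
  have h2 := mul_le_mul_of_nonneg_left hQ' (show 0 ≤ K * r by positivity)
  have h3 := mul_le_mul_of_nonneg_left hey (sq_nonneg r)
  have h4 := mul_le_mul_of_nonneg_left huy (show 0 ≤ K by linarith)
  have h5 : vu + r ^ 3 * vy - (r ^ 3 * vy - r ^ 3 * ey) -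
      K * ((vv - ve + (uy + r ^ 3 * yy)) * r + vy * -(r ^ 3 * vy - r ^ 3 * ey)) =
      vu + r ^ 2 * (ey * r) + K * -(uy * r) - K * (r ^ 2 * (yy * r ^ 2)) - K * r * Q := by
    rw [hQ]; ring
  rw [hyy] at h5
  nlinarith [sq_nonneg (r - K ^ 3 / 8)]

variable {E : ℝ → Space → Space} {ξ η : ℝ → Space} {C T a b : ℝ} {γ : ℝ → Phase}

/-- The logarithm divides by at least `1 + |v|²/4`, which turns `(|v| + K)|u|` into a multiple of
`|u|/(1 + |v|)`, the quantity with a finite mean. The factor `8 (1 + K)` is not optimal. -/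
theorem fderiv_log_lyapunov_le {K : ℝ} (hK : 1 ≤ K) {y v e u : Space} (hy : y ≠ 0)
    (he : ‖e‖ ≤ K - 1) :
    fderiv ℝ (fun p => Real.log (1 + lyapunov K p)) (y, v) (v - e, u + coulomb y) ≤
      8 * (1 + K) * (‖u‖ * (1 + ‖v‖)⁻¹) + K ^ 6 / 64 := by
  have hK0 : 0 ≤ K := by linarith
  have hL := one_add_lyapunov_pos hK0 (y, v)
  have hL2 : 1 + ‖v‖ ^ 2 / 4 ≤ 1 + lyapunov K (y, v) := by
    linarith [norm_sq_le_lyapunov hK0 (y, v)]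
  rw [fderiv_log_lyapunov hK0 hy, div_le_iff₀ hL]
  refine (lyapunov_deriv_le hK hy he).trans ?_
  have h1 : K ^ 6 / 64 ≤ K ^ 6 / 64 * (1 + lyapunov K (y, v)) := by
    refine le_mul_of_one_le_right (by positivity) ?_
    have : 0 ≤ ‖v‖ ^ 2 / 4 := by positivity
    linarith
  have h2 : (‖v‖ + K) * ‖u‖ ≤
      8 * (1 + K) * (‖u‖ * (1 + ‖v‖)⁻¹) * (1 + ‖v‖ ^ 2 / 4) := by
    have hv : 0 < 1 + ‖v‖ := by positivity
    have h3 : (‖v‖ + K) ≤ 8 * (1 + K) * (1 + ‖v‖)⁻¹ * (1 + ‖v‖ ^ 2 / 4) := by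
      rw [mul_right_comm, ← div_eq_mul_inv, le_div_iff₀ hv]
      nlinarith [norm_nonneg v, sq_nonneg (‖v‖ - 1), mul_nonneg hK0 (norm_nonneg v),
        mul_nonneg hK0 (sq_nonneg (‖v‖ - 1)), mul_nonneg hK0 (sq_nonneg ‖v‖)]
    calc (‖v‖ + K) * ‖u‖ ≤ 8 * (1 + K) * (1 + ‖v‖)⁻¹ * (1 + ‖v‖ ^ 2 / 4) * ‖u‖ := by gcongr
      _ = _ := by ring
  have h4 : 8 * (1 + K) * (‖u‖ * (1 + ‖v‖)⁻¹) * (1 + ‖v‖ ^ 2 / 4) ≤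
      8 * (1 + K) * (‖u‖ * (1 + ‖v‖)⁻¹) * (1 + lyapunov K (y, v)) := by gcongr
  linarith

theorem IsTrajectory.log_lyapunov_le (hγ : IsTrajectory E ξ a b γ) (hξ : IsChargePath E ξ η C T)
    (ha : 0 ≤ a) (hab : a ≤ b) (hb : b ≤ T) {K Q : ℝ} (hK : 1 ≤ K)
    (hη : ∀ s ∈ Icc a b, ‖η s‖ ≤ K - 1) (hQ : 0 ≤ Q)
    (hint : ∫⁻ s in Ioo a b, ‖E s (γ s).1‖ₑ * ENNReal.ofReal (1 + ‖(γ s).2‖)⁻¹ ≤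
      ENNReal.ofReal Q) :
    Real.log (1 + lyapunov K ((γ b).1 - ξ b, (γ b).2)) ≤
      Real.log (1 + lyapunov K ((γ a).1 - ξ a, (γ a).2)) + 8 * (1 + K) * Q +
        K ^ 6 / 64 * (b - a) := by
  have hK0 : 0 ≤ K := by linarith
  obtain ⟨h1, h2⟩ := hγ.integral_fderiv hξ ha hab hb 0 (contDiffOn_log_lyapunov hK0)
  simp only [zero_smul, sub_zero] at h1 h2
  have hm := hγ.aemeasurable hab
  have hCb := hξ.bound_nonneg
  have hii : IntervalIntegrable (fun s => ‖E s (γ s).1‖ * (1 + ‖(γ s).2‖)⁻¹) volume a b := by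
    rw [intervalIntegrable_iff]
    refine IntegrableOn.of_bound (C := C) (by rw [uIoc]; exact measure_Ioc_lt_top) ?_
      (Eventually.of_forall fun s => ?_)
    · have h3 : AEMeasurable (fun s => (1 + ‖(γ s).2‖)⁻¹) (volume.restrict (uIoc a b)) :=
        (hm.snd.norm.const_add 1).inv
      exact (hξ.aestronglyMeasurable_comp hm.fst).norm.mul h3.aestronglyMeasurable
    · rw [norm_mul, norm_norm, Real.norm_of_nonneg (by positivity)]
      refine (mul_le_of_le_one_right (norm_nonneg _) ?_).trans (hξ.bound _ _)
      exact inv_le_one_of_one_le₀ (by linarith [norm_nonneg (γ s).2])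
  have h4 : ∫ s in a..b, ‖E s (γ s).1‖ * (1 + ‖(γ s).2‖)⁻¹ ≤ Q := by
    rw [intervalIntegral.integral_of_le hab, integral_Ioc_eq_integral_Ioo,
      integral_eq_lintegral_of_nonneg_ae (Eventually.of_forall fun s => by positivity)
      (((intervalIntegrable_iff_integrableOn_Ioc_of_le hab).1 hii).mono_set
        Ioo_subset_Ioc_self).aestronglyMeasurable]
    refine ENNReal.toReal_le_of_le_ofReal hQ (le_trans (le_of_eq ?_) hint)
    refine lintegral_congr fun s => ?_
    rw [ENNReal.ofReal_mul (norm_nonneg _), ofReal_norm]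
  have h5 : ∫ s in a..b, fderiv ℝ (fun p => Real.log (1 + lyapunov K p))
      ((γ s).1 - ξ s, (γ s).2) ((γ s).2 - η s, E s (γ s).1 + coulomb ((γ s).1 - ξ s)) ≤
      ∫ s in a..b, (8 * (1 + K) * (‖E s (γ s).1‖ * (1 + ‖(γ s).2‖)⁻¹) + K ^ 6 / 64) := by
    refine intervalIntegral.integral_mono_on hab h1
      ((hii.const_mul _).add intervalIntegrable_const) fun s hs => ?_
    exact fderiv_log_lyapunov_le hK (sub_ne_zero.2 (hγ.ne s hs)) (hη s hs)
  rw [h2, intervalIntegral.integral_add (hii.const_mul _) intervalIntegrable_const,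
    intervalIntegral.integral_const_mul, intervalIntegral.integral_const, smul_eq_mul] at h5
  have h6 := mul_le_mul_of_nonneg_left h4 (show 0 ≤ 8 * (1 + K) by linarith)
  linarith

end VPCharge

/-! ### Mean action, bound on the speed and uniform escape estimate -/

namespace VPCharge

/-- A regular Lagrangian flow of `drift E ξ` with quantitative bounds: `N` bounds the compression
and the density that generates the field, `H` its kinetic energy, and `K - 1` the charge's speed. -/
structure IsControlledFlow (N H : ℝ≥0∞) (K t T : ℝ) (μ : Measure Phase) (E : ℝ → Space → Space)
    (ξ η : ℝ → Space) (C : ℝ) (L : ℝ≥0∞) (Z : ℝ → Phase → Phase) : Prop where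
  flow : IsRegularLagrangianFlow μ L (drift E ξ) t T Z
  ne_top : L ≠ ∞
  chargePath : IsChargePath E ξ η C T
  nonneg : 0 ≤ t
  lt : t < T
  mass : μ univ ≤ 1
  speed : ∀ s ∈ Icc 0 T, ‖η s‖ ≤ K - 1
  compression : ∀ᵐ s, s ∈ Ioo t T → μ.map (Z s) ≤ N • (volume : Measure Phase)
  field : ∀ᵐ s, s ∈ Ioo t T → ∃ κ : Measure Phase, κ ≤ N • (volume : Measure Phase) ∧
    κ univ ≤ 1 ∧ ∫⁻ y : Phase, ENNReal.ofReal ((1 + ‖y.2‖) ^ 2) ∂κ ≤ H ∧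
    ∀ x, ‖E s x‖ₑ ≤ ∫⁻ y : Phase, (‖x - y.1‖ₑ ^ 2)⁻¹ ∂κ

variable {N H L : ℝ≥0∞} {K t T C : ℝ} {μ : Measure Phase} {E : ℝ → Space → Space}
  {ξ η : ℝ → Space} {Z Γ : ℝ → Phase → Phase}

/-- The compression by `N` is known only at almost every time after `t`. Paths start continuously,
so indicators of open sets are lower semicontinuous along them and Fatou's lemma carries the bound
back to `t`. The bound by `L` would hold at once, but `L` may not appear in the modulus of the
transported case. -/
theorem IsPathFlow.measure_open_le (hΓ : IsPathFlow E ξ μ t T Γ) (htT : t < T)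
    (hN : ∀ᵐ s, s ∈ Ioo t T → μ.map (Γ s) ≤ N • (volume : Measure Phase)) {S : Set Phase}
    (hS : IsOpen S) : μ S ≤ N * volume S := by
  have hmeas : ∀ s, Measurable (Γ s) := fun s => hΓ.measurable.comp measurable_prodMk_left
  have hex : ∀ n : ℕ, ∃ s ∈ Ioo t T, s < t + 1 / ((n : ℝ) + 1) ∧
      μ.map (Γ s) ≤ N • (volume : Measure Phase) := by
    intro n
    obtain ⟨s, hs, hst, -, hQ⟩ := exists_mem_of_measure_ne_zero (P := fun _ => True)
      (show 0 < 1 / ((n : ℝ) + 1) by positivity) htT (fun h hh => by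
        have : {s ∈ Ioo t (t + h) | True} = Ioo t (t + h) := by ext; simp
        rw [this, Real.volume_Ioo]; simpa using hh) hN
    exact ⟨s, hs, hst, hQ⟩
  choose σ hσ hσt hσN using hex
  have hlim : Tendsto σ atTop (𝓝[Icc t T] t) := by
    refine tendsto_nhdsWithin_iff.2 ⟨?_, Eventually.of_forall fun n => Ioo_subset_Icc_self (hσ n)⟩
    refine tendsto_of_tendsto_of_tendsto_of_le_of_le tendsto_const_nhds
      (show Tendsto (fun n : ℕ => t + 1 / ((n : ℝ) + 1)) atTop (𝓝 t) by
        simpa using tendsto_one_div_add_atTop_nhds_zero_nat.const_add t)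
      (fun n => (hσ n).1.le) (fun n => (hσt n).le)
  calc μ S = ∫⁻ z, S.indicator 1 z ∂μ := (lintegral_indicator_one hS.measurableSet).symm
    _ ≤ ∫⁻ z, liminf (fun n => S.indicator 1 (Γ (σ n) z)) atTop ∂μ := by
        refine lintegral_mono_ae ?_
        filter_upwards [hΓ.trajectory] with z hz
        by_cases hzS : z ∈ S
        · have h1 : Tendsto (fun n => Γ (σ n) z) atTop (𝓝 z) := by
            have := (hz.continuousOn t (left_mem_Icc.2 htT.le)).tendsto.comp hlim
            rwa [hΓ.initial] at this
          have h2 : ∀ᶠ n in atTop, S.indicator (1 : Phase → ℝ≥0∞) (Γ (σ n) z) = 1 := by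
            filter_upwards [h1.eventually (hS.mem_nhds hzS)] with n hn
            rw [indicator_of_mem hn]; rfl
          rw [indicator_of_mem hzS]
          exact (tendsto_nhds_of_eventually_eq h2).liminf_eq.ge
        · rw [indicator_of_notMem hzS]; exact zero_le
    _ ≤ liminf (fun n => ∫⁻ z, S.indicator 1 (Γ (σ n) z) ∂μ) atTop :=
        lintegral_liminf_le fun n =>
          (measurable_one.indicator hS.measurableSet).comp (hmeas _)
    _ ≤ N * volume S := by
        refine liminf_le_of_frequently_le' (Frequently.of_forall fun n => ?_)
        have h1 := hσN n S
        rw [Measure.map_apply (hmeas _) hS.measurableSet] at h1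
        have h2 : ∫⁻ z, S.indicator 1 (Γ (σ n) z) ∂μ = μ (Γ (σ n) ⁻¹' S) := by
          rw [← lintegral_indicator_one (hmeas _ hS.measurableSet)]
          rfl
        rw [h2]
        simpa using h1

/-- The field felt along a characteristic, with weight `1 / (1 + |v|)`. -/
noncomputable def fieldAction (E : ℝ → Space → Space) (t T : ℝ) (Γ : ℝ → Phase → Phase)
    (z : Phase) : ℝ≥0∞ :=
  ∫⁻ s in Ioo t T, ‖E s (Γ s z).1‖ₑ * ENNReal.ofReal (1 + ‖(Γ s z).2‖)⁻¹

theorem measurable_weighted_field (hE : Measurable (Function.uncurry E)) :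
    Measurable (Function.uncurry fun (s : ℝ) (y : Phase) =>
      ‖E s y.1‖ₑ * ENNReal.ofReal (1 + ‖y.2‖)⁻¹) := by
  have h1 : Measurable fun p : ℝ × Phase => E p.1 p.2.1 :=
    hE.comp (measurable_fst.prodMk measurable_snd.fst)
  have h2 : Measurable fun p : ℝ × Phase => ENNReal.ofReal (1 + ‖p.2.2‖)⁻¹ := by fun_prop
  exact h1.enorm.mul h2

theorem lintegral_weighted_field_le {E : Space → Space} (hE : Measurable E) {κ : Measure Phase}
    (hκE : ∀ x, ‖E x‖ₑ ≤ ∫⁻ y : Phase, (‖x - y.1‖ₑ ^ 2)⁻¹ ∂κ) {Y : Phase → Phase}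
    (hY : Measurable Y) :
    ∫⁻ z, ‖E (Y z).1‖ₑ * ENNReal.ofReal (1 + ‖(Y z).2‖)⁻¹ ∂μ ≤
      ∫⁻ z, (∫⁻ y, speedKernel (z.1 - y.1) z.2 ∂κ) ∂(μ.map Y) := by
  have hm : Measurable fun y : Phase => ‖E y.1‖ₑ * ENNReal.ofReal (1 + ‖y.2‖)⁻¹ :=
    (hE.comp measurable_fst).enorm.mul (by fun_prop)
  rw [← lintegral_map (μ := μ) hm hY]
  refine lintegral_mono fun z => ?_
  simp only [speedKernel]
  rw [lintegral_mul_const' _ _ ENNReal.ofReal_ne_top]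
  gcongr
  exact hκE z.1

theorem lintegral_flow_swap [SFinite μ] (hΓ : Measurable (Function.uncurry Γ))
    {G : ℝ → Phase → ℝ≥0∞} (hG : Measurable (Function.uncurry G)) (ν : Measure ℝ) [SFinite ν] :
    ∫⁻ z, (∫⁻ s, G s (Γ s z) ∂ν) ∂μ = ∫⁻ s, (∫⁻ z, G s (Γ s z) ∂μ) ∂ν := by
  have hm : Measurable fun p : ℝ × Phase => G p.1 (Γ p.1 p.2) :=
    hG.comp (measurable_fst.prodMk hΓ)
  exact lintegral_lintegral_swap (f := fun z s => G s (Γ s z))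
    (hm.comp measurable_swap).aemeasurable

theorem lintegral_fieldAction_eq [SFinite μ] (hE : Measurable (Function.uncurry E))
    (hΓ : Measurable (Function.uncurry Γ)) : ∫⁻ z, fieldAction E t T Γ z ∂μ =
      ∫⁻ s in Ioo t T, (∫⁻ z, ‖E s (Γ s z).1‖ₑ * ENNReal.ofReal (1 + ‖(Γ s z).2‖)⁻¹ ∂μ) :=
  lintegral_flow_swap hΓ (measurable_weighted_field hE) _

/-- At almost every time the inner mean is a double integral of `speedKernel` over the transported
measure and the measure that generates the field. -/
theorem IsControlledFlow.lintegral_fieldAction_le (h : IsControlledFlow N H K t T μ E ξ η C L Z)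
    (hΓ : IsPathFlow E ξ μ t T Γ)
    (hΓZ : ∀ᵐ s, s ∈ Ioo t T → μ.map (Z s) = μ.map (Γ s)) {B : ℝ≥0∞}
    (hB : ∀ κ ν : Measure Phase, κ ≤ N • (volume : Measure Phase) →
      ν ≤ N • (volume : Measure Phase) → κ univ ≤ 1 → ν univ ≤ 1 →
      ∫⁻ y : Phase, ENNReal.ofReal ((1 + ‖y.2‖) ^ 2) ∂κ ≤ H →
      ∫⁻ z, (∫⁻ y, speedKernel (z.1 - y.1) z.2 ∂κ) ∂ν ≤ B) :
    ∫⁻ z, fieldAction E t T Γ z ∂μ ≤ B * ENNReal.ofReal (T - t) := by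
  have : IsFiniteMeasure μ := ⟨h.mass.trans_lt ENNReal.one_lt_top⟩
  rw [lintegral_fieldAction_eq h.chargePath.measurable hΓ.measurable, ← Real.volume_Ioo,
    ← setLIntegral_const]
  refine lintegral_mono_ae ?_
  filter_upwards [ae_restrict_mem measurableSet_Ioo, ae_restrict_of_ae hΓZ,
    ae_restrict_of_ae h.compression, ae_restrict_of_ae h.field] with s hs hZ hcomp hfield
  obtain ⟨κ, hκN, hκ1, hκH, hκE⟩ := hfield hs
  have hms : Measurable (Γ s) := hΓ.measurable.of_uncurry_left
  have hEs : Measurable (E s) := h.chargePath.measurable.of_uncurry_left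
  have hν1 : μ.map (Γ s) univ ≤ 1 := by
    rw [Measure.map_apply hms MeasurableSet.univ]; exact h.mass
  exact (lintegral_weighted_field_le hEs hκE hms).trans
    (hB κ (μ.map (Γ s)) hκN (hZ hs ▸ hcomp hs) hκ1 hν1 hκH)

theorem phaseNorm_trajectory_le {γ : ℝ → Phase} {a b r A : ℝ} (hγ : IsTrajectory E ξ a b γ)
    (hr : ‖(γ a).1‖ ≤ r) (hA : 0 ≤ A) (hv : ∀ s ∈ Icc a b, ‖(γ s).2‖ ≤ A) {s : ℝ}
    (hs : s ∈ Icc a b) : phaseNorm (γ s) ≤ r + A * (b - a) + A := by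
  have h1 : ‖∫ τ in a..s, (γ τ).2‖ ≤ A * |s - a| :=
    intervalIntegral.norm_integral_le_of_norm_le_const fun τ hτ => hv τ (by
      rw [uIoc_of_le hs.1] at hτ
      exact ⟨hτ.1.le, hτ.2.trans hs.2⟩)
  rw [abs_of_nonneg (by linarith [hs.1])] at h1
  have h2 : ‖(γ s).1‖ ≤ ‖(γ a).1‖ + ‖∫ τ in a..s, (γ τ).2‖ := by
    rw [hγ.fst_eq hs]; exact norm_add_le _ _
  have h3 : A * (s - a) ≤ A * (b - a) := by gcongr; exact hs.2
  linarith [phaseNorm_le (γ s), hv s hs]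

theorem measurable_fieldAction (hE : Measurable (Function.uncurry E))
    (hΓ : Measurable (Function.uncurry Γ)) : Measurable (fieldAction E t T Γ) :=
  measurable_lintegral_flow hΓ (measurable_weighted_field hE) _

/-- The speed reached by a particle that starts in the ball of radius `r` at distance at least `δ`
from the charge and feels an action at most `Q`. -/
noncomputable def speedBound (T K r δ Q : ℝ) : ℝ :=
  2 * √(Real.exp (Real.log (1 + (r ^ 2 / 2 + δ⁻¹ + K * r + K ^ 2)) + 8 * (1 + K) * Q +
    K ^ 6 / 64 * T))

theorem IsTrajectory.speed_le {γ : ℝ → Phase} (hγ : IsTrajectory E ξ t T γ)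
    (hξ : IsChargePath E ξ η C T) (ht : 0 ≤ t) {r δ Q : ℝ} (hK : 1 ≤ K)
    (hη : ∀ s ∈ Icc 0 T, ‖η s‖ ≤ K - 1) (hQ : 0 ≤ Q) (hδ : 0 < δ)
    (hint : ∫⁻ s in Ioo t T, ‖E s (γ s).1‖ₑ * ENNReal.ofReal (1 + ‖(γ s).2‖)⁻¹ ≤
      ENNReal.ofReal Q) (hr : ‖(γ t).2‖ ≤ r) (hd : δ ≤ ‖(γ t).1 - ξ t‖) {s : ℝ}
    (hs : s ∈ Icc t T) : ‖(γ s).2‖ ≤ speedBound T K r δ Q := by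
  have hK0 : 0 ≤ K := by linarith
  have hr0 : 0 ≤ r := (norm_nonneg _).trans hr
  have h1 := (hγ.mono le_rfl hs.1 hs.2).log_lyapunov_le hξ ht hs.1 hs.2 hK
    (fun τ hτ => hη τ ⟨ht.trans hτ.1, hτ.2.trans hs.2⟩) hQ
    ((lintegral_mono_set (Ioo_subset_Ioo_right hs.2)).trans hint)
  have h2 : lyapunov K ((γ t).1 - ξ t, (γ t).2) ≤ r ^ 2 / 2 + δ⁻¹ + K * r + K ^ 2 := by
    refine (lyapunov_le hK0 _).trans ?_
    gcongr
  have h3 : K ^ 6 / 64 * (s - t) ≤ K ^ 6 / 64 * T := by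
    gcongr
    linarith [hs.2]
  have h4 : Real.log (1 + lyapunov K ((γ t).1 - ξ t, (γ t).2)) ≤
      Real.log (1 + (r ^ 2 / 2 + δ⁻¹ + K * r + K ^ 2)) :=
    Real.log_le_log (one_add_lyapunov_pos hK0 _) (by linarith)
  have h5 := norm_sq_le_lyapunov hK0 ((γ s).1 - ξ s, (γ s).2)
  have h6 : 1 + lyapunov K ((γ s).1 - ξ s, (γ s).2) ≤
      Real.exp (Real.log (1 + (r ^ 2 / 2 + δ⁻¹ + K * r + K ^ 2)) + 8 * (1 + K) * Q +
        K ^ 6 / 64 * T) := by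
    rw [← Real.log_le_iff_le_exp (one_add_lyapunov_pos hK0 _)]
    linarith
  rw [speedBound]
  have h7 : ‖(γ s).2‖ / 2 ≤ √(Real.exp (Real.log (1 + (r ^ 2 / 2 + δ⁻¹ + K * r + K ^ 2)) +
      8 * (1 + K) * Q + K ^ 6 / 64 * T)) := by
    refine Real.le_sqrt_of_sq_le ?_
    simp only at h5
    nlinarith
  linarith

/-- Up to a set of measure `ε`, the particles that start in a ball stay in a larger ball. -/
theorem exists_sublevel_radius {ε : ℝ≥0∞} (hN : N ≠ ∞) (hH : H ≠ ∞) (hK : 1 ≤ K)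
    (hε : ε ≠ 0) (T r : ℝ) :
    ∃ R : ℝ, ∀ (t : ℝ) (μ : Measure Phase) (E : ℝ → Space → Space) (ξ η : ℝ → Space) (C : ℝ)
      (L : ℝ≥0∞) (Z : ℝ → Phase → Phase), IsControlledFlow N H K t T μ E ξ η C L Z →
      ∀ lam : ℝ, R ≤ lam → μ (phaseBall r \ sublevel Z t T lam) ≤ ε := by
  rcases lt_or_ge 0 T with hT | hT
  swap
  · exact ⟨0, fun t μ E ξ η C L Z h => absurd (h.nonneg.trans_lt h.lt) (not_lt.2 hT)⟩
  obtain ⟨B, hB, hBall⟩ := exists_lintegral_speedKernel_bound hN hH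
  have hε2 : ε / 2 ≠ 0 := by simpa using hε
  -- Half of `ε` pays for the particles that start within `δ` of the charge, uniformly in its
  -- position.
  obtain ⟨δ, hδ, hδε⟩ : ∃ δ : ℝ, 0 < δ ∧ ∀ a : Space,
      N * volume (Metric.ball a δ ×ˢ Metric.ball (0 : Space) r) ≤ ε / 2 := by
    set D : ℝ≥0∞ := N * volume (Metric.ball (0 : Space) 1) * volume (Metric.ball (0 : Space) r)
    have hD : D ≠ ∞ := ENNReal.mul_ne_top (ENNReal.mul_ne_top hN measure_ball_lt_top.ne)
      measure_ball_lt_top.ne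
    have h1 : Tendsto (fun δ : ℝ => ENNReal.ofReal (δ ^ 3) * D) (𝓝[>] 0) (𝓝 0) := by
      have h2 : Tendsto (fun δ : ℝ => ENNReal.ofReal (δ ^ 3)) (𝓝[>] 0) (𝓝 0) := by
        have : Continuous fun δ : ℝ => ENNReal.ofReal (δ ^ 3) :=
          ENNReal.continuous_ofReal.comp (continuous_pow 3)
        simpa using (this.tendsto 0).mono_left nhdsWithin_le_nhds
      simpa using ENNReal.Tendsto.mul_const h2 (Or.inr hD)
    obtain ⟨δ, hδ, hδ0⟩ := ((h1.eventually (gt_mem_nhds (pos_iff_ne_zero.2 hε2))).and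
      self_mem_nhdsWithin).exists
    refine ⟨δ, hδ0, fun a => le_trans (le_of_eq ?_) hδ.le⟩
    rw [Measure.volume_eq_prod, Measure.prod_prod, Measure.addHaar_ball _ _ (le_of_lt hδ0),
      finrank_space]
    ring
  -- The other half pays, through Markov's inequality, for the particles with action at least `Q`.
  obtain ⟨Q, hQ, hQε⟩ : ∃ Q : ℝ, 0 < Q ∧ B * ENNReal.ofReal T / ENNReal.ofReal Q ≤ ε / 2 := by
    have hD : B * ENNReal.ofReal T / (ε / 2) ≠ ∞ :=
      ENNReal.div_ne_top (ENNReal.mul_ne_top hB ENNReal.ofReal_ne_top) hε2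
    refine ⟨(B * ENNReal.ofReal T / (ε / 2)).toReal + 1, by positivity, ?_⟩
    refine ENNReal.div_le_of_le_mul ?_
    rw [mul_comm (ε / 2)]
    refine (ENNReal.div_le_iff_le_mul (Or.inl hε2) (Or.inr ?_)).1 ?_
    · exact (ENNReal.ofReal_pos.2 (by positivity)).ne'
    · rw [ENNReal.le_ofReal_iff_toReal_le hD (by positivity)]
      linarith
  set A := speedBound T K r δ Q with hA
  have hA0 : 0 ≤ A := by rw [hA, speedBound]; positivity
  -- `r + A * T` bounds the position and `A` the velocity.
  refine ⟨r + A * T + A, fun t μ E ξ η C L Z h lam hlam => ?_⟩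
  have : IsFiniteMeasure μ := ⟨h.mass.trans_lt ENNReal.one_lt_top⟩
  obtain ⟨Γ, hΓ, hΓZ, hΓm⟩ := h.flow.exists_isPathFlow h.ne_top h.chargePath h.nonneg h.lt
  have hcomp : ∀ᵐ s, s ∈ Ioo t T → μ.map (Γ s) ≤ N • (volume : Measure Phase) := by
    filter_upwards [hΓm, h.compression] with s h1 h2 hs
    rw [← h1 hs]; exact h2 hs
  have hnear := (hΓ.measure_open_le h.lt hcomp
    (Metric.isOpen_ball.prod Metric.isOpen_ball)).trans (hδε (ξ t))
  have hfar : μ {z | ENNReal.ofReal Q ≤ fieldAction E t T Γ z} ≤ ε / 2 := by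
    refine (meas_ge_le_lintegral_div (measurable_fieldAction h.chargePath.measurable
      hΓ.measurable).aemeasurable (by simpa using hQ) ENNReal.ofReal_ne_top).trans
      (le_trans ?_ hQε)
    gcongr
    refine (h.lintegral_fieldAction_le hΓ hΓm hBall).trans ?_
    gcongr
    linarith [h.nonneg]
  have hsub : ∀ᵐ z ∂μ, z ∈ phaseBall r \ sublevel Z t T lam →
      z ∈ (Metric.ball (ξ t) δ ×ˢ Metric.ball (0 : Space) r) ∪
        {z | ENNReal.ofReal Q ≤ fieldAction E t T Γ z} := by
    filter_upwards [hΓ.trajectory, hΓZ] with z hz hZ hzm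
    by_contra hcon
    rw [mem_union, not_or] at hcon
    have hr1 : ‖z.1‖ ≤ r := (norm_fst_le_phaseNorm z).trans (le_of_lt hzm.1)
    have hr2 : ‖z.2‖ < r := (norm_snd_le_phaseNorm z).trans_lt hzm.1
    have hd : δ ≤ ‖z.1 - ξ t‖ := by
      by_contra hlt
      refine hcon.1 ⟨?_, by simpa using hr2⟩
      rw [Metric.mem_ball, dist_eq_norm]; exact not_le.1 hlt
    have hact : fieldAction E t T Γ z ≤ ENNReal.ofReal Q := (not_le.1 hcon.2).le
    refine hzm.2 ?_
    have hbd : ∀ s ∈ Icc t T, phaseNorm (Γ s z) ≤ lam := by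
      intro s hs
      have hv : ∀ s ∈ Icc t T, ‖(Γ s z).2‖ ≤ A := fun s hs =>
        hz.speed_le (r := r) (δ := δ) h.chargePath h.nonneg hK h.speed hQ.le hδ hact
          (by rw [hΓ.initial]; exact hr2.le) (by rw [hΓ.initial]; exact hd) hs
      refine (phaseNorm_trajectory_le (r := r) hz (by rw [hΓ.initial]; exact hr1) hA0 hv hs).trans ?_
      have : A * (T - t) ≤ A * T :=
        mul_le_mul_of_nonneg_left (by linarith [h.nonneg]) hA0
      linarith
    -- `Z` and `Γ` are compared on the open interval, while sublevels refer to the closed one.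
    have hne : ∀ᵐ s : ℝ, s ≠ t ∧ s ≠ T := by
      rw [eventually_and]
      constructor <;> simp [ae_iff, measure_singleton]
    change ∀ᵐ s ∂(volume.restrict (Icc t T)), phaseNorm (Z s z) ≤ lam
    rw [ae_restrict_iff' measurableSet_Icc]
    filter_upwards [hZ, hne] with s hs hsne hsI
    rw [hs ⟨lt_of_le_of_ne hsI.1 hsne.1.symm, lt_of_le_of_ne hsI.2 hsne.2⟩]
    exact hbd s hsI
  calc μ (phaseBall r \ sublevel Z t T lam)
      ≤ μ ((Metric.ball (ξ t) δ ×ˢ Metric.ball (0 : Space) r) ∪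
        {z | ENNReal.ofReal Q ≤ fieldAction E t T Γ z}) := measure_mono_ae hsub
    _ ≤ ε / 2 + ε / 2 := (measure_union_le _ _).trans (add_le_add hnear hfar)
    _ = ε := ENNReal.add_halves ε

end VPCharge

namespace VPCharge

/-! ### Densities -/

variable {f : Phase → ℝ}

theorem densityMeasure_univ (f : Phase → ℝ) : densityMeasure f univ = totalCharge f := by
  rw [densityMeasure, withDensity_apply _ MeasurableSet.univ, Measure.restrict_univ, totalCharge]

theorem spatialDensity_nonneg (hf : ∀ z, 0 ≤ f z) (x : Space) : 0 ≤ spatialDensity f x :=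
  integral_nonneg fun v => hf (x, v)

theorem measurable_spatialDensity (hf : Measurable f) : Measurable (spatialDensity f) :=
  (StronglyMeasurable.integral_prod_right' hf.stronglyMeasurable).measurable

/-- The Bochner integral in `spatialDensity` is zero where the velocity integral diverges. Finite
total charge makes that set of positions null. -/
theorem map_fst_densityMeasure (hf : Measurable f) (hf0 : ∀ z, 0 ≤ f z) (hc : totalCharge f ≠ ∞) :
    (densityMeasure f).map Prod.fst =
      volume.withDensity fun x => ENNReal.ofReal (spatialDensity f x) := by
  have hm : Measurable fun z => ENNReal.ofReal (f z) := hf.ennreal_ofReal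
  have hae : ∀ᵐ x : Space, ∫⁻ v, ENNReal.ofReal (f (x, v)) = ENNReal.ofReal (spatialDensity f x) := by
    have h1 : ∫⁻ x : Space, ∫⁻ v : Space, ENNReal.ofReal (f (x, v)) ≠ ∞ := by
      rw [totalCharge, Measure.volume_eq_prod, lintegral_prod _ hm.aemeasurable] at hc
      exact hc
    have h2 : ∀ᵐ x : Space, ∫⁻ v : Space, ENNReal.ofReal (f (x, v)) < ∞ :=
      ae_lt_top (Measurable.lintegral_prod_right' hm) h1
    filter_upwards [h2] with x hx
    have hfx : Measurable fun v => f (x, v) := hf.comp measurable_prodMk_left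
    have hi : Integrable fun v => f (x, v) :=
      ⟨hfx.aestronglyMeasurable, (hasFiniteIntegral_iff_ofReal
        (Eventually.of_forall fun v => hf0 (x, v))).2 hx⟩
    exact (ofReal_integral_eq_lintegral_ofReal hi (Eventually.of_forall fun v => hf0 (x, v))).symm
  ext S hS
  rw [Measure.map_apply measurable_fst hS, densityMeasure, withDensity_apply _ (measurable_fst hS),
    withDensity_apply _ hS, ← prod_univ, Measure.volume_eq_prod,
    ← Measure.prod_restrict, lintegral_prod _ hm.aemeasurable, Measure.restrict_univ]
  exact lintegral_congr_ae (ae_restrict_of_ae hae)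

theorem lintegral_fst_densityMeasure (hf : Measurable f) (hf0 : ∀ z, 0 ≤ f z)
    (hc : totalCharge f ≠ ∞) {g : Space → ℝ≥0∞} (hg : Measurable g) :
    ∫⁻ z, g z.1 ∂(densityMeasure f) = ∫⁻ x, ENNReal.ofReal (spatialDensity f x) * g x := by
  rw [← lintegral_map hg measurable_fst, map_fst_densityMeasure hf hf0 hc,
    lintegral_withDensity_eq_lintegral_mul _ (measurable_spatialDensity hf).ennreal_ofReal hg]
  rfl

theorem integral_coulomb_densityMeasure (hf : Measurable f) (hf0 : ∀ z, 0 ≤ f z)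
    (hc : totalCharge f ≠ ∞) (x : Space) :
    ∫ z : Phase, coulomb (x - z.1) ∂(densityMeasure f) = selfField f x := by
  have hm : Measurable fun y => coulomb (x - y) :=
    measurable_coulomb.comp (measurable_const.sub measurable_id)
  have h1 := integral_map (μ := densityMeasure f) measurable_fst.aemeasurable
    (f := fun y => coulomb (x - y)) hm.aestronglyMeasurable
  rw [← h1, map_fst_densityMeasure hf hf0 hc, integral_withDensity_eq_integral_toReal_smul
    (measurable_spatialDensity hf).ennreal_ofReal (Eventually.of_forall fun _ =>
      ENNReal.ofReal_lt_top)]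
  simp only [ENNReal.toReal_ofReal (spatialDensity_nonneg hf0 _), selfField]

theorem densityMeasure_le_eLpNorm (f : Phase → ℝ) :
    densityMeasure f ≤ eLpNorm f ∞ volume • (volume : Measure Phase) := by
  rw [densityMeasure, ← withDensity_const]
  refine withDensity_mono ?_
  rw [eLpNorm_exponent_top]
  filter_upwards [enorm_ae_le_eLpNormEssSup f volume] with z hz
  exact (Real.ofReal_le_enorm _).trans hz

theorem eLpNorm_le_of_densityMeasure_le (hf : Measurable f) (hf0 : ∀ z, 0 ≤ f z) {L : ℝ≥0∞}
    (h : densityMeasure f ≤ L • (volume : Measure Phase)) : eLpNorm f ∞ volume ≤ L := by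
  rw [densityMeasure, ← withDensity_const] at h
  have h1 : (fun z => ENNReal.ofReal (f z)) ≤ᵐ[volume] fun _ => L := by
    refine ae_le_of_forall_setLIntegral_le_of_sigmaFinite hf.ennreal_ofReal fun S hS _ => ?_
    have := h S
    rwa [withDensity_apply _ hS, withDensity_apply _ hS] at this
  rw [eLpNorm_exponent_top]
  refine essSup_le_of_ae_le _ ?_
  filter_upwards [h1] with z hz
  rwa [Real.enorm_of_nonneg (hf0 z)]

theorem measurable_selfField {F : ℝ → Phase → ℝ} (hF : Measurable (Function.uncurry F)) :
    Measurable fun p : ℝ × Space => selfField (F p.1) p.2 := by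
  have h1 : Measurable fun p : (ℝ × Space) × Space => F p.1.1 (p.1.2, p.2) :=
    hF.comp (measurable_fst.fst.prodMk (measurable_fst.snd.prodMk measurable_snd))
  have h2 : Measurable fun p : ℝ × Space => spatialDensity (F p.1) p.2 :=
    (h1.stronglyMeasurable.integral_prod_right' (ν := (volume : Measure Space))).measurable
  have h3 : Measurable fun p : (ℝ × Space) × Space =>
      spatialDensity (F p.1.1) p.2 • coulomb (p.1.2 - p.2) :=
    (h2.comp (measurable_fst.fst.prodMk measurable_snd)).smul
      (measurable_coulomb.comp (measurable_fst.snd.sub measurable_snd))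
  exact (h3.stronglyMeasurable.integral_prod_right' (ν := (volume : Measure Space))).measurable

/-! ### The energy of the initial data -/

theorem integrable_of_lintegral_ofReal {α : Type*} [MeasurableSpace α] {μ : Measure α}
    {g : α → ℝ} (hg : Measurable g) (h0 : ∀ x, 0 ≤ g x)
    (h : ∫⁻ x, ENNReal.ofReal (g x) ∂μ ≠ ∞) : Integrable g μ :=
  ⟨hg.aestronglyMeasurable,
    (hasFiniteIntegral_iff_ofReal (Eventually.of_forall h0)).2 h.lt_top⟩

theorem lintegral_kinetic (hf : Measurable f) (hf0 : ∀ z, 0 ≤ f z) :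
    ∫⁻ z : Phase, ENNReal.ofReal (‖z.2‖ ^ 2 / 2) ∂(densityMeasure f) =
      ∫⁻ z : Phase, ENNReal.ofReal (‖z.2‖ ^ 2 / 2 * f z) := by
  rw [densityMeasure, lintegral_withDensity_eq_lintegral_mul _ hf.ennreal_ofReal (by fun_prop)]
  refine lintegral_congr fun z => ?_
  rw [Pi.mul_apply, mul_comm (‖z.2‖ ^ 2 / 2), ENNReal.ofReal_mul (hf0 z)]

theorem lintegral_potential (hf : Measurable f) (hf0 : ∀ z, 0 ≤ f z) (hc : totalCharge f ≠ ∞)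
    (ξ : Space) : ∫⁻ z : Phase, ENNReal.ofReal ‖z.1 - ξ‖⁻¹ ∂(densityMeasure f) =
      ∫⁻ x : Space, ENNReal.ofReal (spatialDensity f x / ‖x - ξ‖) := by
  rw [lintegral_fst_densityMeasure hf hf0 hc (g := fun x => ENNReal.ofReal ‖x - ξ‖⁻¹) (by fun_prop)]
  refine lintegral_congr fun x => ?_
  rw [← ENNReal.ofReal_mul (spatialDensity_nonneg hf0 x), div_eq_mul_inv]

theorem lintegral_interaction (hf : Measurable f) (hf0 : ∀ z, 0 ≤ f z) (hc : totalCharge f ≠ ∞) :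
    ∫⁻ p : Phase × Phase, ENNReal.ofReal ‖p.1.1 - p.2.1‖⁻¹
        ∂((densityMeasure f).prod (densityMeasure f)) =
      ∫⁻ x : Space, ∫⁻ y : Space,
        ENNReal.ofReal (spatialDensity f x * spatialDensity f y / ‖x - y‖) := by
  have : IsFiniteMeasure (densityMeasure f) := ⟨by rw [densityMeasure_univ]; exact hc.lt_top⟩
  have hm : Measurable fun p : Phase × Phase => ENNReal.ofReal ‖p.1.1 - p.2.1‖⁻¹ := by fun_prop
  have hm2 : Measurable fun p : Space × Space =>
      ENNReal.ofReal (spatialDensity f p.2) * ENNReal.ofReal ‖p.1 - p.2‖⁻¹ :=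
    ((measurable_spatialDensity hf).comp measurable_snd).ennreal_ofReal.mul (by fun_prop)
  rw [lintegral_prod _ hm.aemeasurable]
  have h1 : ∀ z : Phase, ∫⁻ z' : Phase, ENNReal.ofReal ‖z.1 - z'.1‖⁻¹ ∂(densityMeasure f) =
      ∫⁻ y : Space, ENNReal.ofReal (spatialDensity f y) * ENNReal.ofReal ‖z.1 - y‖⁻¹ := fun z =>
    lintegral_fst_densityMeasure hf hf0 hc (g := fun y => ENNReal.ofReal ‖z.1 - y‖⁻¹) (by fun_prop)
  simp only [h1]
  rw [lintegral_fst_densityMeasure hf hf0 hc (g := fun x => ∫⁻ y : Space,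
    ENNReal.ofReal (spatialDensity f y) * ENNReal.ofReal ‖x - y‖⁻¹)
    (Measurable.lintegral_prod_right' hm2)]
  refine lintegral_congr fun x => ?_
  rw [← lintegral_const_mul' _ _ ENNReal.ofReal_ne_top]
  refine lintegral_congr fun y => ?_
  rw [← ENNReal.ofReal_mul (spatialDensity_nonneg hf0 y),
    ← ENNReal.ofReal_mul (spatialDensity_nonneg hf0 x), div_eq_mul_inv, mul_assoc]

theorem integrable_energy (hf : Measurable f) (hf0 : ∀ z, 0 ≤ f z) (hc : totalCharge f ≠ ∞)
    {ξ η : Space} (hE : totalEnergy f ξ η ≠ ∞) :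
    Integrable (fun z : Phase => ‖z.2‖ ^ 2 / 2) (densityMeasure f) ∧
    Integrable (fun z : Phase => ‖z.1 - ξ‖⁻¹) (densityMeasure f) ∧
    Integrable (fun p : Phase × Phase => ‖p.1.1 - p.2.1‖⁻¹)
      ((densityMeasure f).prod (densityMeasure f)) ∧
    ∫ z : Phase, ‖z.2‖ ^ 2 / 2 ∂(densityMeasure f) + ‖η‖ ^ 2 / 2 +
      (1 / 2) * ∫ p : Phase × Phase, ‖p.1.1 - p.2.1‖⁻¹
        ∂((densityMeasure f).prod (densityMeasure f)) +
      ∫ z : Phase, ‖z.1 - ξ‖⁻¹ ∂(densityMeasure f) = (totalEnergy f ξ η).toReal := by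
  rw [totalEnergy, ← lintegral_kinetic hf hf0, ← lintegral_interaction hf hf0 hc,
    ← lintegral_potential hf hf0 hc] at hE ⊢
  obtain ⟨h123, h4⟩ := ENNReal.add_ne_top.1 hE
  obtain ⟨h12, h3⟩ := ENNReal.add_ne_top.1 h123
  obtain ⟨h1, -⟩ := ENNReal.add_ne_top.1 h12
  have h3' : ∫⁻ p : Phase × Phase, ENNReal.ofReal ‖p.1.1 - p.2.1‖⁻¹
      ∂((densityMeasure f).prod (densityMeasure f)) ≠ ∞ := by
    intro h
    rw [h, ENNReal.mul_top (by simp)] at h3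
    exact h3 rfl
  have i1 := integrable_of_lintegral_ofReal (by fun_prop) (fun z : Phase => by positivity) h1
  have i4 := integrable_of_lintegral_ofReal (by fun_prop) (fun z : Phase => by positivity) h4
  have i3 := integrable_of_lintegral_ofReal (by fun_prop) (fun z : Phase × Phase => by positivity)
    h3'
  refine ⟨i1, i4, i3, ?_⟩
  rw [ENNReal.toReal_add h123 h4, ENNReal.toReal_add h12 h3,
    ENNReal.toReal_add h1 ENNReal.ofReal_ne_top, ENNReal.toReal_mul,
    ENNReal.toReal_ofReal (by positivity),
    integral_eq_lintegral_of_nonneg_ae (Eventually.of_forall fun z => by positivity)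
      i1.aestronglyMeasurable,
    integral_eq_lintegral_of_nonneg_ae (Eventually.of_forall fun z => by positivity)
      i3.aestronglyMeasurable,
    integral_eq_lintegral_of_nonneg_ae (Eventually.of_forall fun z => by positivity)
      i4.aestronglyMeasurable]
  simp

end VPCharge

/-! ### From Lagrangian solutions to self-consistent families -/

namespace VPCharge

variable {T : ℝ} {f₀ : Phase → ℝ} {ξ₀ η₀ : Space} {f : ℝ → Phase → ℝ} {ξ η : ℝ → Space}

theorem totalCharge_eq_of_transported {s : ℝ} {Y : Phase → Phase} (hY : Measurable Y)
    (h : (densityMeasure f₀).map Y = densityMeasure (f s)) :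
    totalCharge (f s) = totalCharge f₀ := by
  rw [← densityMeasure_univ, ← h, Measure.map_apply hY MeasurableSet.univ, preimage_univ,
    densityMeasure_univ]

/-- The self-induced field at the times of a set `G`, and zero at the other times. -/
noncomputable def fieldOn (G : Set ℝ) (f : ℝ → Phase → ℝ) (s : ℝ) (x : Space) : Space :=
  G.indicator (fun s => selfField (f s) x) s

theorem fieldOn_of_mem {G : Set ℝ} {s : ℝ} (hs : s ∈ G) (x : Space) :
    fieldOn G f s x = selfField (f s) x := indicator_of_mem hs _

theorem measurable_fieldOn {G : Set ℝ} (hG : MeasurableSet G)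
    (hf : Measurable (Function.uncurry f)) : Measurable (Function.uncurry (fieldOn G f)) := by
  have h := (measurable_selfField hf).indicator (measurable_fst hG)
  exact h

/-- A function on `[0, T]`, extended by its values at the endpoints. -/
noncomputable def extendPath (hT : 0 ≤ T) (x : ℝ → Space) : ℝ → Space :=
  IccExtend hT ((Icc 0 T).domRestrict x)

theorem extendPath_of_mem (hT : 0 ≤ T) (x : ℝ → Space) {s : ℝ} (hs : s ∈ Icc 0 T) :
    extendPath hT x s = x s := by
  rw [extendPath, IccExtend_of_mem hT _ hs, domRestrict_apply]

theorem continuous_extendPath (hT : 0 ≤ T) {x : ℝ → Space} (hx : ContinuousOn x (Icc 0 T)) :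
    Continuous (extendPath hT x) :=
  (continuousOn_iff_continuous_domRestrict.1 hx).Icc_extend'

/-- The field is bounded only at the times of `G`; setting it to zero elsewhere makes the bound hold
everywhere. The equations of the charge survive in integrated form, since almost every time is in
`G`. -/
theorem IsLagrangianSolution.isChargePath (h : IsLagrangianSolution T f₀ ξ₀ η₀ f ξ η)
    (hT : 0 ≤ T) {G : Set ℝ} (hG : MeasurableSet G) {C : ℝ} (hC0 : 0 ≤ C)
    (hGC : ∀ s ∈ G, ∀ x, ‖selfField (f s) x‖ ≤ C)
    (hGae : ∀ᵐ s, s ∈ Icc 0 T → s ∈ G) :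
    IsChargePath (fieldOn G f) (extendPath hT ξ) (extendPath hT η) C T := by
  have hξc : Continuous (extendPath hT ξ) :=
    continuous_extendPath hT fun s hs => (h.position s hs).continuousWithinAt
  have hηc : Continuous (extendPath hT η) :=
    continuous_extendPath hT fun s hs => (h.velocity s hs).continuousWithinAt
  have hm := measurable_fieldOn hG h.measurable
  have hb : ∀ s x, ‖fieldOn G f s x‖ ≤ C := by
    intro s x
    by_cases hs : s ∈ G
    · rw [fieldOn_of_mem hs]; exact hGC s hs x
    · rw [fieldOn, indicator_of_notMem hs, norm_zero]; exact hC0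
  refine ⟨hm, hb, hξc, hηc, fun s hs => ?_, fun s hs => ?_⟩
  · have h0 : (0 : ℝ) ∈ Icc 0 T := ⟨le_rfl, hT⟩
    have e := intervalIntegral.integral_eq_sub_of_hasDerivAt_of_le (f := ξ)
      (f' := extendPath hT η) hs.1
      (fun τ hτ => ((h.position τ ⟨hτ.1, hτ.2.trans hs.2⟩).continuousWithinAt).mono
        (Icc_subset_Icc_right hs.2)) (fun τ hτ => ?_) (hηc.intervalIntegrable _ _)
    · rw [extendPath_of_mem hT ξ hs, extendPath_of_mem hT ξ h0, e]; abel
    · have hτ' : τ ∈ Ioo 0 T := ⟨hτ.1, hτ.2.trans_le hs.2⟩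
      rw [extendPath_of_mem hT η (Ioo_subset_Icc_self hτ')]
      exact (h.position τ (Ioo_subset_Icc_self hτ')).hasDerivAt (Icc_mem_nhds hτ'.1 hτ'.2)
  · have h0 : (0 : ℝ) ∈ Icc 0 T := ⟨le_rfl, hT⟩
    have hae : ∀ᵐ τ, τ ∈ Ioc 0 s →
        fieldOn G f τ (extendPath hT ξ τ) = selfField (f τ) (ξ τ) := by
      filter_upwards [hGae] with τ hτ hτs
      have hτ' : τ ∈ Icc 0 T := ⟨hτs.1.le, hτs.2.trans hs.2⟩
      rw [fieldOn_of_mem (hτ hτ'), extendPath_of_mem hT ξ hτ']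
    have hii : IntervalIntegrable (fun τ => fieldOn G f τ (extendPath hT ξ τ)) volume 0 s := by
      rw [intervalIntegrable_iff]
      exact IntegrableOn.of_bound (by rw [uIoc]; exact measure_Ioc_lt_top)
        (hm.comp (measurable_id.prodMk hξc.measurable)).aestronglyMeasurable C
        (Eventually.of_forall fun τ => hb τ _)
    have hii' : IntervalIntegrable (fun τ => selfField (f τ) (ξ τ)) volume 0 s := by
      refine hii.congr_ae ?_
      rw [uIoc_of_le hs.1]
      exact (ae_restrict_iff' measurableSet_Ioc).2 hae
    have e := intervalIntegral.integral_eq_sub_of_hasDerivAt_of_le (f := η)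
      (f' := fun τ => selfField (f τ) (ξ τ)) hs.1
      (fun τ hτ => ((h.velocity τ ⟨hτ.1, hτ.2.trans hs.2⟩).continuousWithinAt).mono
        (Icc_subset_Icc_right hs.2)) (fun τ hτ => ?_) hii'
    · have e2 : ∫ τ in (0 : ℝ)..s, fieldOn G f τ (extendPath hT ξ τ) =
          ∫ τ in (0 : ℝ)..s, selfField (f τ) (ξ τ) := by
        refine intervalIntegral.integral_congr_ae ?_
        rw [uIoc_of_le hs.1]
        exact hae
      rw [e2, e, extendPath_of_mem hT η hs, extendPath_of_mem hT η h0]; abel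
    · have hτ' : τ ∈ Ioo 0 T := ⟨hτ.1, hτ.2.trans_le hs.2⟩
      exact (h.velocity τ (Ioo_subset_Icc_self hτ')).hasDerivAt (Icc_mem_nhds hτ'.1 hτ'.2)

theorem IsRegularLagrangianFlow.fieldOn {μ : Measure Phase} {L : ℝ≥0∞} {t : ℝ}
    {Z : ℝ → Phase → Phase} (h : IsRegularLagrangianFlow μ L (vectorField f ξ) t T Z)
    (hT : 0 ≤ T) (ht : 0 ≤ t) {G : Set ℝ} (hGae : ∀ᵐ s, s ∈ Icc 0 T → s ∈ G) :
    IsRegularLagrangianFlow μ L (drift (fieldOn G f) (extendPath hT ξ)) t T Z := by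
  refine h.congr_field ?_
  filter_upwards [hGae] with s hs hst
  have hs' : s ∈ Icc 0 T := ⟨ht.trans hst.1.le, hst.2.le⟩
  funext z
  simp only [vectorField, drift]
  rw [fieldOn_of_mem (hs hs'), extendPath_of_mem hT ξ hs']

theorem IsLagrangianSolution.exists_good_times (h : IsLagrangianSolution T f₀ ξ₀ η₀ f ξ η) :
    ∃ (α C : ℝ) (G : Set ℝ), 0 < α ∧ 0 ≤ C ∧ MeasurableSet G ∧
      (∀ᵐ s, s ∈ Icc 0 T → s ∈ G) ∧ ∀ s ∈ G, (∀ x, ‖selfField (f s) x‖ ≤ C) ∧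
      ∀ x y, ‖selfField (f s) x - selfField (f s) y‖ ≤ C * ‖x - y‖ ^ α := by
  obtain ⟨α, hα, -, C, hC⟩ := h.field_holder
  obtain ⟨G, hG, hGm, hGC⟩ := hC.exists_measurable_mem
  refine ⟨α, |C|, G, hα, abs_nonneg C, hGm, (ae_restrict_iff' measurableSet_Icc).1 hG,
    fun s hs => ⟨fun x => ((hGC s hs).1 x).trans (le_abs_self C), fun x y => ?_⟩⟩
  refine ((hGC s hs).2 x y).trans ?_
  gcongr
  exact le_abs_self C

/-- A Lagrangian solution is generated by a self-consistent family of characteristics. -/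
theorem IsLagrangianSolution.exists_isSelfConsistent (h : IsLagrangianSolution T f₀ ξ₀ η₀ f ξ η)
    (hT : 0 < T) (hf₀ : Measurable f₀) (hf₀0 : ∀ z, 0 ≤ f₀ z) (hM : totalCharge f₀ < 1)
    (hH : totalEnergy f₀ ξ₀ η₀ < ∞) :
    ∃ (C : ℝ) (G : Set ℝ) (Γ : ℝ → Phase → Phase) (B : ℝ≥0∞),
      (∀ᵐ s, s ∈ Icc 0 T → s ∈ G) ∧
      (∀ᵐ s, s ∈ Ioo 0 T → (densityMeasure f₀).map (Γ s) = densityMeasure (f s)) ∧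
      IsSelfConsistent (fieldOn G f) (extendPath hT.le ξ) (extendPath hT.le η) C T
        (densityMeasure f₀) Γ B := by
  have : IsFiniteMeasure (densityMeasure f₀) :=
    ⟨by rw [densityMeasure_univ]; exact hM.trans ENNReal.one_lt_top⟩
  have hc : totalCharge f₀ ≠ ∞ := (hM.trans ENNReal.one_lt_top).ne
  obtain ⟨α, C, G, hα, hC0, hGm, hGae, hGC⟩ := h.exists_good_times
  obtain ⟨L, Y, hL, hY, hYf⟩ := h.transported
  have hcp := h.isChargePath hT.le hGm hC0 (fun s hs => (hGC s hs).1) hGae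
  obtain ⟨Γ, hΓ, -, hΓm⟩ := (hY.fieldOn hT.le le_rfl hGae).exists_isPathFlow hL hcp le_rfl hT
  -- The mass bound `1` is available because transport preserves the total charge.
  obtain ⟨B, hB, hBall⟩ := exists_lintegral_inv_sq_bound (C := C) hα 1 ENNReal.one_ne_top
  have h0 : (0 : ℝ) ∈ Icc 0 T := ⟨le_rfl, hT.le⟩
  have e0 : extendPath hT.le ξ 0 = ξ₀ := by rw [extendPath_of_mem _ _ h0, h.initial_position]
  obtain ⟨i1, i2, i3, -⟩ := integrable_energy hf₀ hf₀0 hc hH.ne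
  have htr : ∀ᵐ s, s ∈ Ioo 0 T → (densityMeasure f₀).map (Γ s) = densityMeasure (f s) := by
    filter_upwards [hΓm] with s hs hsT
    rw [← hs hsT, hYf s (Ioo_subset_Icc_self hsT)]
  have hms : ∀ s, Measurable (Γ s) := fun s => hΓ.measurable.of_uncurry_left
  have hfs : ∀ s, Measurable (f s) := fun s => h.measurable.of_uncurry_left
  refine ⟨C, G, Γ, B, hGae, htr, hΓ, hcp, hT, ?_, e0 ▸ i2, i3, hB, ?_, ?_⟩
  · refine (i1.const_mul 2).congr (Eventually.of_forall fun z => ?_)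
    simp only
    ring
  · filter_upwards [htr, hGae] with s hs hsG hsT x
    have hsc : totalCharge (f s) = totalCharge f₀ := totalCharge_eq_of_transported (hms s) (hs hsT)
    have hg : Measurable fun y : Space => (‖y - x‖ₑ ^ 2)⁻¹ := measurable_inv_enorm_sq_sub x
    have e1 := lintegral_map (μ := densityMeasure f₀) (hg.comp measurable_fst) (hms s)
    refine (le_of_eq e1.symm).trans ?_
    rw [hs hsT]
    refine (le_of_eq (lintegral_fst_densityMeasure (hfs s) (h.nonneg s) (hsc ▸ hc) hg)).trans ?_
    refine hBall _ (measurable_spatialDensity (hfs s)) (spatialDensity_nonneg (h.nonneg s)) ?_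
      (hGC s (hsG (Ioo_subset_Icc_self hsT))).2 x
    have e2 := lintegral_fst_densityMeasure (hfs s) (h.nonneg s) (hsc ▸ hc)
      (g := fun _ => 1) measurable_const
    simp only [mul_one, lintegral_one] at e2
    rw [← e2, densityMeasure_univ, hsc]
    exact hM.le
  · filter_upwards [htr, hGae] with s hs hsG hsT x
    have hsc : totalCharge (f s) = totalCharge f₀ := totalCharge_eq_of_transported (hms s) (hs hsT)
    have hg : Measurable fun z : Phase => coulomb (x - z.1) :=
      measurable_coulomb.comp (measurable_const.sub measurable_fst)
    rw [fieldOn_of_mem (hsG (Ioo_subset_Icc_self hsT)),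
      ← integral_coulomb_densityMeasure (hfs s) (h.nonneg s) (hsc ▸ hc), ← hs hsT]
    exact integral_map (hms s).aemeasurable hg.aestronglyMeasurable

end VPCharge

/-! ### Control by the density bound and the initial energy -/

namespace VPCharge

variable {T : ℝ} {f₀ : Phase → ℝ} {ξ₀ η₀ : Space} {f : ℝ → Phase → ℝ} {ξ η : ℝ → Space}

/-- The flow that transports the solution has a finite compression constant, which bounds the
density at every time. -/
theorem IsLagrangianSolution.densityNorm_lt_top (h : IsLagrangianSolution T f₀ ξ₀ η₀ f ξ η) :
    densityNorm T f < ∞ := by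
  obtain ⟨L, Y, hL, hY, hYf⟩ := h.transported
  refine lt_of_le_of_lt ?_ hL.lt_top
  refine essSup_le_of_ae_le _ ((ae_restrict_iff' measurableSet_Icc).2
    (Eventually.of_forall fun s hs => ?_))
  refine eLpNorm_le_of_densityMeasure_le h.measurable.of_uncurry_left (h.nonneg s) ?_
  rw [← hYf s hs]
  exact hY.compression s hs

theorem ae_densityMeasure_le (T : ℝ) (f : ℝ → Phase → ℝ) :
    ∀ᵐ s, s ∈ Icc 0 T → densityMeasure (f s) ≤ densityNorm T f • (volume : Measure Phase) := by
  have h1 : ∀ᵐ s ∂(volume.restrict (Icc 0 T)), eLpNorm (f s) ∞ volume ≤ densityNorm T f :=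
    ENNReal.ae_le_essSup _
  filter_upwards [(ae_restrict_iff' measurableSet_Icc).1 h1] with s hs hsT
  refine (densityMeasure_le_eLpNorm (f s)).trans fun S => ?_
  simp only [Measure.smul_apply, smul_eq_mul]
  gcongr
  exact hs hsT

/-- `(1 + a)² ≤ 2 + 4 (a²/2)`, and the mass is at most one. -/
theorem lintegral_sq_le {μ : Measure Phase} (hμ : μ univ ≤ 1) {V : Phase → Space}
    (hV : Integrable (fun z => ‖V z‖ ^ 2) μ) {H : ℝ≥0∞}
    (hle : ∫ z, ‖V z‖ ^ 2 / 2 ∂μ ≤ H.toReal) :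
    ∫⁻ z, ENNReal.ofReal ((1 + ‖V z‖) ^ 2) ∂μ ≤ 2 + 4 * H := by
  have h1 : ∀ z, ENNReal.ofReal ((1 + ‖V z‖) ^ 2) ≤
      2 + 4 * ENNReal.ofReal (‖V z‖ ^ 2 / 2) := by
    intro z
    generalize ‖V z‖ = a
    rw [show (4 : ℝ≥0∞) = ENNReal.ofReal 4 by simp, show (2 : ℝ≥0∞) = ENNReal.ofReal 2 by simp,
      ← ENNReal.ofReal_mul (by norm_num), ← ENNReal.ofReal_add (by norm_num) (by positivity)]
    exact ENNReal.ofReal_le_ofReal (by nlinarith [sq_nonneg (a - 1)])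
  refine (lintegral_mono h1).trans ?_
  rw [lintegral_add_left measurable_const, lintegral_const, lintegral_const_mul' _ _ (by simp),
    ← ofReal_integral_eq_lintegral_ofReal (hV.div_const 2)
      (Eventually.of_forall fun z => by positivity)]
  gcongr
  · exact mul_le_of_le_one_right' hμ
  · exact (ENNReal.ofReal_le_ofReal hle).trans ENNReal.ofReal_toReal_le

/-- A flow of the field of a Lagrangian solution is controlled by the density bound, the
compression and the initial energy. -/
theorem IsLagrangianSolution.exists_isControlledFlow
    (h : IsLagrangianSolution T f₀ ξ₀ η₀ f ξ η) (hf₀ : Measurable f₀) (hf₀0 : ∀ z, 0 ≤ f₀ z)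
    (hM : totalCharge f₀ < 1) (hH : totalEnergy f₀ ξ₀ η₀ < ∞) {t : ℝ} {L N : ℝ≥0∞}
    {Z : ℝ → Phase → Phase} (ht : 0 ≤ t) (htT : t < T) (hL : L ≠ ∞)
    (hZ : IsRegularLagrangianFlow (densityMeasure f₀) L (vectorField f ξ) t T Z)
    (hN : densityNorm T f ≤ N)
    (hZN : ∀ᵐ s, s ∈ Ioo t T →
      (densityMeasure f₀).map (Z s) ≤ N • (volume : Measure Phase)) :
    ∃ (E : ℝ → Space → Space) (ξ' η' : ℝ → Space) (C : ℝ),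
      IsControlledFlow N (2 + 4 * totalEnergy f₀ ξ₀ η₀)
        (√(2 * (totalEnergy f₀ ξ₀ η₀).toReal) + 1) t T (densityMeasure f₀) E ξ' η' C L Z := by
  have hT : 0 < T := ht.trans_lt htT
  have hμ1 : densityMeasure f₀ univ ≤ 1 := by rw [densityMeasure_univ]; exact hM.le
  have : IsFiniteMeasure (densityMeasure f₀) := ⟨hμ1.trans_lt ENNReal.one_lt_top⟩
  have hc : totalCharge f₀ ≠ ∞ := (hM.trans ENNReal.one_lt_top).ne
  obtain ⟨C, G, Γ, B, hG, htr, hsc⟩ := h.exists_isSelfConsistent hT hf₀ hf₀0 hM hH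
  have h0 : (0 : ℝ) ∈ Icc 0 T := ⟨le_rfl, hT.le⟩
  have hen : ∀ s ∈ Icc 0 T, ∫ z, ‖(Γ s z).2‖ ^ 2 / 2 ∂(densityMeasure f₀) +
      ‖extendPath hT.le η s‖ ^ 2 / 2 ≤ (totalEnergy f₀ ξ₀ η₀).toReal := by
    intro s hs
    have h1 := hsc.energy_le hs
    rw [extendPath_of_mem hT.le η h0, extendPath_of_mem hT.le ξ h0, h.initial_position,
      h.initial_velocity] at h1
    rwa [(integrable_energy hf₀ hf₀0 hc hH.ne).2.2.2] at h1
  refine ⟨fieldOn G f, extendPath hT.le ξ, extendPath hT.le η, C, hZ.fieldOn hT.le ht hG, hL,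
    hsc.chargePath, ht, htT, hμ1, fun s hs => ?_, hZN, ?_⟩
  -- The energy inequality bounds the speed of the charge by `√(2H)`, which is the reason for the
  -- choice of `K`.
  · rw [add_sub_cancel_right]
    refine Real.le_sqrt_of_sq_le ?_
    have h1 : 0 ≤ ∫ z, ‖(Γ s z).2‖ ^ 2 / 2 ∂(densityMeasure f₀) :=
      integral_nonneg fun z => by positivity
    linarith [hen s hs]
  · filter_upwards [htr, hsc.field_eq, ae_densityMeasure_le T f] with s hs hE hd hst
    have hsT : s ∈ Ioo 0 T := ⟨ht.trans_lt hst.1, hst.2⟩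
    have hms : Measurable (Γ s) := hsc.pathFlow.measurable.of_uncurry_left
    refine ⟨densityMeasure (f s), (hd (Ioo_subset_Icc_self hsT)).trans fun S => ?_, ?_, ?_,
      fun x => ?_⟩
    · simp only [Measure.smul_apply, smul_eq_mul]
      gcongr
    · rw [← hs hsT, Measure.map_apply hms MeasurableSet.univ]; exact hμ1
    · have hm : Measurable fun y : Phase => ENNReal.ofReal ((1 + ‖y.2‖) ^ 2) := by fun_prop
      rw [← hs hsT, lintegral_map hm hms]
      refine lintegral_sq_le hμ1 (hsc.integrable_norm_sq (Ioo_subset_Icc_self hsT)) ?_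
      have := hen s (Ioo_subset_Icc_self hsT)
      have h2 : 0 ≤ ‖extendPath hT.le η s‖ ^ 2 / 2 := by positivity
      linarith
    · have hm : Measurable fun y : Phase => (‖x - y.1‖ₑ ^ 2)⁻¹ :=
        measurable_inv_enorm_sq.comp (measurable_const.sub measurable_fst)
      rw [hE hsT x, ← hs hsT, lintegral_map hm hms]
      exact (enorm_integral_le_lintegral_enorm _).trans
        (lintegral_mono fun z => enorm_coulomb_le _)

/-! ### The modulus of escape -/

/-- The mass in the ball `B_r` that leaves `G_lam`, for some Lagrangian solution and some flow of
its field with density and compression at most `N` and with initial energy `H`. -/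
def escapeMasses (T : ℝ) (N H : ℝ≥0∞) (r lam : ℝ) : Set ℝ≥0∞ :=
  {m | ∃ (t : ℝ) (L : ℝ≥0∞) (f₀ : Phase → ℝ) (ξ₀ η₀ : Space) (f : ℝ → Phase → ℝ)
    (ξ η : ℝ → Space) (Z : ℝ → Phase → Phase), 0 ≤ t ∧ t < T ∧ Measurable f₀ ∧ (∀ z, 0 ≤ f₀ z) ∧
    totalCharge f₀ < 1 ∧ totalEnergy f₀ ξ₀ η₀ < ∞ ∧ totalEnergy f₀ ξ₀ η₀ = H ∧
    IsLagrangianSolution T f₀ ξ₀ η₀ f ξ η ∧ L ≠ ∞ ∧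
    IsRegularLagrangianFlow (densityMeasure f₀) L (vectorField f ξ) t T Z ∧
    densityNorm T f ≤ N ∧
    (∀ᵐ s, s ∈ Ioo t T → (densityMeasure f₀).map (Z s) ≤ N • (volume : Measure Phase)) ∧
    m = densityMeasure f₀ (phaseBall r \ sublevel Z t T lam)}

/-- The largest mass that escapes. -/
noncomputable def escapeMass (T : ℝ) (N H : ℝ≥0∞) (r lam : ℝ) : ℝ≥0∞ :=
  sSup (escapeMasses T N H r lam)

theorem sublevel_mono (Z : ℝ → Phase → Phase) (t T : ℝ) {lam lam' : ℝ} (h : lam ≤ lam') :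
    sublevel Z t T lam ⊆ sublevel Z t T lam' := fun z hz => by
  change ∀ᵐ s ∂(volume.restrict (Icc t T)), phaseNorm (Z s z) ≤ lam'
  have hz' : ∀ᵐ s ∂(volume.restrict (Icc t T)), phaseNorm (Z s z) ≤ lam := hz
  filter_upwards [hz'] with s hs using hs.trans h

theorem escapeMass_le_one (T : ℝ) (N H : ℝ≥0∞) (r lam : ℝ) : escapeMass T N H r lam ≤ 1 := by
  refine sSup_le ?_
  rintro m ⟨t, L, f₀, ξ₀, η₀, f, ξ, η, Z, -, -, -, -, hM, -, -, -, -, -, -, -, rfl⟩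
  refine (measure_mono (subset_univ _)).trans ?_
  rw [densityMeasure_univ]
  exact hM.le

theorem escapeMass_antitone (T : ℝ) (N H : ℝ≥0∞) (r : ℝ) : Antitone (escapeMass T N H r) := by
  intro lam lam' hle
  refine sSup_le ?_
  rintro m ⟨t, L, f₀, ξ₀, η₀, f, ξ, η, Z, h1, h2, h3, h4, h5, h6, h7, h8, h9, h10, h11, h12, rfl⟩
  refine (measure_mono (sdiff_subset_sdiff_right (sublevel_mono Z t T hle))).trans ?_
  exact le_sSup ⟨t, L, f₀, ξ₀, η₀, f, ξ, η, Z, h1, h2, h3, h4, h5, h6, h7, h8, h9, h10, h11, h12,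
    rfl⟩

/-- The radius of `exists_sublevel_radius` is the same for all competitors in the supremum, because
they share `T`, `N`, `H` and `r`. -/
theorem tendsto_escapeMass (T : ℝ) {N : ℝ≥0∞} (hN : N ≠ ∞) (H : ℝ≥0∞) (r : ℝ) :
    Tendsto (escapeMass T N H r) atTop (𝓝 0) := by
  rw [ENNReal.tendsto_nhds_zero]
  intro ε hε
  -- Admissible data have finite energy, so for `H = ∞` the supremum is over the empty set.
  by_cases hH : H = ∞
  · refine Eventually.of_forall fun lam => sSup_le ?_
    rintro m ⟨t, L, f₀, ξ₀, η₀, f, ξ, η, Z, h1, h2, h3, h4, h5, h6, h7, -⟩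
    exact absurd (h7.trans hH) h6.ne
  · obtain ⟨R, hR⟩ := exists_sublevel_radius (N := N) (H := 2 + 4 * H)
      (K := √(2 * H.toReal) + 1) hN (by finiteness) (by linarith [Real.sqrt_nonneg (2 * H.toReal)])
      hε.ne' T r
    filter_upwards [eventually_ge_atTop R] with lam hlam
    refine sSup_le ?_
    rintro m ⟨t, L, f₀, ξ₀, η₀, f, ξ, η, Z, h1, h2, h3, h4, h5, h6, rfl, h8, h9, h10, h11, h12,
      rfl⟩
    obtain ⟨E, ξ', η', C, hc⟩ :=
      h8.exists_isControlledFlow h3 h4 h5 h6 h1 h2 h9 h10 h11 h12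
    exact hR t _ E ξ' η' C L Z hc lam hlam

end VPCharge

/-! ### The modulus and the two bounds -/

open VPCharge in
theorem lemma4p1 :
    ∃ g : ℝ → ℝ≥0∞ → ℝ≥0∞ → ℝ≥0∞ → ℝ≥0∞ → ℝ → ℝ → ℝ,
      (∀ (T : ℝ) (NE Nf M H : ℝ≥0∞) (r : ℝ), 0 < r →
        AntitoneOn (fun lam : ℝ => g T NE Nf M H r lam) (Ioi 0) ∧
        Tendsto (fun lam : ℝ => g T NE Nf M H r lam) atTop (𝓝 0)) ∧
      ∀ (T t : ℝ) (L : ℝ≥0∞) (f₀ : VPCharge.Phase → ℝ) (ξ₀ η₀ : VPCharge.Space)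
        (f : ℝ → VPCharge.Phase → ℝ) (ξ η : ℝ → VPCharge.Space)
        (Z : ℝ → VPCharge.Phase → VPCharge.Phase),
        0 ≤ t → t < T →
        Measurable f₀ → (∀ z, 0 ≤ f₀ z) → eLpNorm f₀ ⊤ volume < ⊤ →
        VPCharge.totalCharge f₀ < 1 →
        VPCharge.totalEnergy f₀ ξ₀ η₀ < ⊤ →
        VPCharge.IsLagrangianSolution T f₀ ξ₀ η₀ f ξ η →
        L < ⊤ →
        VPCharge.IsRegularLagrangianFlow (VPCharge.densityMeasure f₀) L
          (VPCharge.vectorField f ξ) t T Z →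
        -- the case in which `f` is transported by `Z`: the bound does not see `L`
        ((∀ s ∈ Icc t T, (VPCharge.densityMeasure f₀).map (Z s) =
              VPCharge.densityMeasure (f s)) →
          ∀ r lam : ℝ, 0 < r → 0 < lam →
            VPCharge.densityMeasure f₀
                (VPCharge.phaseBall r \ VPCharge.sublevel Z t T lam) ≤
              ENNReal.ofReal (g T (VPCharge.fieldNorm T f) (VPCharge.densityNorm T f)
                (VPCharge.totalCharge f₀) (VPCharge.totalEnergy f₀ ξ₀ η₀) r lam)) ∧
        -- an arbitrary regular Lagrangian flow of the same field, from an arbitrary time `t`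
        ∀ r lam : ℝ, 0 < r → 0 < lam →
          VPCharge.densityMeasure f₀
              (VPCharge.phaseBall r \ VPCharge.sublevel Z t T lam) ≤
            ENNReal.ofReal (g T (VPCharge.fieldNorm T f) (max (VPCharge.densityNorm T f) L)
              (VPCharge.totalCharge f₀) (VPCharge.totalEnergy f₀ ξ₀ η₀) r lam) := by
  have hfin : ∀ T N H r lam, escapeMass T N H r lam ≠ ∞ := fun T N H r lam =>
    ((escapeMass_le_one T N H r lam).trans_lt ENNReal.one_lt_top).ne
  -- For `N = ∞` there is no decay to rely on, and the default `0` keeps the modulus monotone and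
  -- vanishing at infinity. This value is never used, since the density norm and `L` are finite.
  refine ⟨fun T _ N _ H r lam => if N = ∞ then 0 else (escapeMass T N H r lam).toReal, ?_, ?_⟩
  · intro T NE N M H r _
    by_cases hN : N = ∞
    · simp only [hN, if_true]
      exact ⟨antitoneOn_const, tendsto_const_nhds⟩
    · simp only [hN, if_false]
      refine ⟨fun lam _ lam' _ hle => ENNReal.toReal_mono (hfin _ _ _ _ _)
        (escapeMass_antitone T N H r hle), ?_⟩
      have h := (ENNReal.tendsto_toReal ENNReal.zero_ne_top).comp (tendsto_escapeMass T hN H r)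
      simpa [Function.comp_def] using h
  · intro T t L f₀ ξ₀ η₀ f ξ η Z ht htT hf₀ hf₀0 _ hM hH hsol hL hZ
    have hNf := hsol.densityNorm_lt_top
    have key : ∀ N : ℝ≥0∞, N ≠ ∞ → densityNorm T f ≤ N →
        (∀ᵐ s, s ∈ Ioo t T → (densityMeasure f₀).map (Z s) ≤ N • (volume : Measure Phase)) →
        ∀ r lam : ℝ, densityMeasure f₀ (phaseBall r \ sublevel Z t T lam) ≤
          ENNReal.ofReal (if N = ∞ then 0 else
            (escapeMass T N (totalEnergy f₀ ξ₀ η₀) r lam).toReal) := by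
      intro N hN hNf hZN r lam
      rw [if_neg hN, ENNReal.ofReal_toReal (hfin _ _ _ _ _)]
      exact le_sSup ⟨t, L, f₀, ξ₀, η₀, f, ξ, η, Z, ht, htT, hf₀, hf₀0, hM, hH, rfl, hsol, hL.ne,
        hZ, hNf, hZN, rfl⟩
    refine ⟨fun htr r lam _ _ => ?_, fun r lam _ _ => ?_⟩
    -- When `f` is transported by `Z`, the density bound is itself a compression bound at almost
    -- every time, so `N` is the density norm alone.
    · refine key _ hNf.ne le_rfl ?_ r lam
      filter_upwards [ae_densityMeasure_le T f] with s hs hst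
      rw [htr s (Ioo_subset_Icc_self hst)]
      exact hs ⟨ht.trans hst.1.le, hst.2.le⟩
    · refine key _ (max_lt hNf hL).ne (le_max_left _ _) (Eventually.of_forall fun s hs => ?_) r lam
      refine (hZ.compression s (Ioo_subset_Icc_self hs)).trans fun S => ?_
      simp only [Measure.smul_apply, smul_eq_mul]
      gcongr
      exact le_max_right _ _
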